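/- Let $p$ be a prime and $F$ a finite extension of $\mathbb{Q}_p$, with ring of integers $\mathfrak{o}$, maximal ideal $\mathfrak{p}$, residue field of order $q$, normalized valuation $\mathrm{ord}$ and absolute value $|x|=q^{-\mathrm{ord}(x)}$, and different $\mathfrak{d}$ over $\mathbb{Q}_p$; put $e=\mathrm{ord}(2)$. Let $\psi:F\to\mathbb{C}^\times$ be an additive character such that the largest integer $c\ge 0$ with $\psi(\mathfrak{p}^{-c})=1$ equals $\mathrm{ord}(\mathfrak{d})$, and let $\delta\in F^\times$ have $\mathrm{ord}(\delta)=c$. Let $dx$ be the Haar measure on $F$ with $\mathrm{Vol}(\mathfrak{o})=1$. **The metaplectic group.** $\widetilde{SL_2(F)}=\{[g,\zeta] : g\in SL_2(F),\ \zeta=\pm1\}$ with $[g_1,\zeta_1][g_2,\zeta_2]=[g_1g_2,\zeta_1\zeta_2\,\mathbf{c}(g_1,g_2)]$, where $\mathbf{c}(g_1,g_2)=\left\langle \frac{\tau(g_1)}{\tau(g_1g_2)},\frac{\tau(g_2)}{\tau(g_1g_2)}\right\rangle$, $\langle\,,\rangle$ is the Hilbert symbol, and $\tau\begin{pmatrix}a&b\\c&d\end{pmatrix}$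 is $c$ if $c\ne0$ and $d$ if $c=0$. It has its usual topology as a double cover of $SL_2(F)$: a neighbourhood basis of the identity is given by the sets $\{[k,1] : k\in V\}$, $V$ a neighbourhood of $1$ in $SL_2(F)$. For $S\subset SL_2(F)$ let $\widetilde S$ be its inverse image. Write $[g]=[g,1]$ and $\mathbf{u}^\sharp(x)=\left[\begin{pmatrix}1&x\\0&1\end{pmatrix}\right]$, $\mathbf{m}(a)=\left[\begin{pmatrix}a&0\\0&a^{-1}\end{pmatrix}\right]$, $\mathbf{w}_a=\left[\begin{pmatrix}0&-a^{-1}\\a&0\end{pmatrix}\right]$ for $x\in F$, $a\in F^\times$. **The Weil representation.** Let $\mathcal{S}(F)$ be the space of locally constant compactly supported functions $F\to\mathbb{C}$, and $\hat\phi(x)=|\delta|^{1/2}\int_F\phi(y)\psi(xy)\,dy$. For $a\in F^\times$ the Weil constant $\alpha_\psi(a)$ is defined by $\int_F\phi(x)\psi(ax^2)\,dx=\alpha_\psi(a)|2a|^{-1/2}\int_F\hat\phi(x)\psi\left(-\frac{x^2}{4a}\right)dx$ for all $\phi\in\mathcal{S}(F)$. The Weil representation $\omega_\psi$ of $\widetilde{SL_2(F)}$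 on $\mathcal{S}(F)$ is given by $\omega_\psi([1,\zeta])\phi=\zeta\phi$ and $$\omega_\psi(\mathbf{m}(a))\phi(t)=\frac{\alpha_\psi(1)}{\alpha_\psi(a)}|a|^{1/2}\phi(at),\quad \omega_\psi(\mathbf{u}^\sharp(b))\phi(t)=\psi(bt^2)\phi(t),\quad \omega_\psi(\mathbf{w}_a)\phi(t)=\overline{\alpha_\psi(a)}\,|2a^{-1}|^{1/2}\hat\phi(-2a^{-1}t).$$ Put $(\phi_1,\phi_2)=\int_F\phi_1(t)\overline{\phi_2(t)}\,dt$ and let $\phi_0$ be the characteristic function of $\mathfrak{o}$. **The Hecke algebra.** Let $\Gamma[\mathfrak{a},\mathfrak{b}]$ be the set of $\begin{pmatrix}a&b\\c&d\end{pmatrix}\in SL_2(F)$ with $a,d\in\mathfrak{o}$, $b\in\mathfrak{a}$, $c\in\mathfrak{b}$, and put $\Gamma=\Gamma[\mathfrak{d}^{-1},4\mathfrak{d}]$, $\Lambda=\Gamma[\mathfrak{d}^{-1},\mathfrak{d}]$. Let $\varepsilon$ be the character of $\widetilde\Gamma$ with $\omega_\psi(\gamma)\phi_0=\varepsilon(\gamma)^{-1}\phi_0$.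 The Hecke algebra $\widetilde{\mathcal{H}}=\widetilde{\mathcal{H}}(\widetilde\Gamma\backslash\widetilde{SL_2(F)}/\widetilde\Gamma;\varepsilon)$ consists of the compactly supported locally constant functions $\phi:\widetilde{SL_2(F)}\to\mathbb{C}$ with $\phi(\gamma_1g\gamma_2)=\varepsilon(\gamma_1)\varepsilon(\gamma_2)\phi(g)$ for all $g\in\widetilde{SL_2(F)}$ and $\gamma_1,\gamma_2\in\widetilde\Gamma$, with the product $$(\phi_1*\phi_2)(g)=\int_{\widetilde{SL_2(F)}/\{\pm1\}}\phi_1(gh^{-1})\phi_2(h)\,dh,$$ where $\{\pm1\}$ denotes $\{[1,\pm1]\}$ and $dh$ is the Haar measure on $\widetilde{SL_2(F)}/\{\pm1\}=SL_2(F)$ for which $\Lambda$ has volume $1$. **The two functions.** Let $e^K(g)=q^e\,(\phi_0,\omega_\psi(g)\phi_0)$ for $g\in\widetilde\Lambda$, $e^K(g)=0$ for $g\in\widetilde{SL_2(F)}\setminus\widetilde\Lambda$, and $E^K(g)=e^K(\mathbf{w}_{2\delta}^{-1}\,g\,\mathbf{w}_{2\delta})$ for $g\in\widetilde{SL_2(F)}$.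 **Proposition.** $e^K$ and $E^K$ are idempotents in $\widetilde{\mathcal{H}}$: that is, $e^K,E^K\in\widetilde{\mathcal{H}}$, $e^K*e^K=e^K$ and $E^K*E^K=E^K$. -/

import Mathlib

open MeasureTheory ValuativeRel
open scoped MatrixGroups ComplexConjugate

noncomputable section

namespace Metaplectic

/-! ### The local field -/

section LocalField

variable (F : Type*) [Field F] [ValuativeRel F] [TopologicalSpace F]
  [IsNonarchimedeanLocalField F]

/-- The order `q` of the residue field. -/
def resCard : ℕ := Nat.card 𝓀[F]

variable {F}

/-- The normalized additive valuation `ord` (a prime element has order `1`); by convention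
`ord 0 = 0`. -/
def ord (x : F) : ℤ :=
  -WithZero.log (IsNonarchimedeanLocalField.valueGroupWithZeroIsoInt F (valuation F x))

open Classical in
/-- The normalized absolute value `|x| = q ^ (-ord x)`, `|0| = 0`. -/
def nabs (x : F) : ℝ := if x = 0 then 0 else (resCard F : ℝ) ^ (-ord x)

variable (F)

/-- The fractional ideal `𝔭 ^ n`, `n ∈ ℤ`. -/
def primePow (n : ℤ) : Set F := {x | x = 0 ∨ n ≤ ord x}

/-- The inverse different `𝔡⁻¹ = {x | Tr (x 𝔬) ⊆ ℤ_p}` of `F / ℚ_p`. -/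
def codifferent (p : ℕ) [Fact p.Prime] [Algebra ℚ_[p] F] : Set F :=
  {x | ∀ y ∈ 𝒪[F], ‖Algebra.trace ℚ_[p] F (x * y)‖ ≤ 1}

/-- The different `𝔡` of `F / ℚ_p`, the inverse of the fractional ideal `𝔡⁻¹`. -/
def different (p : ℕ) [Fact p.Prime] [Algebra ℚ_[p] F] : Set F :=
  {x | ∀ y ∈ codifferent F p, x * y ∈ 𝒪[F]}

/-- The ring of integers as a compact set with non-empty interior. -/
def intCompacts : TopologicalSpace.PositiveCompacts F where
  carrier := {x | valuation F x ≤ 1}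
  isCompact' := IsNonarchimedeanLocalField.isCompact_closedBall F 1
  interior_nonempty' := by
    refine ⟨0, mem_interior_iff_mem_nhds.mpr ?_⟩
    refine (IsValuativeTopology.mem_nhds_iff (R := F)).mpr ⟨1, fun x hx => ?_⟩
    obtain ⟨y, hy, rfl⟩ := hx
    simpa using le_of_lt hy

/-- The Haar measure `dx` on `F` with `Vol(𝔬) = 1`. -/
def haarF [MeasurableSpace F] [BorelSpace F] : Measure F :=
  Measure.addHaarMeasure (intCompacts F)

/-- The order of an additive character is `c`: this is the largest non-negative integer with
`ψ (𝔭 ^ (-c)) = 1`. (It forces `ψ` to be continuous and non-trivial.) -/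
def HasOrder (ψ : AddChar F ℂ) (c : ℕ) : Prop :=
  IsGreatest {n : ℕ | ∀ x ∈ primePow F (-(n : ℤ)), ψ x = 1} c

end LocalField

/-! ### The metaplectic group -/

section Group

variable {F : Type*} [Field F]

open Classical in
/-- The (quadratic) Hilbert symbol `⟨a, b⟩`, for `a, b ≠ 0`. -/
def hilbertSymbol (a b : F) : ℤˣ :=
  if ∃ x y z : F, (x ≠ 0 ∨ y ≠ 0 ∨ z ≠ 0) ∧ a * x ^ 2 + b * y ^ 2 = z ^ 2 then 1 else -1

open Classical in
/-- `τ(g)` is the lower left entry of `g` if it is non-zero, else the lower right entry. -/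
def tau (g : SL(2, F)) : F := if g.1 1 0 ≠ 0 then g.1 1 0 else g.1 1 1

/-- Kubota's 2-cocycle. -/
def kubota (g h : SL(2, F)) : ℤˣ :=
  hilbertSymbol (tau g / tau (g * h)) (tau h / tau (g * h))

variable (F) in
/-- The underlying set of the metaplectic double cover of `SL₂(F)`: the pairs `[g, ζ]`. -/
@[ext]
structure Mp where
  /-- the projection to `SL₂(F)` -/
  g : SL(2, F)
  /-- the sign -/
  ζ : ℤˣ

instance : Mul (Mp F) := ⟨fun x y => ⟨x.g * y.g, x.ζ * y.ζ * kubota x.g y.g⟩⟩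

/-- The inverse for the metaplectic multiplication. -/
instance : Inv (Mp F) := ⟨fun x => ⟨x.g⁻¹, x.ζ * kubota x.g x.g⁻¹⟩⟩

/-- `[g] = [g, 1]`. -/
def bracket (g : SL(2, F)) : Mp F := ⟨g, 1⟩

/-- The inverse image in the metaplectic group of a subset of `SL₂(F)`. -/
def tilde (S : Set SL(2, F)) : Set (Mp F) := {x | x.g ∈ S}

/-- `w_a = [(0, -a⁻¹; a, 0)]` for `a ≠ 0`. -/
def wElt (a : F) (ha : a ≠ 0) : Mp F :=
  bracket ⟨!![0, -a⁻¹; a, 0], by simp [Matrix.det_fin_two_of, ha]⟩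

/-- The topology of the metaplectic group over a non-archimedean local field. On a small compact
open subgroup of `SL₂(F)` (where the lower right entry is a square) Kubota's cocycle is trivial, so
that `k ↦ [k]` is a homomorphic section there; the group topology is the one for which the sets
`{[k] | k ∈ V}`, with `V` a neighbourhood of `1` in `SL₂(F)`, form a neighbourhood basis of `1`,
and hence the sets `{x [k] | k ∈ V}` one of `x`. -/
instance [TopologicalSpace F] : TopologicalSpace (Mp F) where
  IsOpen U := ∀ x ∈ U, ∃ V ∈ nhds (1 : SL(2, F)), ∀ k ∈ V, x * bracket k ∈ U
  isOpen_univ := fun _ _ => ⟨Set.univ, Filter.univ_mem, fun _ _ => trivial⟩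
  isOpen_inter := by
    rintro U₁ U₂ h₁ h₂ x ⟨hx₁, hx₂⟩
    obtain ⟨V₁, hV₁, h₁⟩ := h₁ x hx₁
    obtain ⟨V₂, hV₂, h₂⟩ := h₂ x hx₂
    exact ⟨V₁ ∩ V₂, Filter.inter_mem hV₁ hV₂, fun k hk => ⟨h₁ k hk.1, h₂ k hk.2⟩⟩
  isOpen_sUnion := by
    rintro S hS x ⟨U, hU, hx⟩
    obtain ⟨V, hV, h⟩ := hS U hU x hx
    exact ⟨V, hV, fun k hk => ⟨U, hU, h k hk⟩⟩

end Group

/-! ### The Weil representation -/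

section Weil

variable {F : Type*} [Field F] [ValuativeRel F] [TopologicalSpace F]
  [IsNonarchimedeanLocalField F] [MeasurableSpace F] [BorelSpace F]
  (ψ : AddChar F ℂ) (δ : F)

/-- The Fourier transform `φ̂(x) = |δ|^{1/2} ∫ φ(y) ψ(xy) dy`. -/
def fourierT (φ : F → ℂ) (x : F) : ℂ :=
  (Real.sqrt (nabs δ) : ℂ) * ∫ y, φ y * ψ (x * y) ∂haarF F

/-- `γ` satisfies the identity that defines the Weil constant at `a`: for all Schwartz (locally
constant and compactly supported) functions `φ`,
`∫ φ(x) ψ(a x²) dx = γ |2a|^{-1/2} ∫ φ̂(x) ψ(- x² / (4a)) dx`. -/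
def IsWeilConstant (a : F) (γ : ℂ) : Prop :=
  ∀ φ : F → ℂ, IsLocallyConstant φ → HasCompactSupport φ →
    ∫ x, φ x * ψ (a * x ^ 2) ∂haarF F =
      γ * ((Real.sqrt (nabs (2 * a)))⁻¹ : ℝ) *
        ∫ x, fourierT ψ δ φ x * ψ (-(x ^ 2 / (4 * a))) ∂haarF F

/-- The Weil constant `α_ψ(a)`, `a ≠ 0`. -/
def weilConst (a : F) : ℂ := Classical.epsilon (IsWeilConstant ψ δ a)

/-- `ω_ψ(u♯(b)) φ(t) = ψ(b t²) φ(t)`. -/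
def weilU (b : F) (φ : F → ℂ) (t : F) : ℂ := ψ (b * t ^ 2) * φ t

/-- `ω_ψ(m(a)) φ(t) = (α_ψ(1) / α_ψ(a)) |a|^{1/2} φ(a t)`. -/
def weilM (a : F) (φ : F → ℂ) (t : F) : ℂ :=
  weilConst ψ δ 1 / weilConst ψ δ a * (Real.sqrt (nabs a) : ℂ) * φ (a * t)

/-- `ω_ψ(w_a) φ(t) = conj (α_ψ(a)) |2 a⁻¹|^{1/2} φ̂(-2 a⁻¹ t)`. -/
def weilW (a : F) (φ : F → ℂ) (t : F) : ℂ :=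
  conj (weilConst ψ δ a) * (Real.sqrt (nabs (2 * a⁻¹)) : ℂ) * fourierT ψ δ φ (-2 * a⁻¹ * t)

open Classical in
/-- The Weil representation. For `g = (a, b; c, d)` one has the exact identities in the metaplectic
group `[g] = u♯(a/c) w_c u♯(d/c)` if `c ≠ 0`, and `[g] = u♯(ab) m(a)` if `c = 0`; the central
element `[1, ζ]` acts by the scalar `ζ`. -/
def weil (x : Mp F) (φ : F → ℂ) : F → ℂ :=
  let a := x.g.1 0 0
  let b := x.g.1 0 1
  let c := x.g.1 1 0
  let d := x.g.1 1 1
  ((x.ζ : ℤ) : ℂ) •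
    (if c ≠ 0 then weilU ψ (a / c) (weilW ψ δ c (weilU ψ (d / c) φ))
      else weilU ψ (a * b) (weilM ψ δ a φ))

/-- The inner product `(φ₁, φ₂) = ∫ φ₁(t) conj (φ₂(t)) dt`. -/
def innerF (φ₁ φ₂ : F → ℂ) : ℂ := ∫ t, φ₁ t * conj (φ₂ t) ∂haarF F

variable (F) in
/-- `φ₀`, the characteristic function of `𝔬`. -/
def phi0 : F → ℂ := Set.indicator {x | x ∈ 𝒪[F]} 1

end Weil

/-! ### Congruence subgroups, the Hecke algebra and the two functions -/

section Hecke

variable (F : Type*) [Field F] [ValuativeRel F] [TopologicalSpace F]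
  [IsNonarchimedeanLocalField F]

/-- `Γ[𝔞, 𝔟]`: the matrices `(a, b; c, d)` of determinant one with `a, d ∈ 𝔬`, `b ∈ 𝔞`, `c ∈ 𝔟`. -/
def congrGroup (𝔞 𝔟 : Set F) : Set SL(2, F) :=
  {g | g.1 0 0 ∈ 𝒪[F] ∧ g.1 1 1 ∈ 𝒪[F] ∧ g.1 0 1 ∈ 𝔞 ∧ g.1 1 0 ∈ 𝔟}

/-- `Γ = Γ[𝔡⁻¹, 4𝔡]`. -/
def Gam (p : ℕ) [Fact p.Prime] [Algebra ℚ_[p] F] : Set SL(2, F) :=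
  congrGroup F (codifferent F p) ((fun x => 4 * x) '' different F p)

/-- `Λ = Γ[𝔡⁻¹, 𝔡]`. -/
def Lam (p : ℕ) [Fact p.Prime] [Algebra ℚ_[p] F] : Set SL(2, F) :=
  congrGroup F (codifferent F p) (different F p)

variable {F}
variable [MeasurableSpace F] [BorelSpace F]
  (p : ℕ) [Fact p.Prime] [Algebra ℚ_[p] F] (ψ : AddChar F ℂ) (δ : F)

/-- The genuine character `ε` of the inverse image of `Γ`. It is given by
`ω_ψ(γ) φ₀ = ε(γ)⁻¹ φ₀`, and `φ₀(0) = 1`. -/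
def eps (γ : Mp F) : ℂ := (weil ψ δ γ (phi0 F) 0)⁻¹

/-- The Hecke algebra, as a space of functions: the compactly supported locally constant functions
`φ` on the metaplectic group with `φ(γ₁ g γ₂) = ε(γ₁) ε(γ₂) φ(g)` for `γ₁, γ₂` in the inverse image
of `Γ`. Its multiplication is `conv` below. -/
def heckeAlg : Submodule ℂ (Mp F → ℂ) where
  carrier := {φ | IsLocallyConstant φ ∧ HasCompactSupport φ ∧
    ∀ γ₁ ∈ tilde (Gam F p), ∀ γ₂ ∈ tilde (Gam F p), ∀ g : Mp F,
      φ (γ₁ * g * γ₂) = eps ψ δ γ₁ * eps ψ δ γ₂ * φ g}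
  add_mem' := by
    rintro φ φ' ⟨h₁, h₂, h₃⟩ ⟨h₁', h₂', h₃'⟩
    refine ⟨h₁.add h₁', h₂.add h₂', fun γ₁ hγ₁ γ₂ hγ₂ g => ?_⟩
    simp only [Pi.add_apply, h₃ γ₁ hγ₁ γ₂ hγ₂ g, h₃' γ₁ hγ₁ γ₂ hγ₂ g]
    ring
  zero_mem' := ⟨IsLocallyConstant.const 0, HasCompactSupport.zero, by simp⟩
  smul_mem' := by
    rintro z φ ⟨h₁, h₂, h₃⟩
    refine ⟨h₁.comp (z • ·), h₂.smul_left (f := fun _ => z), fun γ₁ hγ₁ γ₂ hγ₂ g => ?_⟩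
    simp only [Pi.smul_apply, h₃ γ₁ hγ₁ γ₂ hγ₂ g, smul_eq_mul]
    ring

/-- The convolution product `(φ₁ ∗ φ₂)(g) = ∫ φ₁(g h⁻¹) φ₂(h) dh` over the metaplectic group modulo
`{±1}`. This quotient is `SL₂(F)`, on which `μ` is a Haar measure; the integrand, which for genuine
`φ₁, φ₂` depends only on the class of `h`, is evaluated at the representative `[h, 1]`. -/
def conv {F : Type*} [Field F] [MeasurableSpace SL(2, F)] (μ : Measure SL(2, F))
    (φ₁ φ₂ : Mp F → ℂ) (g : Mp F) : ℂ :=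
  ∫ h : SL(2, F), φ₁ (g * (bracket h)⁻¹) * φ₂ (bracket h) ∂μ

open Classical in
/-- `e^K(g) = q^e (φ₀, ω_ψ(g) φ₀)`, with `e = ord 2`, on the inverse image of `Λ`, and `0` elsewhere. -/
def eK (g : Mp F) : ℂ :=
  if g ∈ tilde (Lam F p) then
    (resCard F : ℂ) ^ ord (2 : F) * innerF (phi0 F) (weil ψ δ g (phi0 F))
  else 0

theorem two_ne_zero_of_padic {F : Type*} [Field F] (p : ℕ) [Fact p.Prime] [Algebra ℚ_[p] F] :
    (2 : F) ≠ 0 := by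
  have : CharZero F := charZero_of_injective_algebraMap (algebraMap ℚ_[p] F).injective
  exact two_ne_zero

/-- `E^K(g) = e^K(w_{2δ}⁻¹ g w_{2δ})`. -/
def EK (hδ0 : δ ≠ 0) (g : Mp F) : ℂ :=
  let w : Mp F := wElt (2 * δ) (mul_ne_zero (two_ne_zero_of_padic p) hδ0)
  eK p ψ δ (w⁻¹ * g * w)

end Hecke

end Metaplectic

end

open Metaplectic

/-!
Both functions are the matrix coefficient `q^e (φ₀, ω_ψ(g) φ₀)` restricted to the inverse image of
a conjugate `n Λ n⁻¹`, with `n = 1` for `e^K` and `n = w_{2δ}` for `E^K`; here `φ₀` is an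
eigenvector of `ω_ψ([n])`, so conjugation by `[n]` moves the support but not the coefficient
(`eK_eq_coeffOn`, `EK_eq_coeffOn`). Such a function is idempotent by an orthogonality relation of
Schur type for the finite-dimensional representation of `Λ` on the `𝔬`-periodic functions with
support in `½ 𝔬`, whose dimension is `|2|⁻¹ = q^e` (`integral_innerF_mul_innerF`,
`conv_coeffOn_conjGroup`).

The orthogonality relation is proved without showing irreducibility. This space is stable
under `Λ` (`IsBounded.weil_of_mem`). For `f_h = ω_ψ([h⁻¹]) φ₀`, the average of `conj f_h(s) f_h(t)`
over `h ∈ Λ` is invariant under right translations of `Λ`. The upper unipotent elements act by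
the characters `b ↦ ψ(b s²)`, which are distinct for distinct `s ∈ ½ 𝔬 / 𝔬`, so the average vanishes
off the diagonal (`averagedKernel_eq_zero`). A Weyl element expresses the value at `(0, 0)` by the
average of the diagonal values, whose sum is `(f_h, f_h) = 1`; so this value is `|2|`
(`averagedKernel_zero_zero`). For `n = w_{2δ}` the integral over `n Λ n⁻¹` is moved to `Λ` by
translations on both sides, which preserve the Haar measure because `n²` is central
(`rightInvariantUnder_of_sq_central`).

All this needs the Weil representation to be a homomorphism on the metaplectic group (`weil_mul`)
and unitary (`innerF_weil`). In terms of the Bruhat decomposition, the Kubota cocycle is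
the Hilbert symbol in Weil's formula `α(a) α(b) = ⟨a, b⟩ α(1) α(ab)` (`weilConst_mul`). The constants
`α(a)` are regularized Gauss integrals (`weilConst_eq`), and `α(t) α(-td)` depends only on the values
represented by the form `t (x² - d y²)`. The norm group of `F(√d)` has index two
(`index_range_norm`), so at most two values of this product occur. That they are opposite follows
from an integral of products of Gauss integrals over a shell in `t`, which vanishes because the norm
form is anisotropic (`integral_gaussInt_mul_gaussInt`). The index of the norm group in turn comes from
counting square classes, in `F` and in `F(√d)` modulo scalars, by Hensel's lemma.

Finally, `φ₀` is an eigenvector of the inverse image of `Γ` (`latticeGroup_le_eigenGroup`), which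
gives the transformation behaviour under `ε`; local constancy and compactness of the support in the
metaplectic topology hold because a small principal congruence subgroup fixes `φ₀`, so that
the cocycle is trivial on it (`kubota_eq_one`, `coeffOn_mem_heckeAlg`).
-/

namespace Metaplectic

/-! ### The normalized valuation -/

section Valuation

variable {F : Type*} [Field F] [ValuativeRel F] [TopologicalSpace F]
  [IsNonarchimedeanLocalField F]

lemma valIso_ne_zero {x : F} (hx : x ≠ 0) :
    IsNonarchimedeanLocalField.valueGroupWithZeroIsoInt F (valuation F x) ≠ 0 := by
  simpa using hx

@[simp] lemma ord_zero : ord (0 : F) = 0 := by simp [ord]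

@[simp] lemma ord_one : ord (1 : F) = 0 := by simp [ord]

lemma ord_mul {x y : F} (hx : x ≠ 0) (hy : y ≠ 0) : ord (x * y) = ord x + ord y := by
  simp only [ord, map_mul]
  rw [WithZero.log_mul (valIso_ne_zero hx) (valIso_ne_zero hy)]
  ring

@[simp] lemma ord_inv (x : F) : ord x⁻¹ = -ord x := by
  by_cases hx : x = 0
  · simp [hx]
  · have := ord_mul hx (inv_ne_zero hx)
    rw [mul_inv_cancel₀ hx, ord_one] at this
    linarith

lemma ord_div {x y : F} (hx : x ≠ 0) (hy : y ≠ 0) : ord (x / y) = ord x - ord y := by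
  rw [div_eq_mul_inv, ord_mul hx (inv_ne_zero hy), ord_inv]; ring

@[simp] lemma ord_neg (x : F) : ord (-x) = ord x := by simp [ord, Valuation.map_neg]

@[simp] lemma ord_pow (x : F) (n : ℕ) : ord (x ^ n) = n * ord x := by
  by_cases hx : x = 0
  · rcases n with - | n <;> simp [hx]
  · induction n with
    | zero => simp
    | succ n ih => rw [pow_succ, ord_mul (pow_ne_zero _ hx) hx, ih]; push_cast; ring

@[simp] lemma ord_zpow (x : F) (n : ℤ) : ord (x ^ n) = n * ord x := by
  cases n with
  | ofNat n => simp
  | negSucc n => rw [zpow_negSucc, ord_inv, ord_pow]; push_cast [Int.negSucc_eq]; ring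

lemma valuation_le_iff {x y : F} (hx : x ≠ 0) (hy : y ≠ 0) :
    valuation F x ≤ valuation F y ↔ ord y ≤ ord x := by
  rw [← (IsNonarchimedeanLocalField.valueGroupWithZeroIsoInt F).strictMono.le_iff_le,
    ← WithZero.log_le_log (valIso_ne_zero hx) (valIso_ne_zero hy)]
  simp [ord]

lemma valuation_le_iff_mem {x y : F} (hy : y ≠ 0) :
    valuation F x ≤ valuation F y ↔ x ∈ primePow F (ord y) := by
  by_cases hx : x = 0
  · simp [hx, primePow]
  · rw [valuation_le_iff hx hy]; simp [primePow, hx]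

lemma mem_integers_iff {x : F} : x ∈ 𝒪[F] ↔ x ∈ primePow F 0 := by
  rw [Valuation.mem_integer_iff, ← map_one (valuation F), valuation_le_iff_mem one_ne_zero,
    ord_one]

variable (F) in
lemma exists_ord_eq (n : ℤ) : ∃ x : F, x ≠ 0 ∧ ord x = n := by
  obtain ⟨y, hy⟩ := (IsNonarchimedeanLocalField.valueGroupWithZeroIsoInt F).surjective
    (WithZero.exp (-n))
  obtain ⟨x, rfl⟩ := ValuativeRel.valuation_surjective y
  change IsNonarchimedeanLocalField.valueGroupWithZeroIsoInt F (valuation F x) = _ at hy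
  refine ⟨x, ?_, by simp [ord, hy]⟩
  rintro rfl
  simp only [map_zero] at hy
  exact WithZero.exp_ne_zero hy.symm

lemma mem_primePow {x : F} {n : ℤ} : x ∈ primePow F n ↔ x = 0 ∨ n ≤ ord x := Iff.rfl

lemma mem_primePow_of_ne {x : F} (hx : x ≠ 0) {n : ℤ} : x ∈ primePow F n ↔ n ≤ ord x := by
  simp [mem_primePow, hx]

@[simp] lemma zero_mem_primePow (n : ℤ) : (0 : F) ∈ primePow F n := Or.inl rfl

lemma primePow_anti {m n : ℤ} (h : m ≤ n) : primePow F n ⊆ primePow F m := by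
  rintro x (hx | hx)
  · exact Or.inl hx
  · exact Or.inr (h.trans hx)

lemma add_mem_primePow {n : ℤ} {x y : F} (hx : x ∈ primePow F n) (hy : y ∈ primePow F n) :
    x + y ∈ primePow F n := by
  obtain ⟨z, hz, rfl⟩ := exists_ord_eq F n
  rw [← valuation_le_iff_mem hz] at *
  exact (Valuation.map_add _ _ _).trans (max_le hx hy)

@[simp] lemma neg_mem_primePow {n : ℤ} {x : F} : -x ∈ primePow F n ↔ x ∈ primePow F n := by
  simp [mem_primePow]

lemma sub_mem_primePow {n : ℤ} {x y : F} (hx : x ∈ primePow F n) (hy : y ∈ primePow F n) :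
    x - y ∈ primePow F n := by
  rw [sub_eq_add_neg]; exact add_mem_primePow hx (neg_mem_primePow.2 hy)

lemma add_mem_primePow_iff {n : ℤ} {x y : F} (hy : y ∈ primePow F n) :
    x + y ∈ primePow F n ↔ x ∈ primePow F n :=
  ⟨fun h => by simpa using sub_mem_primePow h hy, fun h => add_mem_primePow h hy⟩

lemma mul_mem_primePow {m n : ℤ} {x y : F} (hx : x ∈ primePow F m) (hy : y ∈ primePow F n) :
    x * y ∈ primePow F (m + n) := by
  by_cases hx0 : x = 0
  · simp [hx0]
  by_cases hy0 : y = 0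
  · simp [hy0]
  rw [mem_primePow_of_ne hx0] at hx
  rw [mem_primePow_of_ne hy0] at hy
  rw [mem_primePow_of_ne (mul_ne_zero hx0 hy0), ord_mul hx0 hy0]
  linarith

lemma mul_mem_primePow_iff {n : ℤ} {a x : F} (ha : a ≠ 0) :
    a * x ∈ primePow F n ↔ x ∈ primePow F (n - ord a) := by
  by_cases hx : x = 0
  · simp [hx]
  rw [mem_primePow_of_ne (mul_ne_zero ha hx), mem_primePow_of_ne hx, ord_mul ha hx]
  constructor <;> intro h <;> linarith

lemma self_mem_primePow (x : F) : x ∈ primePow F (ord x) := Or.inr le_rfl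

lemma one_mem_primePow_zero : (1 : F) ∈ primePow F 0 := Or.inr (by simp)

lemma ord_add_eq_left {x y : F} (hx : x ≠ 0) (hy : y ∈ primePow F (ord x + 1)) :
    x + y ≠ 0 ∧ ord (x + y) = ord x := by
  have h1 : x + y ≠ 0 := by
    intro h
    rw [← neg_mem_primePow, ← eq_neg_of_add_eq_zero_left h, mem_primePow_of_ne hx] at hy
    linarith
  refine ⟨h1, le_antisymm ?_ ?_⟩
  · by_contra! h
    have h2 : x + y ∈ primePow F (ord x + 1) := (mem_primePow_of_ne h1).2 h
    rw [add_mem_primePow_iff hy, mem_primePow_of_ne hx] at h2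
    linarith
  · exact (mem_primePow_of_ne h1).1
      (add_mem_primePow (self_mem_primePow x) (primePow_anti (by linarith) hy))

variable (F) in
/-- The fractional ideal `𝔭 ^ n` as an additive subgroup of `F`. -/
def primePowAdd (n : ℤ) : AddSubgroup F where
  carrier := primePow F n
  add_mem' := add_mem_primePow
  zero_mem' := zero_mem_primePow n
  neg_mem' := neg_mem_primePow.2

lemma mem_maximalIdeal_iff {y : 𝒪[F]} :
    y ∈ IsLocalRing.maximalIdeal 𝒪[F] ↔ (y : F) ∈ primePow F 1 := by
  rw [IsLocalRing.mem_maximalIdeal, mem_nonunits_iff, not_iff_comm]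
  by_cases hy : (y : F) = 0
  · have : y = 0 := Subtype.ext hy
    simp [this]
  have hyi := mem_integers_iff.1 y.2
  rw [mem_primePow_of_ne hy] at hyi ⊢
  constructor
  · intro h
    have h0 : ord (y : F) = 0 := by omega
    have : (y : F)⁻¹ ∈ 𝒪[F] := by
      rw [mem_integers_iff, mem_primePow_of_ne (inv_ne_zero hy)]; simp [h0]
    exact IsUnit.of_mul_eq_one ⟨_, this⟩ (Subtype.ext (mul_inv_cancel₀ hy))
  · rintro h h1
    obtain ⟨w, hw⟩ := h.exists_right_inv
    have hw' : (y : F) * w = 1 := congrArg Subtype.val hw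
    have hw0 : (w : F) ≠ 0 := by rintro h; simp [h] at hw'
    have := ord_mul hy hw0
    rw [hw', ord_one] at this
    have hwi := mem_integers_iff.1 w.2
    rw [mem_primePow_of_ne hw0] at hwi
    omega

/-! ### Topology and Haar measure of a local field -/

lemma primePow_eq_smul {n : ℤ} {y : F} (hy : y ≠ 0) (h : ord y = n) :
    primePow F n = {x | valuation F x ≤ valuation F y} := by
  ext x; subst h; exact (valuation_le_iff_mem hy).symm

lemma isCompact_primePow (n : ℤ) : IsCompact (primePow F n) := by
  obtain ⟨y, hy, h⟩ := exists_ord_eq F n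
  rw [primePow_eq_smul hy h]
  exact IsNonarchimedeanLocalField.isCompact_closedBall F _

lemma primePow_mem_nhds_zero (n : ℤ) : primePow F n ∈ nhds (0 : F) := by
  obtain ⟨y, hy, h⟩ := exists_ord_eq F n
  refine (IsValuativeTopology.mem_nhds_iff (R := F)).mpr
    ⟨Units.mk0 (valuation F y) (by simpa using hy), ?_⟩
  rintro - ⟨z, hz, rfl⟩
  rw [primePow_eq_smul hy h]
  simpa using le_of_lt hz

lemma isOpen_primePow (n : ℤ) : IsOpen (primePow F n) :=
  AddSubgroup.isOpen_of_mem_nhds (primePowAdd F n) (primePow_mem_nhds_zero n)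

lemma isClosed_primePow (n : ℤ) : IsClosed (primePow F n) :=
  AddSubgroup.isClosed_of_isOpen (primePowAdd F n) (isOpen_primePow n)

lemma exists_primePow_subset {U : Set F} (hU : U ∈ nhds (0 : F)) : ∃ n, primePow F n ⊆ U := by
  obtain ⟨γ, hγ⟩ := (IsValuativeTopology.mem_nhds_iff (R := F)).mp hU
  obtain ⟨y, hy⟩ := ValuativeRel.valuation_surjective (γ : ValueGroupWithZero F)
  have hy0 : y ≠ 0 := by
    rintro rfl
    exact γ.ne_zero (by simpa using hy.symm)
  refine ⟨ord y + 1, fun x hx => hγ ⟨x, ?_, by simp⟩⟩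
  change valuation F x < γ
  rw [← hy]
  rw [lt_iff_not_ge]
  intro h
  by_cases hx0 : x = 0
  · subst hx0; simp at h; exact hy0 h
  · rw [valuation_le_iff hy0 hx0] at h
    rw [mem_primePow_of_ne hx0] at hx
    linarith

lemma mem_nhds_iff_primePow {U : Set F} {x : F} :
    U ∈ nhds x ↔ ∃ n, ∀ y ∈ primePow F n, x + y ∈ U := by
  constructor
  · intro h
    have : (fun y => x + y) ⁻¹' U ∈ nhds (0 : F) :=
      (continuous_const_add x).continuousAt.preimage_mem_nhds (by simpa using h)
    exact exists_primePow_subset this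
  · rintro ⟨n, hn⟩
    have : (fun y => y - x) ⁻¹' primePow F n ∈ nhds x :=
      (continuous_sub_right x).continuousAt.preimage_mem_nhds
        (by simpa using primePow_mem_nhds_zero n)
    filter_upwards [this] with y hy
    simpa using hn _ hy

variable (F) in
lemma t2Space : T2Space F := by
  have : T1Space F := by
    refine ⟨fun x => ?_⟩
    rw [← isOpen_compl_iff, isOpen_iff_mem_nhds]
    intro y hy
    rw [mem_nhds_iff_primePow]
    refine ⟨ord (y - x) + 1, fun z hz h => ?_⟩
    have hyx : y - x ≠ 0 := sub_ne_zero.2 hy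
    have h' : y + z = x := h
    have : y - x = -z := by linear_combination h'
    rw [this, neg_mem_primePow.symm, ← this, mem_primePow_of_ne hyx] at hz
    linarith
  infer_instance

/-! ### The absolute value -/

variable (F) in
lemma one_lt_resCard : 1 < resCard F := Finite.one_lt_card

variable (F) in
lemma resCard_pos : (0 : ℝ) < resCard F := by
  exact_mod_cast (zero_lt_one.trans (one_lt_resCard F))

lemma nabs_of_ne {x : F} (hx : x ≠ 0) : nabs x = (resCard F : ℝ) ^ (-ord x) := by simp [nabs, hx]

@[simp] lemma nabs_zero : nabs (0 : F) = 0 := by simp [nabs]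

@[simp] lemma nabs_one : nabs (1 : F) = 1 := by simp [nabs]

lemma nabs_pos {x : F} (hx : x ≠ 0) : 0 < nabs x := by
  rw [nabs_of_ne hx]; exact zpow_pos (resCard_pos F) _

lemma nabs_nonneg (x : F) : 0 ≤ nabs x := by
  by_cases hx : x = 0
  · simp [hx]
  · exact (nabs_pos hx).le

lemma nabs_ne_zero {x : F} (hx : x ≠ 0) : nabs x ≠ 0 := (nabs_pos hx).ne'

@[simp] lemma nabs_mul (x y : F) : nabs (x * y) = nabs x * nabs y := by
  by_cases hx : x = 0
  · simp [hx]
  by_cases hy : y = 0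
  · simp [hy]
  rw [nabs_of_ne hx, nabs_of_ne hy, nabs_of_ne (mul_ne_zero hx hy), ord_mul hx hy,
    ← zpow_add₀ (resCard_pos F).ne']
  congr 1; ring

@[simp] lemma nabs_inv (x : F) : nabs x⁻¹ = (nabs x)⁻¹ := by
  by_cases hx : x = 0
  · simp [hx]
  · rw [nabs_of_ne hx, nabs_of_ne (inv_ne_zero hx), ord_inv, ← zpow_neg]

@[simp] lemma nabs_div (x y : F) : nabs (x / y) = nabs x / nabs y := by
  simp [div_eq_mul_inv]

@[simp] lemma nabs_neg (x : F) : nabs (-x) = nabs x := by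
  by_cases hx : x = 0
  · simp [hx]
  · rw [nabs_of_ne hx, nabs_of_ne (neg_ne_zero.2 hx), ord_neg]

@[simp] lemma nabs_pow (x : F) (n : ℕ) : nabs (x ^ n) = nabs x ^ n := by
  induction n with
  | zero => simp
  | succ n ih => rw [pow_succ, nabs_mul, ih, pow_succ]

end Valuation

section Haar

variable {F : Type*} [Field F] [ValuativeRel F] [TopologicalSpace F]
  [IsNonarchimedeanLocalField F] [MeasurableSpace F] [BorelSpace F]

instance : (haarF F).IsAddHaarMeasure := by unfold haarF; infer_instance

omit [MeasurableSpace F] [BorelSpace F] in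
lemma coe_intCompacts : (intCompacts F : Set F) = primePow F 0 := by
  rw [primePow_eq_smul (y := 1) one_ne_zero ord_one, map_one]; rfl

lemma haarF_primePow_zero : haarF F (primePow F 0) = 1 := by
  rw [← coe_intCompacts]; exact Measure.addHaarMeasure_self

lemma measurableSet_primePow (n : ℤ) : MeasurableSet (primePow F n) :=
  (isOpen_primePow n).measurableSet

omit [MeasurableSpace F] [BorelSpace F] in
variable (F) in
/-- Representatives of `𝔭 ^ n` modulo `𝔭 ^ (n + 1)`, indexed by the residue field. -/
lemma exists_coset_representatives (n : ℤ) : ∃ r : 𝓀[F] → F,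
    (∀ k, r k ∈ primePow F n) ∧ ∀ x ∈ primePow F n, ∃! k, x - r k ∈ primePow F (n + 1) := by
  obtain ⟨z, hz, hzn⟩ := exists_ord_eq F n
  have key : ∀ y : 𝒪[F], IsLocalRing.residue 𝒪[F] y = 0 ↔ (y : F) ∈ primePow F 1 :=
    fun y => (IsLocalRing.residue_eq_zero_iff y).trans mem_maximalIdeal_iff
  refine ⟨fun k => z * (Function.surjInv (IsLocalRing.residue_surjective (R := 𝒪[F])) k : 𝒪[F]),
    fun k => ?_, fun x hx => ?_⟩
  · have := mul_mem_primePow (self_mem_primePow z) (mem_integers_iff.1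
      (Function.surjInv (IsLocalRing.residue_surjective (R := 𝒪[F])) k).2)
    simpa [hzn] using this
  · have hxz : x / z ∈ 𝒪[F] := by
      rw [mem_integers_iff, div_eq_inv_mul, mul_mem_primePow_iff (inv_ne_zero hz)]
      simpa [hzn] using hx
    have key2 : ∀ y : 𝒪[F], x - z * y ∈ primePow F (n + 1) ↔
        IsLocalRing.residue 𝒪[F] ⟨x / z, hxz⟩ = IsLocalRing.residue 𝒪[F] y := by
      intro y
      rw [← sub_eq_zero, ← map_sub, key]
      have : x - z * y = z * (x / z - y) := by field_simp
      rw [this, mul_mem_primePow_iff hz, hzn]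
      simp
    refine ⟨IsLocalRing.residue 𝒪[F] ⟨x / z, hxz⟩, ?_, fun k hk => ?_⟩
    · simp only [key2]
      exact (Function.surjInv_eq IsLocalRing.residue_surjective _).symm
    · simp only [key2] at hk
      exact ((Function.surjInv_eq IsLocalRing.residue_surjective k).symm.trans hk.symm)

lemma haarF_primePow_succ (n : ℤ) :
    haarF F (primePow F n) = resCard F * haarF F (primePow F (n + 1)) := by
  obtain ⟨r, hr, hr'⟩ := exists_coset_representatives F n
  have : Fintype 𝓀[F] := Fintype.ofFinite _
  have h1 : primePow F n = ⋃ k, (fun x => x - r k) ⁻¹' primePow F (n + 1) := by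
    ext x
    simp only [Set.mem_iUnion, Set.mem_preimage]
    refine ⟨fun hx => (hr' x hx).exists, fun ⟨k, hk⟩ => ?_⟩
    simpa using add_mem_primePow (primePow_anti (by linarith) hk) (hr k)
  have h2 : ∀ k, haarF F ((fun x => x - r k) ⁻¹' primePow F (n + 1)) =
      haarF F (primePow F (n + 1)) := by
    intro k
    simp only [sub_eq_add_neg]
    exact measure_preimage_add_right _ _ _
  rw [h1, measure_iUnion]
  · simp [h2, resCard, Nat.card_eq_fintype_card]
  · intro i j hij
    rw [Function.onFun, Set.disjoint_left]
    intro x hi hj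
    have hx : x ∈ primePow F n := by
      rw [h1]; exact Set.mem_iUnion.2 ⟨i, hi⟩
    exact hij ((hr' x hx).unique hi hj)
  · exact fun k => (measurableSet_primePow _).preimage (by fun_prop)

lemma haarF_primePow (n : ℤ) :
    haarF F (primePow F n) = ENNReal.ofReal ((resCard F : ℝ) ^ (-n)) := by
  have hq := resCard_pos F
  have step : ∀ n : ℤ, haarF F (primePow F (n + 1)) =
        ENNReal.ofReal ((resCard F : ℝ) ^ (-(n + 1))) ↔
      haarF F (primePow F n) = ENNReal.ofReal ((resCard F : ℝ) ^ (-n)) := by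
    intro n
    have h1 : ENNReal.ofReal ((resCard F : ℝ) ^ (-n)) =
        resCard F * ENNReal.ofReal ((resCard F : ℝ) ^ (-(n + 1))) := by
      have : (resCard F : ℝ) ^ (-n) = resCard F * (resCard F : ℝ) ^ (-(n + 1)) := by
        rw [← zpow_one_add₀ hq.ne']; congr 1; ring
      rw [this, ENNReal.ofReal_mul hq.le, ENNReal.ofReal_natCast]
    rw [haarF_primePow_succ n, h1]
    constructor
    · intro h; rw [h]
    · intro h
      exact (ENNReal.mul_right_inj (by exact_mod_cast (zero_lt_one.trans (one_lt_resCard F)).ne')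
        (ENNReal.natCast_ne_top _)).1 h
  induction n using Int.induction_on with
  | zero => simp [haarF_primePow_zero]
  | succ i ih => exact (step _).2 ih
  | pred i ih =>
    rw [← step]; simpa using ih

lemma measureReal_primePow (n : ℤ) : (haarF F).real (primePow F n) = (resCard F : ℝ) ^ (-n) := by
  rw [Measure.real, haarF_primePow, ENNReal.toReal_ofReal (zpow_pos (resCard_pos F) _).le]

lemma map_mul_haarF {a : F} (ha : a ≠ 0) :
    Measure.map (a * ·) (haarF F) = ENNReal.ofReal (nabs a)⁻¹ • haarF F := by
  let e : F ≃ₜ+ F :=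
    { Homeomorph.mulLeft₀ a ha with map_add' := fun x y => mul_add a x y }
  have hreg : (haarF F).Regular := by unfold haarF; infer_instance
  have h1 : (Measure.map (a * ·) (haarF F)).IsAddHaarMeasure :=
    e.isAddHaarMeasure_map (haarF F)
  have h2 : (Measure.map (a * ·) (haarF F)).Regular :=
    Measure.Regular.map (Homeomorph.mulLeft₀ a ha)
  have h3 := Measure.isAddLeftInvariant_eq_smul_of_regular
    (Measure.map (a * ·) (haarF F)) (haarF F)
  have h4 : Measure.map (a * ·) (haarF F) (primePow F 0) = ENNReal.ofReal (nabs a)⁻¹ := by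
    rw [Measure.map_apply (measurable_const_mul a) (measurableSet_primePow 0)]
    have : (a * ·) ⁻¹' primePow F 0 = primePow F (-ord a) := by
      ext x; simp [mul_mem_primePow_iff ha]
    rw [this, haarF_primePow, nabs_of_ne ha, ← zpow_neg]
  rw [h3] at h4
  simp only [Measure.smul_apply, haarF_primePow_zero, ENNReal.smul_def, smul_eq_mul, mul_one] at h4
  rw [h3, ← h4]
  rfl

lemma integral_comp_mul {E : Type*} [NormedAddCommGroup E] [NormedSpace ℝ E] {a : F} (ha : a ≠ 0)
    (f : F → E) : ∫ x, f (a * x) ∂haarF F = (nabs a)⁻¹ • ∫ x, f x ∂haarF F := by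
  have h := (Homeomorph.mulLeft₀ a ha).measurableEmbedding.integral_map (μ := haarF F) f
  simp only [Homeomorph.coe_mulLeft₀] at h
  rw [← h, map_mul_haarF ha, integral_smul_measure,
    ENNReal.toReal_ofReal (inv_nonneg.2 (nabs_nonneg a))]

end Haar

/-! ### Integration over lattices -/

section Integrals

variable {F : Type*} [Field F] [ValuativeRel F] [TopologicalSpace F]
  [IsNonarchimedeanLocalField F] [MeasurableSpace F] [BorelSpace F]

lemma integrableOn_primePow {f : F → ℂ} (hf : Continuous f) (n : ℤ) :
    IntegrableOn f (primePow F n) (haarF F) := by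
  have := t2Space F
  exact hf.continuousOn.integrableOn_compact (isCompact_primePow n)

lemma setIntegral_add_left {n : ℤ} {x : F} (hx : x ∈ primePow F n) (f : F → ℂ) :
    ∫ y in primePow F n, f (x + y) ∂haarF F = ∫ y in primePow F n, f y ∂haarF F := by
  rw [← integral_indicator (measurableSet_primePow n),
    ← integral_indicator (measurableSet_primePow n),
    ← integral_add_left_eq_self ((primePow F n).indicator f) x]
  congr 1
  ext y
  by_cases hy : y ∈ primePow F n
  · rw [Set.indicator_of_mem hy, Set.indicator_of_mem (add_mem_primePow hx hy)]
  · rw [Set.indicator_of_notMem hy, Set.indicator_of_notMem]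
    rwa [add_comm, add_mem_primePow_iff hx]

lemma setIntegral_comp_mul {a : F} (ha : a ≠ 0) (n : ℤ) (f : F → ℂ) :
    ∫ x in primePow F n, f (a * x) ∂haarF F =
      ((nabs a)⁻¹ : ℝ) * ∫ x in primePow F (n + ord a), f x ∂haarF F := by
  rw [← integral_indicator (measurableSet_primePow n),
    ← integral_indicator (measurableSet_primePow _), ← Complex.real_smul,
    ← integral_comp_mul ha]
  congr 1
  ext y
  have : a * y ∈ primePow F (n + ord a) ↔ y ∈ primePow F n := by
    rw [mul_mem_primePow_iff ha, add_sub_cancel_right]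
  by_cases hy : y ∈ primePow F n
  · rw [Set.indicator_of_mem hy, Set.indicator_of_mem (this.2 hy)]
  · rw [Set.indicator_of_notMem hy, Set.indicator_of_notMem (this.not.2 hy)]

/-- Fubini's theorem for continuous functions on compact open sets. -/
lemma setIntegral_swap_of_isClopen {X Y : Type*} [TopologicalSpace X] [TopologicalSpace Y]
    [MeasurableSpace X] [MeasurableSpace Y] [OpensMeasurableSpace X] [OpensMeasurableSpace Y]
    {μ : Measure X} {ν : Measure Y} [IsFiniteMeasureOnCompacts μ] [IsFiniteMeasureOnCompacts ν]
    {A : Set X} {B : Set Y} (hA : IsClopen A) (hA' : IsCompact A) (hB : IsClopen B)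
    (hB' : IsCompact B) {f : X → Y → ℂ} (hf : Continuous (Function.uncurry f)) :
    ∫ x in A, ∫ y in B, f x y ∂ν ∂μ = ∫ y in B, ∫ x in A, f x y ∂μ ∂ν := by
  have hcl : IsClopen (A ×ˢ B) := hA.prod hB
  set g : X → Y → ℂ := fun x y => (A ×ˢ B).indicator (Function.uncurry f) (x, y) with hg
  have hgu : Function.uncurry g = (A ×ˢ B).indicator (Function.uncurry f) := by
    ext ⟨x, y⟩; rfl
  have h1 : Continuous (Function.uncurry g) := by
    rw [hgu]; exact hf.indicator (by simp [hcl.frontier_eq])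
  have h2 : HasCompactSupport (Function.uncurry g) := by
    rw [hgu]
    exact HasCompactSupport.intro' (hA'.prod hB') hcl.1
      (fun x hx => Set.indicator_of_notMem hx _)
  have h3 := integral_integral_swap_of_hasCompactSupport h1 h2 (μ := μ) (ν := ν)
  have mA := hA.2.measurableSet
  have mB := hB.2.measurableSet
  have e1 : ∀ x, ∫ y, g x y ∂ν = A.indicator (fun x => ∫ y in B, f x y ∂ν) x := by
    intro x
    by_cases hx : x ∈ A
    · rw [Set.indicator_of_mem hx, ← integral_indicator mB]
      congr 1; ext y
      by_cases hy : y ∈ B <;> simp [hg, hx, hy]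
    · simp [hg, hx]
  have e2 : ∀ y, ∫ x, g x y ∂μ = B.indicator (fun y => ∫ x in A, f x y ∂μ) y := by
    intro y
    by_cases hy : y ∈ B
    · rw [Set.indicator_of_mem hy, ← integral_indicator mA]
      congr 1; ext x
      by_cases hx : x ∈ A <;> simp [hg, hx, hy]
    · simp [hg, hy]
  simp only [e1, e2] at h3
  rwa [integral_indicator mA, integral_indicator mB] at h3

omit [MeasurableSpace F] [BorelSpace F] in
lemma isClopen_primePow (n : ℤ) : IsClopen (primePow F n) :=
  ⟨isClosed_primePow n, isOpen_primePow n⟩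

lemma setIntegral_swap {f : F → F → ℂ} (hf : Continuous (Function.uncurry f)) (m n : ℤ) :
    ∫ x in primePow F m, ∫ y in primePow F n, f x y ∂haarF F ∂haarF F =
      ∫ y in primePow F n, ∫ x in primePow F m, f x y ∂haarF F ∂haarF F :=
  setIntegral_swap_of_isClopen (isClopen_primePow m) (isCompact_primePow m) (isClopen_primePow n)
    (isCompact_primePow n) hf

lemma setIntegral_const_primePow (n : ℤ) (z : ℂ) :
    ∫ _ in primePow F n, z ∂haarF F = ((resCard F : ℝ) ^ (-n) : ℝ) * z := by
  rw [setIntegral_const, measureReal_primePow, Complex.real_smul]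

open Classical in
/-- The integral over a lattice of a function that is constant on a sublattice and vanishes
off it. -/
lemma setIntegral_ite_primePow {m n : ℤ} (h : m ≤ n)
    (z : ℂ) : ∫ x in primePow F m, (if x ∈ primePow F n then z else 0) ∂haarF F =
      ((resCard F : ℝ) ^ (-n) : ℝ) * z := by
  rw [← setIntegral_const_primePow, ← integral_indicator (measurableSet_primePow m),
    ← integral_indicator (measurableSet_primePow n)]
  congr 1; ext x
  by_cases hx : x ∈ primePow F n
  · simp [hx, primePow_anti h hx]
  · simp [hx]

end Integrals

/-! ### Additive characters -/

section Character

variable {F : Type*} [Field F] [ValuativeRel F] [TopologicalSpace F]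
  [IsNonarchimedeanLocalField F]

/-- The largest lattice on which `ψ` is trivial is `δ⁻¹ 𝔬`. -/
structure HasConductor (ψ : AddChar F ℂ) (δ : F) : Prop where
  ne_zero : δ ≠ 0
  trivial_iff : ∀ n : ℤ, (∀ x ∈ primePow F n, ψ x = 1) ↔ -ord δ ≤ n

lemma HasOrder.hasConductor {ψ : AddChar F ℂ} {c : ℕ} (h : HasOrder F ψ c) {δ : F} (hδ0 : δ ≠ 0)
    (hδ : ord δ = c) : HasConductor ψ δ := by
  refine ⟨hδ0, fun n => ⟨fun hn => ?_, fun hn x hx => h.1 x (primePow_anti (by omega) hx)⟩⟩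
  by_contra! hlt
  have : c + 1 ∈ {n : ℕ | ∀ x ∈ primePow F (-(n : ℤ)), ψ x = 1} :=
    fun x hx => hn x (primePow_anti (by push_cast; omega) hx)
  have := h.2 this
  omega

variable {ψ : AddChar F ℂ} {δ : F} (hψ : HasConductor ψ δ)
include hψ

lemma HasConductor.eq_one {x : F} (hx : x ∈ primePow F (-ord δ)) : ψ x = 1 :=
  (hψ.trivial_iff _).2 le_rfl x hx

lemma HasConductor.add_eq {x y : F} (hy : y ∈ primePow F (-ord δ)) : ψ (x + y) = ψ x := by
  rw [AddChar.map_add_eq_mul, hψ.eq_one hy, mul_one]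

/-- The lattice dual to `𝔭 ^ n` with respect to the pairing `ψ (x y)` is `δ⁻¹ 𝔭 ^ (-n)`. -/
lemma HasConductor.dual {x : F} {n : ℤ} :
    (∀ y ∈ primePow F n, ψ (x * y) = 1) ↔ x ∈ primePow F (-ord δ - n) := by
  by_cases hx : x = 0
  · simp [hx]
  rw [mem_primePow_of_ne hx]
  have h := hψ.trivial_iff (n + ord x)
  constructor
  · intro h1
    have := h.1 fun y hy => by
      have := h1 (y / x) (by
        rw [div_eq_inv_mul, mul_mem_primePow_iff (inv_ne_zero hx)]; simpa using hy)
      rwa [mul_div_cancel₀ _ hx] at this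
    linarith
  · intro h1 y hy
    refine h.2 (by linarith) _ ?_
    rw [mul_mem_primePow_iff hx]; simpa using hy

/-- A power of the residue characteristic annihilates every element of `F / δ⁻¹ 𝔬`, so that the
values of `ψ` are roots of unity. -/
lemma HasConductor.norm_eq_one (x : F) : ‖ψ x‖ = 1 := by
  have hq : (resCard F : F) ∈ primePow F 1 := by
    have h1 : IsLocalRing.residue 𝒪[F] (resCard F : 𝒪[F]) = 0 := by
      rw [map_natCast]
      have := Fintype.ofFinite 𝓀[F]
      rw [resCard, Nat.card_eq_fintype_card, Nat.cast_card_eq_zero]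
    exact mem_maximalIdeal_iff.1 ((IsLocalRing.residue_eq_zero_iff _).1 h1)
  have hpow : ∀ k : ℕ, ((resCard F ^ k : ℕ) : F) ∈ primePow F k := by
    intro k
    induction k with
    | zero => simpa using one_mem_primePow_zero
    | succ k ih =>
      rw [pow_succ, Nat.cast_mul]; push_cast at ih ⊢
      exact mul_mem_primePow ih hq
  have h1 : ((resCard F ^ (-ord δ - ord x).toNat : ℕ) : F) * x ∈ primePow F (-ord δ) :=
    primePow_anti (by omega) (mul_mem_primePow (hpow _) (self_mem_primePow x))
  have h2 := hψ.eq_one h1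
  rw [← nsmul_eq_mul, AddChar.map_nsmul_eq_pow] at h2
  have h3 : ‖ψ x‖ ^ (resCard F ^ (-ord δ - ord x).toNat) = 1 := by
    rw [← norm_pow, h2, norm_one]
  exact (pow_eq_one_iff_of_nonneg (norm_nonneg _)
    (pow_pos (zero_lt_one.trans (one_lt_resCard F)) _).ne').1 h3

lemma HasConductor.conj_eq (x : F) : conj (ψ x) = ψ (-x) := by
  rw [AddChar.map_neg_eq_inv, Complex.inv_def, Complex.normSq_eq_norm_sq, hψ.norm_eq_one]
  simp

@[fun_prop]
lemma HasConductor.continuous : Continuous ψ := by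
  refine continuous_iff_continuousAt.2 fun x => ?_
  have : ψ =ᶠ[nhds x] fun _ => ψ x := by
    rw [Filter.EventuallyEq, Filter.Eventually, mem_nhds_iff_primePow]
    exact ⟨-ord δ, fun y hy => hψ.add_eq hy⟩
  exact continuousAt_const.congr this.symm

open Classical in
/-- Orthogonality of characters on the lattice `𝔭 ^ n`. -/
lemma HasConductor.setIntegral [MeasurableSpace F] [BorelSpace F] (x : F) (n : ℤ) :
    ∫ y in primePow F n, ψ (x * y) ∂haarF F =
      if x ∈ primePow F (-ord δ - n) then (((resCard F : ℝ) ^ (-n) : ℝ) : ℂ) else 0 := by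
  split_ifs with hx
  · rw [setIntegral_congr_fun (measurableSet_primePow n)
      (fun y hy => hψ.dual.2 hx y hy : Set.EqOn _ (fun _ => (1 : ℂ)) _),
      setIntegral_const_primePow, mul_one]
  · rw [← hψ.dual] at hx
    push Not at hx
    obtain ⟨t, ht, hne⟩ := hx
    have h1 := setIntegral_add_left ht (fun y => ψ (x * y))
    simp only [mul_add, AddChar.map_add_eq_mul] at h1
    rw [integral_const_mul] at h1
    by_contra h0
    exact hne (mul_right_cancel₀ h0 (h1.trans (one_mul _).symm))

end Character

/-! ### Schwartz functions and the Fourier transform -/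

section Schwartz

variable {F : Type*} [Field F] [ValuativeRel F] [TopologicalSpace F]
  [IsNonarchimedeanLocalField F]

/-- `φ` is supported in `𝔭 ^ m` and invariant under translation by `𝔭 ^ n`. -/
structure IsBounded (φ : F → ℂ) (m n : ℤ) : Prop where
  supp : ∀ x, x ∉ primePow F m → φ x = 0
  inv : ∀ x, ∀ y ∈ primePow F n, φ (x + y) = φ x

/-- Schwartz functions, described by the existence of lattices of support and of periods. -/
def IsSchwartz (φ : F → ℂ) : Prop := ∃ m n : ℤ, IsBounded φ m n

lemma IsBounded.continuous {φ : F → ℂ} {m n : ℤ} (h : IsBounded φ m n) : Continuous φ := by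
  refine continuous_iff_continuousAt.2 fun x => ?_
  have : φ =ᶠ[nhds x] fun _ => φ x := by
    rw [Filter.EventuallyEq, Filter.Eventually, mem_nhds_iff_primePow]
    exact ⟨n, fun y hy => h.inv x y hy⟩
  exact continuousAt_const.congr this.symm

lemma IsBounded.mono {φ : F → ℂ} {m n m' n' : ℤ} (h : IsBounded φ m n) (hm : m' ≤ m)
    (hn : n ≤ n') : IsBounded φ m' n' :=
  ⟨fun x hx => h.supp x fun hx' => hx (primePow_anti hm hx'),
    fun x y hy => h.inv x y (primePow_anti hn hy)⟩

/-- A locally constant function of compact support is uniformly locally constant. -/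
lemma isSchwartz_of_isLocallyConstant {φ : F → ℂ} (h1 : IsLocallyConstant φ) (h2 : HasCompactSupport φ) :
    IsSchwartz φ := by
  have hinv : ∀ x : F, ∃ n : ℤ, ∀ y ∈ primePow F n, φ (x + y) = φ x := by
    intro x
    exact mem_nhds_iff_primePow.1 ((h1.isOpen_fiber (φ x)).mem_nhds rfl)
  choose n hn using hinv
  obtain ⟨t, -, ht⟩ := h2.isCompact.elim_nhds_subcover (fun x => (fun y => y - x) ⁻¹' primePow F (n x))
    (fun x _ => (continuous_sub_right x).continuousAt.preimage_mem_nhds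
        (by simpa using primePow_mem_nhds_zero (n x)))
  have hm : ∃ m : ℤ, ∀ x ∈ t, m ≤ ord x ∧ m ≤ n x := by
    refine ⟨-∑ x ∈ t, (|ord x| + |n x|), fun x hx => ?_⟩
    have := Finset.single_le_sum (f := fun x => |ord x| + |n x|) (fun i _ => by positivity) hx
    have h1 := neg_abs_le (ord x)
    have h2 := neg_abs_le (n x)
    have h3 := abs_nonneg (ord x)
    have h4 := abs_nonneg (n x)
    constructor <;> linarith
  have hN : ∃ N : ℤ, ∀ x ∈ t, n x ≤ N := by
    refine ⟨∑ x ∈ t, |n x|, fun x hx => ?_⟩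
    have := Finset.single_le_sum (f := fun x => |n x|) (fun i _ => by positivity) hx
    exact (le_abs_self _).trans this
  obtain ⟨m, hm⟩ := hm
  obtain ⟨N, hN⟩ := hN
  have hne : ∀ x, φ x ≠ 0 → ∃ z ∈ t, x - z ∈ primePow F (n z) := by
    intro x hx
    simpa using ht (subset_tsupport _ hx)
  have key : ∀ x, φ x ≠ 0 → ∀ y ∈ primePow F N, φ (x + y) = φ x := by
    intro x hx y hy
    obtain ⟨z, hz, hxz⟩ := hne x hx
    have e1 := hn z _ hxz
    have e2 := hn z (x - z + y) (add_mem_primePow hxz (primePow_anti (hN z hz) hy))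
    rw [add_sub_cancel] at e1
    rw [← add_assoc, add_sub_cancel] at e2
    rw [e1, e2]
  refine ⟨m, N, fun x hx => ?_, fun x y hy => ?_⟩
  · by_contra h0
    obtain ⟨z, hz, hxz⟩ := hne x h0
    apply hx
    have := add_mem_primePow (primePow_anti (hm z hz).2 hxz)
      (primePow_anti (hm z hz).1 (self_mem_primePow z))
    simpa using this
  · by_cases h0 : φ x = 0
    · by_contra h3
      have := key (x + y) (by rwa [h0] at h3) (-y) (neg_mem_primePow.2 hy)
      rw [add_neg_cancel_right] at this
      exact h3 this.symm
    · exact key x h0 y hy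

lemma IsSchwartz.const_mul {φ : F → ℂ} (h : IsSchwartz φ) (z : ℂ) :
    IsSchwartz (fun x => z * φ x) := by
  obtain ⟨m, n, h⟩ := h
  exact ⟨m, n, fun x hx => by simp [h.supp x hx], fun x y hy => by simp [h.inv x y hy]⟩

lemma IsSchwartz.smul {φ : F → ℂ} (h : IsSchwartz φ) (z : ℂ) : IsSchwartz (z • φ) :=
  h.const_mul z

lemma IsSchwartz.comp_mul {φ : F → ℂ} (h : IsSchwartz φ) {a : F} (ha : a ≠ 0) :
    IsSchwartz (fun x => φ (a * x)) := by
  obtain ⟨m, n, h⟩ := h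
  refine ⟨m - ord a, n - ord a, fun x hx => h.supp _ ?_, fun x y hy => ?_⟩
  · rwa [mul_mem_primePow_iff ha]
  · rw [mul_add]; exact h.inv _ _ ((mul_mem_primePow_iff ha).2 hy)

lemma IsSchwartz.comp_add {φ : F → ℂ} (h : IsSchwartz φ) (s : F) :
    IsSchwartz (fun x => φ (x + s)) := by
  obtain ⟨m, n, h⟩ := h
  refine ⟨min m (ord s), n, fun x hx => h.supp _ fun h1 => hx ?_, fun x y hy => ?_⟩
  · rw [← add_mem_primePow_iff (primePow_anti (min_le_right _ _) (self_mem_primePow s))]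
    exact primePow_anti (min_le_left _ _) h1
  · rw [add_right_comm]; exact h.inv _ _ hy

/-- Multiplication of a Schwartz function by a factor that is uniformly locally constant on every
lattice. -/
lemma IsSchwartz.mul_periodic {φ : F → ℂ} (h : IsSchwartz φ) {f : F → ℂ}
    (hf : ∀ m : ℤ, ∃ n : ℤ, ∀ x ∈ primePow F m, ∀ y ∈ primePow F n, f (x + y) = f x) :
    IsSchwartz (fun x => f x * φ x) := by
  obtain ⟨m, n, h⟩ := h
  obtain ⟨k, hk⟩ := hf m
  refine ⟨m, max m (max n k), fun x hx => by simp [h.supp x hx], fun x y hy => ?_⟩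
  have hym : y ∈ primePow F m := primePow_anti (le_max_left _ _) hy
  rw [h.inv x y (primePow_anti (by simp) hy)]
  by_cases hx : x ∈ primePow F m
  · rw [hk x hx y (primePow_anti (by simp) hy)]
  · rw [h.supp x hx]; simp

variable {ψ : AddChar F ℂ} {δ : F}

lemma IsSchwartz.psi_quadratic_mul (hψ : HasConductor ψ δ) {φ : F → ℂ} (h : IsSchwartz φ)
    (b s : F) : IsSchwartz (fun x => ψ (b * x ^ 2 + s * x) * φ x) := by
  refine h.mul_periodic (f := fun x => ψ (b * x ^ 2 + s * x)) fun m => ?_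
  refine ⟨max (-ord δ - ord s) (max (-ord δ - ord (2 * b) - m) (max m (-ord δ - ord b - m))), ?_⟩
  intro x hx y hy
  have e : b * (x + y) ^ 2 + s * (x + y) =
      b * x ^ 2 + s * x + (s * y + (2 * b) * (x * y) + b * (y * y)) := by ring
  rw [e]
  refine hψ.add_eq (add_mem_primePow (add_mem_primePow ?_ ?_) ?_)
  · exact primePow_anti (by omega) (mul_mem_primePow (self_mem_primePow s) hy)
  · exact primePow_anti (by omega)
      (mul_mem_primePow (self_mem_primePow (2 * b)) (mul_mem_primePow hx hy))
  · exact primePow_anti (by omega)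
      (mul_mem_primePow (self_mem_primePow b) (mul_mem_primePow
        (primePow_anti (n := max (-ord δ - ord s) (max (-ord δ - ord (2 * b) - m)
          (max m (-ord δ - ord b - m)))) (m := m) (by omega) hy) hy))

lemma IsSchwartz.psi_sq_mul (hψ : HasConductor ψ δ) {φ : F → ℂ} (h : IsSchwartz φ) (b : F) :
    IsSchwartz (fun x => ψ (b * x ^ 2) * φ x) := by
  simpa using h.psi_quadratic_mul hψ b 0

section Integral

variable [MeasurableSpace F] [BorelSpace F]

lemma IsBounded.integral_eq {φ : F → ℂ} {m n : ℤ} (h : IsBounded φ m n) (f : F → ℂ) :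
    ∫ x, φ x * f x ∂haarF F = ∫ x in primePow F m, φ x * f x ∂haarF F := by
  rw [setIntegral_eq_integral_of_forall_compl_eq_zero]
  intro x hx
  rw [h.supp x hx, zero_mul]

lemma fourierT_smul (z : ℂ) (φ : F → ℂ) :
    fourierT ψ δ (fun x => z * φ x) = fun x => z * fourierT ψ δ φ x := by
  ext x
  simp only [fourierT, mul_assoc]
  rw [integral_const_mul]
  ring

lemma fourierT_comp_mul {k : F} (hk : k ≠ 0) (φ : F → ℂ) (x : F) :
    fourierT ψ δ (fun y => φ (k * y)) x = ((nabs k)⁻¹ : ℝ) * fourierT ψ δ φ (x / k) := by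
  simp only [fourierT]
  have := integral_comp_mul hk (fun y => φ y * ψ (x / k * y))
  have e : ∀ y, x / k * (k * y) = x * y := fun y => by field_simp
  simp only [e] at this
  rw [this, Complex.real_smul]
  ring

/-- The Fourier transform interchanges the lattices of support and of periods, up to duality. -/
lemma IsBounded.isBounded_fourierT (hψ : HasConductor ψ δ) {φ : F → ℂ} {m n : ℤ} (h : IsBounded φ m n) :
    IsBounded (fourierT ψ δ φ) (-ord δ - n) (-ord δ - m) := by
  constructor
  · intro x hx
    rw [← hψ.dual] at hx
    push Not at hx
    obtain ⟨t, ht, hne⟩ := hx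
    have h1 : ∫ y, φ y * ψ (x * y) ∂haarF F = ψ (x * t) * ∫ y, φ y * ψ (x * y) ∂haarF F := by
      rw [← integral_const_mul, ← integral_add_right_eq_self _ t]
      congr 1; ext y
      rw [h.inv y t ht, mul_add, AddChar.map_add_eq_mul]; ring
    have h2 : ∫ y, φ y * ψ (x * y) ∂haarF F = 0 := by
      by_contra h0
      exact hne (mul_right_cancel₀ h0 (h1.symm.trans (one_mul _).symm))
    rw [fourierT, h2, mul_zero]
  · intro x s hs
    rw [fourierT, fourierT, h.integral_eq, h.integral_eq]
    congr 1
    refine setIntegral_congr_fun (measurableSet_primePow m) fun y hy => ?_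
    have : s * y ∈ primePow F (-ord δ) := by simpa using mul_mem_primePow hs hy
    rw [add_mul, hψ.add_eq this]

lemma IsSchwartz.isSchwartz_fourierT (hψ : HasConductor ψ δ) {φ : F → ℂ} (h : IsSchwartz φ) :
    IsSchwartz (fourierT ψ δ φ) := by
  obtain ⟨m, n, h⟩ := h
  exact ⟨_, _, h.isBounded_fourierT hψ⟩

omit [MeasurableSpace F] [BorelSpace F] in
lemma sqrt_nabs_mul_self (x : F) :
    (Real.sqrt (nabs x) : ℂ) * (Real.sqrt (nabs x) : ℂ) = (nabs x : ℂ) := by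
  rw [← Complex.ofReal_mul, Real.mul_self_sqrt (nabs_nonneg x)]

/-- Fourier inversion. -/
theorem IsSchwartz.fourierT_fourierT (hψ : HasConductor ψ δ) {φ : F → ℂ} (h : IsSchwartz φ)
    (x : F) : fourierT ψ δ (fourierT ψ δ φ) x = φ (-x) := by
  classical
  obtain ⟨m, n, h⟩ := h
  have hb := h.isBounded_fourierT hψ
  have hc := h.continuous
  set k := -ord δ - n with hk
  have e1 : fourierT ψ δ (fourierT ψ δ φ) x = (nabs δ : ℂ) *
      ∫ y in primePow F k, ∫ z in primePow F m, φ z * ψ (y * z) * ψ (x * y) ∂haarF F ∂haarF F := by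
    rw [fourierT, hb.integral_eq, ← sqrt_nabs_mul_self, mul_assoc]
    congr 1
    rw [← integral_const_mul]
    congr 1
    ext y
    rw [fourierT, h.integral_eq, integral_mul_const]
    ring
  have e2 : ∀ z, ∫ y in primePow F k, φ z * ψ (y * z) * ψ (x * y) ∂haarF F =
      φ (-x) * if x + z ∈ primePow F n then (((resCard F : ℝ) ^ (-k) : ℝ) : ℂ) else 0 := by
    intro z
    have : ∀ y, φ z * ψ (y * z) * ψ (x * y) = φ z * ψ ((x + z) * y) := by
      intro y
      rw [add_mul, AddChar.map_add_eq_mul, mul_comm y z]; ring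
    simp only [this]
    rw [integral_const_mul, hψ.setIntegral]
    have e3 : -ord δ - k = n := by omega
    rw [e3]
    split_ifs with hz
    · have := h.inv (-x) _ hz
      rw [neg_add_cancel_left] at this
      rw [this]
    · simp
  have e4 : ∀ N : ℤ, N ≤ m → N ≤ n → x ∈ primePow F N →
      ∫ z in primePow F N, (if x + z ∈ primePow F n then (((resCard F : ℝ) ^ (-k) : ℝ) : ℂ) else 0)
        ∂haarF F = (((resCard F : ℝ) ^ (-n) : ℝ) : ℂ) * (((resCard F : ℝ) ^ (-k) : ℝ) : ℂ) := by
    intro N _ h2 hx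
    rw [setIntegral_add_left hx (fun z => if z ∈ primePow F n then
      (((resCard F : ℝ) ^ (-k) : ℝ) : ℂ) else 0), setIntegral_ite_primePow h2]
  have h' := h.mono (m' := min m (min n (ord x))) (min_le_left _ _) le_rfl
  have e5 : ∀ y, ∫ z in primePow F m, φ z * ψ (y * z) * ψ (x * y) ∂haarF F =
      ∫ z in primePow F (min m (min n (ord x))), φ z * ψ (y * z) * ψ (x * y) ∂haarF F := by
    intro y
    simp only [mul_assoc]
    rw [← h.integral_eq, h'.integral_eq]
  rw [e1]
  simp only [e5]
  rw [setIntegral_swap (f := fun y z => φ z * ψ (y * z) * ψ (x * y))]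
  · simp only [e2]
    rw [integral_const_mul, e4 _ (min_le_left _ _) (by omega)
      (primePow_anti (by omega) (self_mem_primePow x)), nabs_of_ne hψ.ne_zero]
    have : ((resCard F : ℝ) ^ (-ord δ) : ℝ) * (((resCard F : ℝ) ^ (-n) : ℝ) *
        ((resCard F : ℝ) ^ (-k) : ℝ)) = 1 := by
      rw [← zpow_add₀ (resCard_pos F).ne', ← zpow_add₀ (resCard_pos F).ne', hk]
      simp
    rw [mul_comm (φ (-x)), ← mul_assoc]
    exact_mod_cast congrArg (fun r : ℝ => (r : ℂ) * φ (-x)) this |>.trans (by simp)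
  · have := hψ.continuous
    simp only [Function.uncurry_def]
    fun_prop

lemma innerF_smul_left (z : ℂ) (φ φ' : F → ℂ) :
    innerF (z • φ) φ' = z * innerF φ φ' := by
  simp only [innerF, Pi.smul_apply, smul_eq_mul, mul_assoc]
  rw [integral_const_mul]

lemma innerF_smul_right (z : ℂ) (φ φ' : F → ℂ) :
    innerF φ (z • φ') = conj z * innerF φ φ' := by
  simp only [innerF, Pi.smul_apply, smul_eq_mul, map_mul]
  rw [← integral_const_mul]
  congr 1; ext; ring

/-- Plancherel's formula. -/
theorem innerF_fourierT (hψ : HasConductor ψ δ) {φ φ' : F → ℂ} (h : IsSchwartz φ)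
    (h' : IsSchwartz φ') : innerF (fourierT ψ δ φ) (fourierT ψ δ φ') = innerF φ φ' := by
  obtain ⟨M, N, hM⟩ := h.isSchwartz_fourierT hψ
  obtain ⟨m, n, hm⟩ := h'
  have e1 : innerF (fourierT ψ δ φ) (fourierT ψ δ φ') = ∫ x in primePow F M, ∫ y in primePow F m,
      (Real.sqrt (nabs δ) : ℂ) * (fourierT ψ δ φ x * (conj (φ' y) * ψ (-(x * y))))
        ∂haarF F ∂haarF F := by
    rw [innerF, hM.integral_eq]
    congr 1; ext x
    rw [fourierT.eq_1 ψ δ φ', hm.integral_eq, map_mul, ← integral_conj, Complex.conj_ofReal,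
      integral_const_mul, integral_const_mul]
    simp only [map_mul, hψ.conj_eq]
    ring
  rw [e1, setIntegral_swap (f := fun x y => (Real.sqrt (nabs δ) : ℂ) *
    (fourierT ψ δ φ x * (conj (φ' y) * ψ (-(x * y)))))]
  · have e2 : ∀ y, ∫ x in primePow F M, (Real.sqrt (nabs δ) : ℂ) *
        (fourierT ψ δ φ x * (conj (φ' y) * ψ (-(x * y)))) ∂haarF F = φ y * conj (φ' y) := by
      intro y
      have := h.fourierT_fourierT hψ (-y)
      rw [neg_neg] at this
      rw [← this, fourierT.eq_1 ψ δ (fourierT ψ δ φ), hM.integral_eq, mul_assoc, ← integral_mul_const,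
        ← integral_const_mul]
      congr 1; ext x
      rw [neg_mul, mul_comm y x]; ring
    simp only [e2, innerF]
    rw [setIntegral_eq_integral_of_forall_compl_eq_zero]
    intro x hx
    simp [hm.supp x hx]
  · have h1 := hM.continuous
    have h2 := hm.continuous
    have h3 := hψ.continuous
    have h4 := Complex.continuous_conj
    simp only [Function.uncurry_def]
    fun_prop

end Integral

end Schwartz

/-! ### Quadratic Gauss integrals -/

section Gauss

variable {F : Type*} [Field F] [ValuativeRel F] [TopologicalSpace F]
  [IsNonarchimedeanLocalField F] [MeasurableSpace F] [BorelSpace F]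

open Classical in
lemma setIntegral_ite_mem_primePow {m n : ℤ} (h : m ≤ n) (f : F → ℂ) :
    ∫ x in primePow F m, (if x ∈ primePow F n then f x else 0) ∂haarF F =
      ∫ x in primePow F n, f x ∂haarF F := by
  rw [← integral_indicator (measurableSet_primePow m),
    ← integral_indicator (measurableSet_primePow n)]
  congr 1; ext x
  by_cases hx : x ∈ primePow F n
  · simp [hx, primePow_anti h hx]
  · simp [hx]

/-- The quadratic Gauss integral of `ψ (a x²)` over the ball `𝔭 ^ (-N)`. -/
noncomputable def gaussInt (ψ : AddChar F ℂ) (a : F) (N : ℤ) : ℂ :=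
  ∫ x in primePow F (-N), ψ (a * x ^ 2) ∂haarF F

/-- A radius beyond which the Gauss integrals `gaussInt ψ a N` no longer depend on `N`. -/
def IsStable (δ a : F) (N : ℤ) : Prop :=
  ord δ + ord (2 * a) ≤ 2 * N ∧ ord δ + 2 * ord (2 * a) - ord a ≤ 2 * N

/-- The stable value of the Gauss integrals `gaussInt ψ a N`, that is, the regularized integral of
`ψ (a x²)` over `F`. -/
noncomputable def gaussVal (ψ : AddChar F ℂ) (δ a : F) : ℂ :=
  gaussInt ψ a (|ord δ + ord (2 * a)| + |ord δ + 2 * ord (2 * a) - ord a|)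

omit [MeasurableSpace F] [BorelSpace F] in
lemma IsStable.mono {δ a : F} {N M : ℤ} (h : IsStable δ a N) (hM : N ≤ M) : IsStable δ a M :=
  ⟨h.1.trans (by linarith), h.2.trans (by linarith)⟩

omit [MeasurableSpace F] [BorelSpace F] in
lemma isStable_default (δ a : F) :
    IsStable δ a (|ord δ + ord (2 * a)| + |ord δ + 2 * ord (2 * a) - ord a|) := by
  have h1 := le_abs_self (ord δ + ord (2 * a))
  have h2 := le_abs_self (ord δ + 2 * ord (2 * a) - ord a)
  have h3 := abs_nonneg (ord δ + ord (2 * a))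
  have h4 := abs_nonneg (ord δ + 2 * ord (2 * a) - ord a)
  constructor <;> linarith

variable [CharZero F] {ψ : AddChar F ℂ} {δ : F} (hψ : HasConductor ψ δ)

omit [TopologicalSpace F] [IsNonarchimedeanLocalField F] [MeasurableSpace F] [BorelSpace F]
  [ValuativeRel F] in
lemma two_mul_ne_zero {a : F} (ha : a ≠ 0) : 2 * a ≠ 0 := mul_ne_zero two_ne_zero ha

include hψ

omit [MeasurableSpace F] [BorelSpace F] [CharZero F] in
lemma IsStable.psi_eq_one {a : F} {N : ℤ} (hN : IsStable δ a N) {t : F}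
    (ht : t ∈ primePow F (N - ord δ - ord (2 * a))) : ψ (a * t ^ 2) = 1 := by
  refine hψ.eq_one (primePow_anti ?_ (mul_mem_primePow (self_mem_primePow a)
    (pow_two t ▸ mul_mem_primePow ht ht)))
  have := hN.2
  omega

open Classical in
/-- The integral of `ψ (a x²)` over a translate of a large ball vanishes unless the translate is the
ball itself. -/
lemma IsStable.setIntegral_add_sq {a : F} (ha : a ≠ 0) {N : ℤ} (hN : IsStable δ a N) (x : F) :
    ∫ t in primePow F (-N), ψ (a * (x + t) ^ 2) ∂haarF F =
      if x ∈ primePow F (-N) then gaussInt ψ a N else 0 := by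
  split_ifs with hx
  · exact setIntegral_add_left hx (fun t => ψ (a * t ^ 2))
  · have h2a := two_mul_ne_zero ha
    have hx' : ¬ (∀ y ∈ primePow F (N - ord δ - ord (2 * a)), ψ (2 * a * x * y) = 1) := by
      rw [hψ.dual, mul_mem_primePow_iff h2a]
      convert! hx using 3; ring
    push Not at hx'
    obtain ⟨s, hs, hne⟩ := hx'
    have hsN : s ∈ primePow F (-N) := primePow_anti (by have := hN.1; omega) hs
    have h1 : ∫ t in primePow F (-N), ψ (a * (x + t) ^ 2) ∂haarF F =
        ψ (2 * a * x * s) * ∫ t in primePow F (-N), ψ (a * (x + t) ^ 2) ∂haarF F := by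
      rw [← integral_const_mul, ← setIntegral_add_left hsN]
      refine setIntegral_congr_fun (measurableSet_primePow _) fun t ht => ?_
      have e : a * (x + (s + t)) ^ 2 = 2 * a * x * s + a * (x + t) ^ 2 + a * s ^ 2 +
          2 * a * (s * t) := by ring
      have h3 : ψ (2 * a * (s * t)) = 1 := by
        refine hψ.eq_one ((mul_mem_primePow_iff h2a).2 (primePow_anti ?_ (mul_mem_primePow hs ht)))
        omega
      rw [e, AddChar.map_add_eq_mul, AddChar.map_add_eq_mul, AddChar.map_add_eq_mul, h3,
        hN.psi_eq_one hψ hs, mul_one, mul_one]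
    by_contra h0
    exact hne (mul_right_cancel₀ h0 (h1.symm.trans (one_mul _).symm))

omit [CharZero F] hψ in
lemma gaussInt_of_add_sq {a : F} {N : ℤ} {x : F} (hx : x ∈ primePow F (-N)) :
    ∫ t in primePow F (-N), ψ (a * (t + x) ^ 2) ∂haarF F = gaussInt ψ a N := by
  simp only [add_comm _ x]
  exact setIntegral_add_left hx (fun t => ψ (a * t ^ 2))

/-- Gauss integrals stabilize: integrate `ψ (a (x + t)²)` over `x ∈ 𝔭 ^ (-M)` and `t ∈ 𝔭 ^ (-N)` in
both orders. -/
lemma IsStable.gaussInt_eq_of_le {a : F} (ha : a ≠ 0) {N M : ℤ} (hN : IsStable δ a N)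
    (hM : N ≤ M) : gaussInt ψ a M = gaussInt ψ a N := by
  classical
  have hc := hψ.continuous
  have h := setIntegral_swap (f := fun x t : F => ψ (a * (x + t) ^ 2))
    (by simp only [Function.uncurry_def]; fun_prop) (-M) (-N)
  simp only [hN.setIntegral_add_sq hψ ha] at h
  rw [setIntegral_ite_primePow (by linarith), setIntegral_congr_fun (measurableSet_primePow _)
    (fun t ht => gaussInt_of_add_sq (primePow_anti (by linarith) ht) :
      Set.EqOn _ (fun _ => gaussInt ψ a M) _), setIntegral_const_primePow] at h
  refine (mul_left_cancel₀ ?_ h).symm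
  exact_mod_cast (zpow_pos (resCard_pos F) _).ne'

lemma IsStable.gaussInt_eq {a : F} (ha : a ≠ 0) {N : ℤ} (hN : IsStable δ a N) :
    gaussInt ψ a N = gaussVal ψ δ a := by
  rw [gaussVal, ← hN.gaussInt_eq_of_le hψ ha (le_max_left N _),
    ← (isStable_default δ a).gaussInt_eq_of_le hψ ha (le_max_right N _)]

lemma gaussVal_mul_sq {a b : F} (ha : a ≠ 0) (hb : b ≠ 0) :
    gaussVal ψ δ (a * b ^ 2) = ((nabs b)⁻¹ : ℝ) * gaussVal ψ δ a := by
  have hab : a * b ^ 2 ≠ 0 := mul_ne_zero ha (pow_ne_zero _ hb)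
  have h1 := isStable_default δ (a * b ^ 2)
  have h2 := isStable_default δ a
  set N1 := |ord δ + ord (2 * (a * b ^ 2))| + |ord δ + 2 * ord (2 * (a * b ^ 2)) - ord (a * b ^ 2)|
  set N2 := |ord δ + ord (2 * a)| + |ord δ + 2 * ord (2 * a) - ord a|
  have h1 := h1.mono (le_max_left N1 (N2 + ord b))
  have h2 := h2.mono (show N2 ≤ max N1 (N2 + ord b) - ord b by omega)
  rw [← h1.gaussInt_eq hψ hab, ← h2.gaussInt_eq hψ ha, gaussInt, gaussInt]
  simp only [mul_assoc, ← mul_pow]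
  rw [setIntegral_comp_mul hb _ (fun x => ψ (a * x ^ 2))]
  congr 4; ring

omit [CharZero F] in
lemma gaussVal_neg (a : F) : gaussVal ψ δ (-a) = conj (gaussVal ψ δ a) := by
  rw [gaussVal, gaussVal, gaussInt, gaussInt, ← integral_conj]
  simp only [hψ.conj_eq, mul_neg, ord_neg, neg_mul]

/-- The absolute value of the Gauss integral: substitute `x + t` for `x` in one factor, and integrate
over `x` first. -/
lemma gaussVal_mul_conj {a : F} (ha : a ≠ 0) :
    gaussVal ψ δ a * conj (gaussVal ψ δ a) = ((nabs (2 * a))⁻¹ * (nabs δ)⁻¹ : ℝ) := by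
  classical
  have hc := hψ.continuous
  have hN := isStable_default δ a
  set N := |ord δ + ord (2 * a)| + |ord δ + 2 * ord (2 * a) - ord a|
  have h2a := two_mul_ne_zero ha
  have e1 : gaussVal ψ δ a * conj (gaussVal ψ δ a) =
      ∫ x in primePow F (-N), ∫ t in primePow F (-N),
        ψ (-(a * t ^ 2)) * ψ (-(2 * a * t) * x) ∂haarF F ∂haarF F := by
    rw [← gaussVal_neg hψ, gaussVal, gaussVal]
    simp only [mul_neg, ord_neg]
    rw [gaussInt, ← integral_mul_const]
    refine setIntegral_congr_fun (measurableSet_primePow _) fun x hx => ?_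
    rw [← gaussInt_of_add_sq hx, ← integral_const_mul]
    congr 1; ext t
    rw [← AddChar.map_add_eq_mul, ← AddChar.map_add_eq_mul]
    congr 1; ring
  rw [e1, setIntegral_swap (f := fun x t => ψ (-(a * t ^ 2)) * ψ (-(2 * a * t) * x))
    (by simp only [Function.uncurry_def]; fun_prop)]
  have e2 : ∀ t, ∫ x in primePow F (-N), ψ (-(a * t ^ 2)) * ψ (-(2 * a * t) * x) ∂haarF F =
      if t ∈ primePow F (N - ord δ - ord (2 * a)) then (((resCard F : ℝ) ^ (- -N) : ℝ) : ℂ)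
        else 0 := by
    intro t
    rw [integral_const_mul, hψ.setIntegral, neg_mem_primePow, mul_mem_primePow_iff h2a]
    have : -ord δ - -N - ord (2 * a) = N - ord δ - ord (2 * a) := by ring
    rw [this]
    split_ifs with ht
    · rw [AddChar.map_neg_eq_inv, hN.psi_eq_one hψ ht]; simp
    · simp
  simp only [e2]
  rw [setIntegral_ite_primePow (by have := hN.1; omega), nabs_of_ne h2a, nabs_of_ne hψ.ne_zero,
    ← Complex.ofReal_mul, ← zpow_add₀ (resCard_pos F).ne', ← zpow_neg, ← zpow_neg,
    ← zpow_add₀ (resCard_pos F).ne']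
  congr 2; ring

/-- The isometry `⟨a, b⟩ ≅ ⟨a + b, a b / (a + b)⟩` of binary forms, at the level of Gauss
integrals. -/
lemma gaussVal_mul_gaussVal {a b : F} (ha : a ≠ 0) (hb : b ≠ 0) (hab : a + b ≠ 0) :
    gaussVal ψ δ a * gaussVal ψ δ b = gaussVal ψ δ (a + b) * gaussVal ψ δ (a * b / (a + b)) := by
  classical
  have hc := hψ.continuous
  have hd : a * b / (a + b) ≠ 0 := div_ne_zero (mul_ne_zero ha hb) hab
  have h1 := isStable_default δ a
  have h2 := isStable_default δ b
  have h3 := isStable_default δ (a + b)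
  have h4 := isStable_default δ (a * b / (a + b))
  set N1 := |ord δ + ord (2 * a)| + |ord δ + 2 * ord (2 * a) - ord a|
  set N2 := |ord δ + ord (2 * b)| + |ord δ + 2 * ord (2 * b) - ord b|
  set N3 := |ord δ + ord (2 * (a + b))| + |ord δ + 2 * ord (2 * (a + b)) - ord (a + b)|
  set N4 := |ord δ + ord (2 * (a * b / (a + b)))| +
    |ord δ + 2 * ord (2 * (a * b / (a + b))) - ord (a * b / (a + b))|
  set N := max N1 (max N2 N4)
  set M := max (max N N3) (N - ord (b / (a + b)))
  have h1 := h1.mono (show N1 ≤ N by omega)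
  have h2 := h2.mono (show N2 ≤ N by omega)
  have h3 := h3.mono (show N3 ≤ M by omega)
  have h4 := h4.mono (show N4 ≤ N by omega)
  have h := setIntegral_swap (f := fun x t : F => ψ (a * x ^ 2) * ψ (b * (x + t) ^ 2))
    (by simp only [Function.uncurry_def]; fun_prop) (-M) (-N)
  simp only [integral_const_mul] at h
  simp only [h2.setIntegral_add_sq hψ hb, mul_ite, mul_zero] at h
  rw [setIntegral_ite_mem_primePow (by omega), integral_mul_const] at h
  have e : ∀ t ∈ primePow F (-N), ∫ x in primePow F (-M), ψ (a * x ^ 2) * ψ (b * (x + t) ^ 2)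
      ∂haarF F = gaussInt ψ (a + b) M * ψ (a * b / (a + b) * t ^ 2) := by
    intro t ht
    have hs : b / (a + b) * t ∈ primePow F (-M) :=
      primePow_anti (by omega) (mul_mem_primePow (self_mem_primePow _) ht)
    rw [← gaussInt_of_add_sq hs, ← integral_mul_const]
    congr 1; ext x
    rw [← AddChar.map_add_eq_mul, ← AddChar.map_add_eq_mul]
    congr 1
    field_simp
    ring
  rw [setIntegral_congr_fun (measurableSet_primePow _) e, integral_const_mul,
    ← gaussInt, ← gaussInt, h1.gaussInt_eq hψ ha, h2.gaussInt_eq hψ hb, h3.gaussInt_eq hψ hab,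
    h4.gaussInt_eq hψ hd] at h
  exact h

/-! ### Weil constants as Gauss integrals -/

/-- The integral of a Fourier transform against a quadratic character, computed by completing the
square. -/
lemma IsSchwartz.integral_fourierT_mul_psi {φ : F → ℂ} (h : IsSchwartz φ) {a : F}
    (ha : a ≠ 0) : ∫ x, fourierT ψ δ φ x * ψ (-(x ^ 2 / (4 * a))) ∂haarF F =
      (Real.sqrt (nabs δ) : ℂ) * gaussVal ψ δ (-(1 / (4 * a))) *
        ∫ x, φ x * ψ (a * x ^ 2) ∂haarF F := by
  have hc := hψ.continuous
  have h4 : (4 : F) ≠ 0 := by norm_num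
  have ha' : -(1 / (4 * a)) ≠ 0 := by simp [ha]
  obtain ⟨m, n, h⟩ := h
  have hb := h.isBounded_fourierT hψ
  have hs := isStable_default δ (-(1 / (4 * a)))
  set N1 := |ord δ + ord (2 * -(1 / (4 * a)))| +
    |ord δ + 2 * ord (2 * -(1 / (4 * a))) - ord (-(1 / (4 * a)))|
  set N := max N1 (max (- (m + ord (2 * a))) (ord δ + n))
  have hs := hs.mono (show N1 ≤ N by omega)
  have hb := hb.mono (m' := -N) (by omega) le_rfl
  rw [hb.integral_eq, h.integral_eq, ← integral_const_mul]
  have e1 : ∀ x, fourierT ψ δ φ x * ψ (-(x ^ 2 / (4 * a))) = ∫ y in primePow F m,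
      (Real.sqrt (nabs δ) : ℂ) * (φ y * ψ (a * y ^ 2)) *
        ψ (-(1 / (4 * a)) * (x + -(2 * a * y)) ^ 2) ∂haarF F := by
    intro x
    rw [fourierT, h.integral_eq, mul_assoc, ← integral_mul_const, ← integral_const_mul]
    congr 1; ext y
    rw [mul_assoc, mul_assoc, mul_assoc, ← AddChar.map_add_eq_mul, ← AddChar.map_add_eq_mul]
    congr 3
    field_simp
    ring
  simp only [e1]
  rw [setIntegral_swap (f := fun x y => (Real.sqrt (nabs δ) : ℂ) * (φ y * ψ (a * y ^ 2)) *
        ψ (-(1 / (4 * a)) * (x + -(2 * a * y)) ^ 2))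
    (by have := h.continuous; simp only [Function.uncurry_def]; fun_prop)]
  refine setIntegral_congr_fun (measurableSet_primePow _) fun y hy => ?_
  have hy' : -(2 * a * y) ∈ primePow F (-N) := by
    rw [neg_mem_primePow, mul_mem_primePow_iff (two_mul_ne_zero ha)]
    exact primePow_anti (by omega) hy
  rw [integral_const_mul, gaussInt_of_add_sq hy', hs.gaussInt_eq hψ ha']
  ring

lemma gaussVal_neg_inv {a : F} (ha : a ≠ 0) :
    gaussVal ψ δ (-(1 / (4 * a))) = (nabs (2 * a) : ℂ) * conj (gaussVal ψ δ a) := by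
  have h2a := two_mul_ne_zero ha
  have : -(1 / (4 * a)) = -(a * ((2 * a)⁻¹) ^ 2) := by field_simp; norm_num
  rw [this, gaussVal_neg hψ, gaussVal_mul_sq hψ ha (inv_ne_zero h2a)]
  simp

omit [CharZero F] [MeasurableSpace F] [BorelSpace F] hψ in
lemma isBounded_indicator_primePow {m n : ℤ} (h : m ≤ n) :
    IsBounded ((primePow F m).indicator (fun _ => (1 : ℂ))) m n := by
  refine ⟨fun x hx => Set.indicator_of_notMem hx _, fun x y hy => ?_⟩
  by_cases hx : x ∈ primePow F m
  · rw [Set.indicator_of_mem hx, Set.indicator_of_mem (add_mem_primePow hx (primePow_anti h hy))]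
  · rw [Set.indicator_of_notMem hx, Set.indicator_of_notMem]
    rwa [add_mem_primePow_iff (primePow_anti h hy)]

lemma isWeilConstant_aux {a : F} (ha : a ≠ 0) {φ : F → ℂ} (h : IsSchwartz φ) :
    ∫ x, φ x * ψ (a * x ^ 2) ∂haarF F =
      ((Real.sqrt (nabs (2 * a)) : ℂ) * (Real.sqrt (nabs δ) : ℂ) * gaussVal ψ δ a) *
        ((Real.sqrt (nabs (2 * a)))⁻¹ : ℝ) *
        ∫ x, fourierT ψ δ φ x * ψ (-(x ^ 2 / (4 * a))) ∂haarF F := by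
  rw [h.integral_fourierT_mul_psi hψ ha, gaussVal_neg_inv hψ ha]
  have h1 := gaussVal_mul_conj hψ ha
  have h2 := sqrt_nabs_mul_self δ
  have h3 : (Real.sqrt (nabs (2 * a)) : ℂ) * ((Real.sqrt (nabs (2 * a)))⁻¹ : ℝ) = 1 := by
    rw [← Complex.ofReal_mul, mul_inv_cancel₀
      (Real.sqrt_pos.2 (nabs_pos (two_mul_ne_zero ha))).ne', Complex.ofReal_one]
  have h4 : ((nabs (2 * a))⁻¹ * (nabs δ)⁻¹ : ℝ) * (nabs (2 * a) : ℂ) * (nabs δ : ℂ) = 1 := by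
    have : ((nabs (2 * a))⁻¹ * (nabs δ)⁻¹) * nabs (2 * a) * nabs δ = 1 := by
      have h5 := nabs_ne_zero hψ.ne_zero
      have h6 := nabs_ne_zero (two_mul_ne_zero ha)
      field_simp
    exact_mod_cast this
  set I := ∫ x, φ x * ψ (a * x ^ 2) ∂haarF F
  set s := (Real.sqrt (nabs (2 * a)) : ℂ)
  set s' := (((Real.sqrt (nabs (2 * a)))⁻¹ : ℝ) : ℂ)
  set d := (Real.sqrt (nabs δ) : ℂ)
  set g := gaussVal ψ δ a
  calc I = (s * s') * (((nabs (2 * a))⁻¹ * (nabs δ)⁻¹ : ℝ) * (nabs (2 * a) : ℂ) * (nabs δ : ℂ))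
        * I := by rw [h3, h4]; ring
    _ = (s * s') * ((g * conj g) * (nabs (2 * a) : ℂ) * (d * d)) * I := by rw [h1, h2]
    _ = _ := by ring

lemma isWeilConstant_gaussVal {a : F} (ha : a ≠ 0) : IsWeilConstant ψ δ a
    ((Real.sqrt (nabs (2 * a)) : ℂ) * (Real.sqrt (nabs δ) : ℂ) * gaussVal ψ δ a) :=
  fun _ h1 h2 => isWeilConstant_aux hψ ha (isSchwartz_of_isLocallyConstant h1 h2)

lemma weilConst_eq {a : F} (ha : a ≠ 0) : weilConst ψ δ a =
    (Real.sqrt (nabs (2 * a)) : ℂ) * (Real.sqrt (nabs δ) : ℂ) * gaussVal ψ δ a := by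
  have h1 := isWeilConstant_gaussVal hψ ha
  have h2 : IsWeilConstant ψ δ a (weilConst ψ δ a) := Classical.epsilon_spec ⟨_, h1⟩
  -- a test function on whose support `ψ (a x²)` is trivial
  set k := max 0 (-ord δ - ord a)
  have hb := isBounded_indicator_primePow (F := F) (le_refl k)
  have hlc : IsLocallyConstant ((primePow F k).indicator (fun _ => (1 : ℂ))) := by
    rw [IsLocallyConstant.iff_eventually_eq]
    exact fun x => mem_nhds_iff_primePow.2 ⟨k, fun y hy => hb.inv x y hy⟩
  have hcs : HasCompactSupport ((primePow F k).indicator (fun _ => (1 : ℂ))) := by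
    have := t2Space F
    exact HasCompactSupport.intro (isCompact_primePow k) hb.supp
  have e1 := h1 _ hlc hcs
  have e2 := h2 _ hlc hcs
  have hI : ∫ x, (primePow F k).indicator (fun _ => (1 : ℂ)) x * ψ (a * x ^ 2) ∂haarF F ≠ 0 := by
    rw [hb.integral_eq, setIntegral_congr_fun (g := fun _ => (1 : ℂ)) (measurableSet_primePow k),
      setIntegral_const_primePow, mul_one]
    · exact_mod_cast (zpow_pos (resCard_pos F) _).ne'
    · intro x hx
      have : a * x ^ 2 ∈ primePow F (-ord δ) :=
        primePow_anti (by omega) (mul_mem_primePow (self_mem_primePow a)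
          (pow_two x ▸ mul_mem_primePow hx hx))
      simp only [Set.indicator_of_mem hx, one_mul]
      exact hψ.eq_one this
  rw [e1] at e2
  rw [e1] at hI
  exact (mul_right_cancel₀ (left_ne_zero_of_mul hI |> right_ne_zero_of_mul)
    (mul_right_cancel₀ (right_ne_zero_of_mul hI) e2)).symm

/-- The identity defining the Weil constant. -/
lemma IsSchwartz.integral_mul_psi {a : F} (ha : a ≠ 0) {φ : F → ℂ} (h : IsSchwartz φ) :
    ∫ x, φ x * ψ (a * x ^ 2) ∂haarF F =
      weilConst ψ δ a * ((Real.sqrt (nabs (2 * a)))⁻¹ : ℝ) *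
        ∫ x, fourierT ψ δ φ x * ψ (-(x ^ 2 / (4 * a))) ∂haarF F := by
  rw [weilConst_eq hψ ha]; exact isWeilConstant_aux hψ ha h

lemma weilConst_mul_conj {a : F} (ha : a ≠ 0) :
    weilConst ψ δ a * conj (weilConst ψ δ a) = 1 := by
  rw [weilConst_eq hψ ha]
  simp only [map_mul, Complex.conj_ofReal]
  have h1 := gaussVal_mul_conj hψ ha
  have h2 := sqrt_nabs_mul_self δ
  have h3 := sqrt_nabs_mul_self (2 * a)
  calc _ = ((Real.sqrt (nabs (2 * a)) : ℂ) * (Real.sqrt (nabs (2 * a)) : ℂ)) *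
        ((Real.sqrt (nabs δ) : ℂ) * (Real.sqrt (nabs δ) : ℂ)) *
        (gaussVal ψ δ a * conj (gaussVal ψ δ a)) := by ring
    _ = 1 := by
      rw [h1, h2, h3]
      have h5 := nabs_ne_zero hψ.ne_zero
      have h6 := nabs_ne_zero (two_mul_ne_zero ha)
      have : nabs (2 * a) * nabs δ * ((nabs (2 * a))⁻¹ * (nabs δ)⁻¹) = 1 := by field_simp
      exact_mod_cast this

lemma weilConst_ne_zero {a : F} (ha : a ≠ 0) : weilConst ψ δ a ≠ 0 :=
  left_ne_zero_of_mul_eq_one (weilConst_mul_conj hψ ha)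

lemma conj_weilConst {a : F} (ha : a ≠ 0) : conj (weilConst ψ δ a) = (weilConst ψ δ a)⁻¹ :=
  eq_inv_of_mul_eq_one_right (weilConst_mul_conj hψ ha)

lemma weilConst_mul_sq {a b : F} (ha : a ≠ 0) (hb : b ≠ 0) :
    weilConst ψ δ (a * b ^ 2) = weilConst ψ δ a := by
  rw [weilConst_eq hψ ha, weilConst_eq hψ (mul_ne_zero ha (pow_ne_zero 2 hb)),
    gaussVal_mul_sq hψ ha hb]
  have : nabs (2 * (a * b ^ 2)) = nabs (2 * a) * nabs b ^ 2 := by simp; ring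
  rw [this, Real.sqrt_mul (nabs_nonneg _), Real.sqrt_sq (nabs_nonneg _)]
  have := nabs_ne_zero hb
  have : (nabs b : ℂ) ≠ 0 := by exact_mod_cast this
  push_cast
  field_simp

lemma weilConst_neg {a : F} (ha : a ≠ 0) :
    weilConst ψ δ (-a) = (weilConst ψ δ a)⁻¹ := by
  rw [← conj_weilConst hψ ha, weilConst_eq hψ ha, weilConst_eq hψ (neg_ne_zero.2 ha),
    gaussVal_neg hψ]
  simp

lemma weilConst_mul_weilConst {a b : F} (ha : a ≠ 0) (hb : b ≠ 0) (hab : a + b ≠ 0) :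
    weilConst ψ δ a * weilConst ψ δ b =
      weilConst ψ δ (a + b) * weilConst ψ δ (a * b * (a + b)) := by
  have hd : a * b / (a + b) ≠ 0 := div_ne_zero (mul_ne_zero ha hb) hab
  have e : a * b * (a + b) = (a * b / (a + b)) * (a + b) ^ 2 := by field_simp
  rw [e, weilConst_mul_sq hψ hd hab, weilConst_eq hψ ha, weilConst_eq hψ hb,
    weilConst_eq hψ hab, weilConst_eq hψ hd]
  have h1 := gaussVal_mul_gaussVal hψ ha hb hab
  have h2 : (Real.sqrt (nabs (2 * a)) : ℂ) * (Real.sqrt (nabs (2 * b)) : ℂ) =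
      (Real.sqrt (nabs (2 * (a + b))) : ℂ) * (Real.sqrt (nabs (2 * (a * b / (a + b)))) : ℂ) := by
    have : nabs (2 * a) * nabs (2 * b) = nabs (2 * (a + b)) * nabs (2 * (a * b / (a + b))) := by
      rw [← nabs_mul, ← nabs_mul]; congr 1; field_simp
    rw [← Complex.ofReal_mul, ← Complex.ofReal_mul, ← Real.sqrt_mul (nabs_nonneg _),
      ← Real.sqrt_mul (nabs_nonneg _), this]
  linear_combination (Real.sqrt (nabs δ) : ℂ) * (Real.sqrt (nabs δ) : ℂ) *
    ((Real.sqrt (nabs (2 * a)) : ℂ) * (Real.sqrt (nabs (2 * b)) : ℂ) * h1 +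
    gaussVal ψ δ (a + b) * gaussVal ψ δ (a * b / (a + b)) * h2)

end Gauss

/-! ### Squares in a local field -/

section Squares

variable {F : Type*} [Field F] [ValuativeRel F] [TopologicalSpace F]
  [IsNonarchimedeanLocalField F]

lemma ord_two_nonneg [CharZero F] : 0 ≤ ord (2 : F) := by
  have h : (2 : F) ∈ primePow F 0 := by
    rw [← one_add_one_eq_two]; exact add_mem_primePow one_mem_primePow_zero one_mem_primePow_zero
  exact (mem_primePow_of_ne two_ne_zero).1 h

/-- Hensel's lemma for the polynomial `X² + X - w`, whose reduction has the simple root `0`. -/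
lemma exists_sq_add_self_eq {w : F} (hw : w ∈ primePow F 1) :
    ∃ u ∈ primePow F 1, u ^ 2 + u = w := by
  let _ := IsTopologicalAddGroup.rightUniformSpace F
  have := isUniformAddGroup_of_addCommGroup (G := F)
  let w' : 𝒪[F] := ⟨w, mem_integers_iff.2 (primePow_anti (by norm_num) hw)⟩
  obtain ⟨u, hu, hu'⟩ := HenselianRing.is_henselian (I := IsLocalRing.maximalIdeal 𝒪[F])
    (Polynomial.X ^ 2 + Polynomial.X - Polynomial.C w' : Polynomial 𝒪[F])
    (by monicity!) 0
    (by simpa using mem_maximalIdeal_iff.2 hw) (by simp)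
  rw [sub_zero] at hu'
  refine ⟨u, mem_maximalIdeal_iff.1 hu', ?_⟩
  have : u ^ 2 + u - w' = 0 := by simpa [Polynomial.IsRoot] using hu
  exact congrArg Subtype.val (sub_eq_zero.1 this)

variable [CharZero F]

/-- Hensel's lemma for squares: `1 + 2 𝔭 ^ n = (1 + 𝔭 ^ n) ^ 2` if `n > ord 2`. -/
lemma exists_one_add_sq_eq {n : ℤ} (hn : ord (2 : F) < n) {z : F} (hz : z ∈ primePow F n) :
    ∃ y ∈ primePow F n, (1 + y) ^ 2 = 1 + 2 * z := by
  have h2 : (2 : F) ≠ 0 := two_ne_zero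
  have hw : z / 2 ∈ primePow F (n - ord (2 : F)) := by
    rw [div_eq_inv_mul, mul_mem_primePow_iff (inv_ne_zero h2)]; simpa using hz
  obtain ⟨u, hu, hu'⟩ := exists_sq_add_self_eq (primePow_anti (by omega) hw)
  refine ⟨2 * u, ?_, ?_⟩
  · have h1 := ord_add_eq_left (x := (1 : F)) one_ne_zero (y := u) (by simpa using hu)
    have : (1 + u) * u ∈ primePow F (n - ord (2 : F)) := by
      rw [show (1 + u) * u = z / 2 by rw [← hu']; ring]; exact hw
    rw [mul_mem_primePow_iff h1.1, h1.2, ord_one, sub_zero] at this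
    exact (mul_mem_primePow_iff h2).2 this
  · have : u ^ 2 + u = z / 2 := hu'
    field_simp at this
    linear_combination 2 * this

lemma isSquare_one_add {s : F} (hs : s ∈ primePow F (2 * ord (2 : F) + 1)) :
    ∃ r : F, r ≠ 0 ∧ r ^ 2 = 1 + s := by
  have h2 : (2 : F) ≠ 0 := two_ne_zero
  have h0 := ord_two_nonneg (F := F)
  have hw : s / 2 ∈ primePow F (ord (2 : F) + 1) := by
    rw [div_eq_inv_mul, mul_mem_primePow_iff (inv_ne_zero h2)]
    exact primePow_anti (by simp; linarith) hs
  obtain ⟨y, hy, h⟩ := exists_one_add_sq_eq (by linarith) hw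
  refine ⟨1 + y, (ord_add_eq_left one_ne_zero (primePow_anti ?_ hy)).1, ?_⟩
  · simp [h0]
  · rw [h]; field_simp

/-- The norm form of a quadratic field extension is anisotropic and hence proper. -/
lemma mem_primePow_of_norm {d : F} (hd0 : d ≠ 0) (hd : ¬ IsSquare d) (k : ℤ) {N : ℤ}
    (hN : 2 * ord (2 : F) + |ord d| + |k| ≤ N) {x y : F}
    (h : x ^ 2 - d * y ^ 2 ∈ primePow F k) : x ∈ primePow F (-N) ∧ y ∈ primePow F (-N) := by
  have h0 := ord_two_nonneg (F := F)
  have a1 := neg_abs_le (ord d)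
  have a2 := le_abs_self (ord d)
  have a3 := neg_abs_le k
  have a4 := abs_nonneg (ord d)
  have a5 := abs_nonneg k
  constructor
  · by_contra hx
    have hx0 : x ≠ 0 := by rintro rfl; simp at hx
    rw [mem_primePow_of_ne hx0] at hx
    have hs : -((x ^ 2 - d * y ^ 2) / x ^ 2) ∈ primePow F (2 * ord (2 : F) + 1) := by
      rw [neg_mem_primePow, div_eq_inv_mul, mul_mem_primePow_iff (inv_ne_zero (pow_ne_zero 2 hx0))]
      refine primePow_anti ?_ h
      simp; linarith
    obtain ⟨r, hr, h1⟩ := isSquare_one_add hs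
    have h2 : d * y ^ 2 = (x * r) ^ 2 := by
      rw [mul_pow, h1]; field_simp; ring
    have hy0 : y ≠ 0 := by
      rintro rfl
      have : (x * r) ^ 2 ≠ 0 := pow_ne_zero 2 (mul_ne_zero hx0 hr)
      simp at h2; tauto
    exact hd ⟨x * r / y, by field_simp; linear_combination h2⟩
  · by_contra hy
    have hy0 : y ≠ 0 := by rintro rfl; simp at hy
    rw [mem_primePow_of_ne hy0] at hy
    have hdy : d * y ^ 2 ≠ 0 := mul_ne_zero hd0 (pow_ne_zero 2 hy0)
    have hs : (x ^ 2 - d * y ^ 2) / (d * y ^ 2) ∈ primePow F (2 * ord (2 : F) + 1) := by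
      rw [div_eq_inv_mul, mul_mem_primePow_iff (inv_ne_zero hdy)]
      refine primePow_anti ?_ h
      rw [ord_inv, ord_mul hd0 (pow_ne_zero 2 hy0), ord_pow]; push_cast; linarith
    obtain ⟨r, hr, h1⟩ := isSquare_one_add hs
    refine hd ⟨x / (y * r), ?_⟩
    have h2 : x ^ 2 = d * y ^ 2 * r ^ 2 := by rw [h1]; field_simp; ring
    field_simp
    linear_combination -h2

end Squares

/-! ### Index computations in groups -/

section IndexLemmas

/-- Counting squares modulo a subgroup `C` of a commutative group, by means of a subgroup `W` of
finite index on which squaring is injective modulo `C`. -/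
lemma index_range_sq_sup {A : Type*} [CommGroup A] (C W : Subgroup A) (hCW : C ≤ W)
    (hW : W.index ≠ 0) (hK : C.comap (powMonoidHom 2) ⊓ W ≤ C) :
    ((powMonoidHom 2 : A →* A).range ⊔ C).index =
      C.relIndex (C.comap (powMonoidHom 2)) * (W.map (powMonoidHom 2) ⊔ C).relIndex W := by
  set K := C.comap (powMonoidHom 2) with hKdef
  let f : A →* A ⧸ C := (QuotientGroup.mk' C).comp (powMonoidHom 2)
  have hker : f.ker = K := by
    ext x
    exact QuotientGroup.eq_one_iff (N := C) (x ^ 2)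
  have hcomap : ∀ S : Subgroup A, ((S.map (powMonoidHom 2)).map (QuotientGroup.mk' C)).index =
      (S.map (powMonoidHom 2) ⊔ C).index := by
    intro S
    rw [← Subgroup.index_comap_of_surjective _ (QuotientGroup.mk'_surjective C),
      Subgroup.comap_map_eq, QuotientGroup.ker_mk']
  have h1 := Subgroup.index_map W f
  rw [← Subgroup.map_map, hcomap, hker, MonoidHom.range_eq_map f, ← Subgroup.map_map, hcomap,
    ← MonoidHom.range_eq_map] at h1
  have hle : W.map (powMonoidHom 2) ⊔ C ≤ W := by
    refine sup_le ?_ hCW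
    rintro _ ⟨w, hw, rfl⟩
    exact W.pow_mem hw 2
  rw [← Subgroup.relIndex_mul_index hle] at h1
  have h2 : W.index = C.relIndex K * (W ⊔ K).index := by
    rw [← Subgroup.relIndex_mul_index (le_sup_left : W ≤ W ⊔ K), Subgroup.relIndex_sup_left,
      ← Subgroup.inf_relIndex_right]
    congr 2
    refine le_antisymm (fun x hx => hK ⟨hx.2, hx.1⟩) (fun x hx => ⟨hCW hx, ?_⟩)
    exact C.pow_mem hx 2
  have h3 : (W ⊔ K).index ≠ 0 := fun h => hW (by rw [h2, h, mul_zero])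
  rw [h2] at h1
  refine mul_left_cancel₀ h3 ?_
  rw [← h1]; ring

/-- Comparison of a relative index with an index in an additive group, along a map that need not
be a homomorphism. -/
lemma relIndex_eq_index_of_map {A M : Type*} [Group A] [AddGroup M] {W' W : Subgroup A}
    (g : W → M) (hg : Function.Surjective g) (N : AddSubgroup M)
    (h : ∀ w w' : W, (w : A)⁻¹ * w' ∈ W' ↔ -g w + g w' ∈ N) : W'.relIndex W = N.index := by
  rw [Subgroup.relIndex, Subgroup.index_eq_card, AddSubgroup.index_eq_card]
  have hrel : ∀ w w' : W, (QuotientGroup.mk w : W ⧸ W'.subgroupOf W) = QuotientGroup.mk w' ↔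
      (QuotientAddGroup.mk (g w) : M ⧸ N) = QuotientAddGroup.mk (g w') := by
    intro w w'
    rw [QuotientGroup.eq, QuotientAddGroup.eq, ← h]
    rfl
  refine Nat.card_congr (Equiv.ofBijective
    (fun x => Quotient.liftOn' x (fun w => (QuotientAddGroup.mk (g w) : M ⧸ N)) ?_) ⟨?_, ?_⟩)
  · intro w w' hww
    exact (hrel w w').1 (Quotient.sound' hww)
  · intro x y
    induction x using QuotientGroup.induction_on with | H w => ?_
    induction y using QuotientGroup.induction_on with | H w' => ?_
    exact fun h => (hrel w w').2 h
  · intro y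
    induction y using QuotientAddGroup.induction_on with | H m => ?_
    obtain ⟨w, rfl⟩ := hg m
    exact ⟨QuotientGroup.mk w, rfl⟩

end IndexLemmas

/-! ### Square classes of a local field -/

section IndexTwo

variable {F : Type*} [Field F] [ValuativeRel F] [TopologicalSpace F]
  [IsNonarchimedeanLocalField F]

/-- A subgroup has finite index if finitely many families of cosets, each locally constant in a
parameter from the compact ring of integers, exhaust the group. -/
lemma index_ne_zero_of_locallyConstant {A : Type*} [Group A] (W : Subgroup A) (f₁ f₂ : F → A)
    (h₁ : ∀ x ∈ primePow F 0, ∃ m : ℤ, ∀ s ∈ primePow F m, (f₁ x)⁻¹ * f₁ (x + s) ∈ W)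
    (h₂ : ∀ x ∈ primePow F 0, ∃ m : ℤ, ∀ s ∈ primePow F m, (f₂ x)⁻¹ * f₂ (x + s) ∈ W)
    (h : ∀ a, ∃ x ∈ primePow F 0, (f₁ x)⁻¹ * a ∈ W ∨ (f₂ x)⁻¹ * a ∈ W) : W.index ≠ 0 := by
  have hc : CompactSpace (primePow F 0) := isCompact_iff_compactSpace.1 (isCompact_primePow 0)
  have key : ∀ f : F → A,
      (∀ x ∈ primePow F 0, ∃ m : ℤ, ∀ s ∈ primePow F m, (f x)⁻¹ * f (x + s) ∈ W) →
      (Set.range fun x : primePow F 0 => (QuotientGroup.mk (f x) : A ⧸ W)).Finite := by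
    intro f hf
    refine IsLocallyConstant.range_finite ?_
    rw [IsLocallyConstant.iff_eventually_eq]
    rintro ⟨x, hx⟩
    obtain ⟨m, hm⟩ := hf x hx
    have : {y | y - x ∈ primePow F m} ∈ nhds x :=
      mem_nhds_iff_primePow.2 ⟨m, fun y hy => by simpa using hy⟩
    filter_upwards [continuous_subtype_val.continuousAt.preimage_mem_nhds this] with y hy
    have := hm _ hy
    rw [add_sub_cancel] at this
    exact (QuotientGroup.eq.2 this).symm
  have hfin := (key f₁ h₁).union (key f₂ h₂)
  have : Finite (A ⧸ W) := by
    rw [← Set.finite_univ_iff]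
    refine hfin.subset fun a _ => ?_
    induction a using QuotientGroup.induction_on with | H a => ?_
    obtain ⟨x, hx, h | h⟩ := h a
    · exact Or.inl ⟨⟨x, hx⟩, QuotientGroup.eq.2 h⟩
    · exact Or.inr ⟨⟨x, hx⟩, QuotientGroup.eq.2 h⟩
  exact Subgroup.index_ne_zero_of_finite

lemma relIndex_primePowAdd_ne_zero (m n : ℤ) :
    (primePowAdd F m).relIndex (primePowAdd F n) ≠ 0 := by
  have hc : CompactSpace (primePowAdd F n) := isCompact_iff_compactSpace.1 (isCompact_primePow n)
  have : Finite (primePowAdd F n ⧸ (primePowAdd F m).addSubgroupOf (primePowAdd F n)) :=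
    AddSubgroup.quotient_finite_of_isOpen _ ((isOpen_primePow m).preimage continuous_subtype_val)
  exact AddSubgroup.index_ne_zero_of_finite

lemma ord_eq_zero_of_sub_one_mem {x : F} {n : ℤ} (hn : 1 ≤ n) (h : x - 1 ∈ primePow F n) :
    ord x = 0 := by
  have := (ord_add_eq_left (x := (1 : F)) one_ne_zero (y := x - 1)
    (primePow_anti (by simpa using hn) h)).2
  simpa using this

/-- The elements of `Fˣ` whose unit part, with respect to the prime element `ϖ`, lies in
`1 + 𝔭 ^ n`. -/
def unitPartGroup (ϖ : Fˣ) {n : ℤ} (hn : 1 ≤ n) : Subgroup Fˣ where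
  carrier := {x | (x : F) * (ϖ : F) ^ (-ord (x : F)) - 1 ∈ primePow F n}
  mul_mem' := by
    intro x y hx hy
    simp only [Set.mem_ofPred_eq] at hx hy ⊢
    have e : ((x * y : Fˣ) : F) * (ϖ : F) ^ (-ord ((x * y : Fˣ) : F)) =
        ((x : F) * (ϖ : F) ^ (-ord (x : F))) * ((y : F) * (ϖ : F) ^ (-ord (y : F))) := by
      rw [Units.val_mul, ord_mul x.ne_zero y.ne_zero, neg_add, zpow_add₀ ϖ.ne_zero]; ring
    rw [e]
    set a := (x : F) * (ϖ : F) ^ (-ord (x : F))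
    set b := (y : F) * (ϖ : F) ^ (-ord (y : F))
    have : a * b - 1 = (a - 1) * b + (b - 1) := by ring
    rw [this]
    refine add_mem_primePow ?_ hy
    simpa [ord_eq_zero_of_sub_one_mem hn hy] using mul_mem_primePow hx (self_mem_primePow b)
  one_mem' := by simp
  inv_mem' := by
    intro x hx
    simp only [Set.mem_ofPred_eq] at hx ⊢
    have e : ((x⁻¹ : Fˣ) : F) * (ϖ : F) ^ (-ord ((x⁻¹ : Fˣ) : F)) =
        ((x : F) * (ϖ : F) ^ (-ord (x : F)))⁻¹ := by
      rw [Units.val_inv_eq_inv_val, ord_inv, mul_inv, ← zpow_neg]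
    rw [e]
    set a := (x : F) * (ϖ : F) ^ (-ord (x : F)) with ha
    have ha0 : a ≠ 0 := mul_ne_zero x.ne_zero (zpow_ne_zero _ ϖ.ne_zero)
    have : a⁻¹ - 1 = -((a - 1) * a⁻¹) := by field_simp; ring
    rw [this, neg_mem_primePow]
    simpa [ord_eq_zero_of_sub_one_mem hn hx] using mul_mem_primePow hx (self_mem_primePow a⁻¹)

lemma mem_unitPartGroup {ϖ : Fˣ} {n : ℤ} {hn : 1 ≤ n} {x : Fˣ} : x ∈ unitPartGroup ϖ hn ↔
    (x : F) * (ϖ : F) ^ (-ord (x : F)) - 1 ∈ primePow F n := Iff.rfl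

lemma mem_primePowAdd {n : ℤ} {x : F} : x ∈ primePowAdd F n ↔ x ∈ primePow F n := Iff.rfl

lemma ord_unit_mul {ϖ : Fˣ} (hϖ : ord (ϖ : F) = 1) (x : Fˣ) :
    ord ((x : F) * (ϖ : F) ^ (-ord (x : F))) = 0 := by
  rw [ord_mul x.ne_zero (zpow_ne_zero _ ϖ.ne_zero), ord_zpow, hϖ]; ring

lemma unit_part_sq (ϖ x : Fˣ) : ((x ^ 2 : Fˣ) : F) * (ϖ : F) ^ (-ord ((x ^ 2 : Fˣ) : F)) =
    ((x : F) * (ϖ : F) ^ (-ord (x : F))) ^ 2 := by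
  rw [Units.val_pow_eq_pow_val, ord_pow, mul_pow, ← zpow_natCast, ← zpow_natCast, ← zpow_mul]
  congr 2; push_cast; ring

lemma mem_zpowers_iff_eq {ϖ : Fˣ} (hϖ : ord (ϖ : F) = 1) {x : Fˣ} :
    x ∈ Subgroup.zpowers ϖ ↔ (x : F) * (ϖ : F) ^ (-ord (x : F)) = 1 := by
  rw [zpow_neg, mul_inv_eq_one₀ (zpow_ne_zero _ ϖ.ne_zero), Subgroup.mem_zpowers_iff]
  constructor
  · rintro ⟨k, rfl⟩
    simp [hϖ]
  · intro h
    exact ⟨ord (x : F), Units.ext (by rw [Units.val_zpow_eq_zpow_val, ← h])⟩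

lemma zpowers_le_unitPartGroup {ϖ : Fˣ} (hϖ : ord (ϖ : F) = 1) {n : ℤ} (hn : 1 ≤ n) :
    Subgroup.zpowers ϖ ≤ unitPartGroup ϖ hn := by
  intro x hx
  rw [mem_unitPartGroup, (mem_zpowers_iff_eq hϖ).1 hx]; simp

open Classical in
lemma index_unitPartGroup_ne_zero {ϖ : Fˣ} (hϖ : ord (ϖ : F) = 1) {n : ℤ} (hn : 1 ≤ n) :
    (unitPartGroup ϖ hn).index ≠ 0 := by
  let f : F → Fˣ := fun x => if h : x ≠ 0 ∧ ord x = 0 then Units.mk0 x h.1 else 1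
  have hf : ∀ x ∈ primePow F 0, ∃ m : ℤ, ∀ s ∈ primePow F m,
      (f x)⁻¹ * f (x + s) ∈ unitPartGroup ϖ hn := by
    intro x hx
    refine ⟨n, fun s hs => ?_⟩
    by_cases h : x ≠ 0 ∧ ord x = 0
    · have h1 := ord_add_eq_left (x := x) h.1 (y := s) (primePow_anti (by linarith [h.2]) hs)
      have h2 : x + s ≠ 0 ∧ ord (x + s) = 0 := ⟨h1.1, h1.2.trans h.2⟩
      simp only [f, dif_pos h, dif_pos h2]
      rw [mem_unitPartGroup]
      have h3 : ord (x⁻¹ * (x + s)) = 0 := by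
        rw [ord_mul (inv_ne_zero h.1) h2.1, ord_inv, h.2, h2.2]; rfl
      simp only [Units.val_mul, Units.val_inv_eq_inv_val, Units.val_mk0, h3, neg_zero, zpow_zero,
        mul_one]
      have : x⁻¹ * (x + s) - 1 = x⁻¹ * s := by field_simp [h.1]; ring
      rw [this, mul_mem_primePow_iff (inv_ne_zero h.1), ord_inv, h.2]
      simpa using hs
    · have h2 : ¬ (x + s ≠ 0 ∧ ord (x + s) = 0) := by
        rintro ⟨h3, h4⟩
        have hx1 : x ∈ primePow F 1 := by
          by_cases hx0 : x = 0
          · simp [hx0]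
          · rw [mem_primePow_of_ne hx0] at hx ⊢
            have : ¬ ord x = 0 := fun h' => h ⟨hx0, h'⟩
            omega
        have := add_mem_primePow hx1 (primePow_anti hn hs)
        rw [mem_primePow_of_ne h3] at this
        omega
      simp only [f, dif_neg h, dif_neg h2, inv_one, one_mul]
      exact one_mem _
  refine index_ne_zero_of_locallyConstant _ f f hf hf fun a => ?_
  refine ⟨(a : F) * (ϖ : F) ^ (-ord (a : F)), ?_, Or.inl ?_⟩
  · have := self_mem_primePow ((a : F) * (ϖ : F) ^ (-ord (a : F)))
    rwa [ord_unit_mul hϖ] at this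
  · have h : (a : F) * (ϖ : F) ^ (-ord (a : F)) ≠ 0 ∧ ord ((a : F) * (ϖ : F) ^ (-ord (a : F))) = 0 :=
      ⟨mul_ne_zero a.ne_zero (zpow_ne_zero _ ϖ.ne_zero), ord_unit_mul hϖ a⟩
    have : (f ((a : F) * (ϖ : F) ^ (-ord (a : F))))⁻¹ * a = ϖ ^ (ord (a : F)) := by
      simp only [f, dif_pos h]
      ext
      simp only [Units.val_mul, Units.val_inv_eq_inv_val, Units.val_mk0, Units.val_zpow_eq_zpow_val]
      rw [zpow_neg]
      field_simp [zpow_ne_zero (ord (a : F)) ϖ.ne_zero]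
    rw [this]
    exact zpowers_le_unitPartGroup hϖ hn (Subgroup.zpow_mem_zpowers ϖ _)

variable [CharZero F]

/-- Modulo the powers of `ϖ`, squaring maps `1 + 𝔭 ^ n` onto `1 + 2 𝔭 ^ n`, by Hensel's lemma. -/
lemma map_sq_unitPartGroup {ϖ : Fˣ} (hϖ : ord (ϖ : F) = 1) {n : ℤ} (hn : 1 ≤ n)
    (hn2 : ord (2 : F) < n) (hn' : 1 ≤ n + ord (2 : F)) :
    (unitPartGroup ϖ hn).map (powMonoidHom 2) ⊔ Subgroup.zpowers ϖ = unitPartGroup ϖ hn' := by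
  have h0 := ord_two_nonneg (F := F)
  refine le_antisymm (sup_le ?_ (zpowers_le_unitPartGroup hϖ hn')) ?_
  · rintro _ ⟨x, hx, rfl⟩
    rw [mem_unitPartGroup]
    have hx : (x : F) * (ϖ : F) ^ (-ord (x : F)) - 1 ∈ primePow F n := hx
    rw [powMonoidHom_apply, unit_part_sq]
    set a := (x : F) * (ϖ : F) ^ (-ord (x : F))
    have : a ^ 2 - 1 = (a - 1) * (a - 1) + 2 * (a - 1) := by ring
    rw [this]
    refine add_mem_primePow (primePow_anti (by omega) (mul_mem_primePow hx hx)) ?_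
    rw [mul_mem_primePow_iff two_ne_zero]; simpa using hx
  · intro x hx
    have hx : (x : F) * (ϖ : F) ^ (-ord (x : F)) - 1 ∈ primePow F (n + ord (2 : F)) := hx
    set a := (x : F) * (ϖ : F) ^ (-ord (x : F)) with ha
    have h2 : (a - 1) / 2 ∈ primePow F n := by
      rw [div_eq_inv_mul, mul_mem_primePow_iff (inv_ne_zero two_ne_zero)]; simpa using hx
    obtain ⟨y, hy, h⟩ := exists_one_add_sq_eq hn2 h2
    have hy1 : (1 : F) + y ≠ 0 ∧ ord (1 + y) = ord (1 : F) :=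
      ord_add_eq_left one_ne_zero (primePow_anti (by simpa using hn) hy)
    rw [Subgroup.mem_sup]
    refine ⟨(Units.mk0 (1 + y) hy1.1) ^ 2, ⟨Units.mk0 (1 + y) hy1.1, ?_, rfl⟩, ϖ ^ (ord (x : F)),
      Subgroup.zpow_mem_zpowers ϖ _, ?_⟩
    · rw [SetLike.mem_coe, mem_unitPartGroup]
      simpa [hy1.2] using hy
    · ext
      simp only [Units.val_mul, Units.val_pow_eq_pow_val, Units.val_mk0,
        Units.val_zpow_eq_zpow_val]
      rw [h, ha]
      have := zpow_ne_zero (ord (x : F)) ϖ.ne_zero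
      rw [zpow_neg]
      field_simp
      ring

lemma relIndex_unitPartGroup {ϖ : Fˣ} (hϖ : ord (ϖ : F) = 1) {n m : ℤ} (hn : 1 ≤ n)
    (hm : 1 ≤ m) : (unitPartGroup ϖ hm).relIndex (unitPartGroup ϖ hn) =
      (primePowAdd F m).relIndex (primePowAdd F n) := by
  refine relIndex_eq_index_of_map
    (fun w => ⟨((w : Fˣ) : F) * (ϖ : F) ^ (-ord ((w : Fˣ) : F)) - 1, w.2⟩) ?_ _ ?_
  · rintro ⟨y, hy⟩
    have hy : y ∈ primePow F n := hy
    have hy1 : (1 : F) + y ≠ 0 ∧ ord (1 + y) = ord (1 : F) :=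
      ord_add_eq_left one_ne_zero (primePow_anti (by simpa using hn) hy)
    refine ⟨⟨Units.mk0 (1 + y) hy1.1, ?_⟩, ?_⟩
    · rw [mem_unitPartGroup]
      simpa [hy1.2] using hy
    · refine Subtype.ext ?_
      simp [hy1.2]
  · rintro ⟨w, hw⟩ ⟨w', hw'⟩
    rw [mem_unitPartGroup, AddSubgroup.mem_addSubgroupOf, mem_primePowAdd]
    have e : ((w⁻¹ * w' : Fˣ) : F) * (ϖ : F) ^ (-ord ((w⁻¹ * w' : Fˣ) : F)) =
        ((w : F) * (ϖ : F) ^ (-ord (w : F)))⁻¹ * ((w' : F) * (ϖ : F) ^ (-ord (w' : F))) := by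
      rw [Units.val_mul, Units.val_inv_eq_inv_val, ord_mul (inv_ne_zero w.ne_zero) w'.ne_zero,
        neg_add, zpow_add₀ ϖ.ne_zero, ord_inv, mul_inv, ← zpow_neg]; ring
    simp only
    rw [e]
    have ha : ord ((w : F) * (ϖ : F) ^ (-ord (w : F))) = 0 := ord_unit_mul hϖ w
    have ha0 : (w : F) * (ϖ : F) ^ (-ord (w : F)) ≠ 0 :=
      mul_ne_zero w.ne_zero (zpow_ne_zero _ ϖ.ne_zero)
    simp only [AddSubgroup.coe_add, AddSubgroup.coe_neg]
    set a := (w : F) * (ϖ : F) ^ (-ord (w : F))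
    set b := (w' : F) * (ϖ : F) ^ (-ord (w' : F))
    have : a⁻¹ * b - 1 = a⁻¹ * (-(a - 1) + (b - 1)) := by field_simp; ring
    rw [this, mul_mem_primePow_iff (inv_ne_zero ha0), ord_inv, ha]
    simp

/-- The number of square classes of a local field, as a multiple of `[𝔭 ^ n : 2 𝔭 ^ n]`. -/
lemma index_squares {n : ℤ} (hn : 1 ≤ n) (hn2 : ord (2 : F) < n) :
    (powMonoidHom 2 : Fˣ →* Fˣ).range.index =
      4 * (primePowAdd F (n + ord (2 : F))).relIndex (primePowAdd F n) := by
  obtain ⟨p, hp0, hp⟩ := exists_ord_eq F 1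
  have h0 := ord_two_nonneg (F := F)
  let ϖ : Fˣ := Units.mk0 p hp0
  have hϖ : ord (ϖ : F) = 1 := hp
  have hn' : 1 ≤ n + ord (2 : F) := by omega
  have h1 := index_range_sq_sup (Subgroup.zpowers ϖ) (unitPartGroup ϖ hn)
    (zpowers_le_unitPartGroup hϖ hn) (index_unitPartGroup_ne_zero hϖ hn) (by
      rintro x ⟨hx, hxW⟩
      have hx : x ^ 2 ∈ Subgroup.zpowers ϖ := hx
      have hxW : (x : F) * (ϖ : F) ^ (-ord (x : F)) - 1 ∈ primePow F n := hxW
      rw [mem_zpowers_iff_eq hϖ] at hx ⊢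
      rw [unit_part_sq, sq_eq_one_iff] at hx
      rcases hx with hx | hx
      · exact hx
      · exfalso
        rw [hx] at hxW
        have h2 : (-1 - 1 : F) = -2 := by norm_num
        rw [h2, neg_mem_primePow, mem_primePow_of_ne two_ne_zero] at hxW
        omega)
  rw [map_sq_unitPartGroup hϖ hn hn2 hn', relIndex_unitPartGroup hϖ hn hn'] at h1
  -- the elements with square in `⟨ϖ⟩` are those of `±⟨ϖ⟩`
  have h2 : (Subgroup.zpowers ϖ).relIndex ((Subgroup.zpowers ϖ).comap (powMonoidHom 2)) = 2 := by
    rw [Subgroup.relIndex_eq_two_iff]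
    refine ⟨-1, by simp, fun b hb => ?_⟩
    have hb : b ^ 2 ∈ Subgroup.zpowers ϖ := hb
    rw [mem_zpowers_iff_eq hϖ, unit_part_sq, sq_eq_one_iff] at hb
    rw [mem_zpowers_iff_eq hϖ, mem_zpowers_iff_eq hϖ]
    simp only [mul_neg, mul_one, Units.val_neg, ord_neg, neg_mul]
    have h1 : (-1 : F) ≠ 1 := by norm_num
    rcases hb with hb | hb
    · right; rw [hb]; exact ⟨rfl, h1⟩
    · left; rw [hb]; exact ⟨by simp, h1⟩
  -- `s² ϖ ^ j` is a square if and only if `j` is even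
  have h3 : (powMonoidHom 2 : Fˣ →* Fˣ).range.relIndex
      ((powMonoidHom 2 : Fˣ →* Fˣ).range ⊔ Subgroup.zpowers ϖ) = 2 := by
    have key : ∀ (s : Fˣ) (j : ℤ), s ^ 2 * ϖ ^ j ∈ (powMonoidHom 2 : Fˣ →* Fˣ).range ↔ Even j := by
      intro s j
      constructor
      · rintro ⟨r, hr⟩
        have := congrArg (fun u : Fˣ => ord (u : F)) hr
        simp only [powMonoidHom_apply, Units.val_pow_eq_pow_val, Units.val_mul,
          Units.val_zpow_eq_zpow_val] at this
        rw [ord_mul (pow_ne_zero 2 s.ne_zero) (zpow_ne_zero _ ϖ.ne_zero), ord_pow, ord_pow, ord_zpow,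
          hϖ] at this
        refine ⟨ord (r : F) - ord (s : F), ?_⟩
        push_cast at this
        linarith
      · rintro ⟨i, rfl⟩
        exact ⟨s * ϖ ^ i, by rw [powMonoidHom_apply, mul_pow, zpow_add, pow_two (ϖ ^ i)]⟩
    rw [Subgroup.relIndex_eq_two_iff]
    refine ⟨ϖ, Subgroup.mem_sup_right (Subgroup.mem_zpowers ϖ), fun b hb => ?_⟩
    obtain ⟨_, ⟨s, rfl⟩, _, ⟨j, rfl⟩, rfl⟩ := Subgroup.mem_sup.1 hb
    simp only [powMonoidHom_apply]
    rw [mul_assoc, ← zpow_add_one, key, key, Int.even_add_one]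
    by_cases hj : Even j <;> simp [Xor, hj]
  rw [← Subgroup.relIndex_mul_index (le_sup_left : (powMonoidHom 2 : Fˣ →* Fˣ).range ≤ _ ⊔
    Subgroup.zpowers ϖ), h3, h1, h2]
  ring

end IndexTwo

/-! ### Norm groups of quadratic extensions have index two -/

section NormGroup

variable {F : Type*} [Field F] [ValuativeRel F] [TopologicalSpace F]
  [IsNonarchimedeanLocalField F] {d : F}

omit [ValuativeRel F] [TopologicalSpace F] [IsNonarchimedeanLocalField F] in
lemma norm_eq_sub (x : QuadraticAlgebra F d 0) :
    QuadraticAlgebra.norm x = x.re ^ 2 - d * x.im ^ 2 := by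
  rw [QuadraticAlgebra.norm_def]; ring

variable [hd : Fact (∀ r : F, r ^ 2 ≠ d + 0 * r)]

/-- The scalars, as a subgroup of the multiplicative group of the quadratic extension `F(√d)`. The
quadratic algebra with `√d ² = d + 0 · √d` is a field under the condition `r² ≠ d + 0 * r` for all
`r`, that is, for `d` not a square. -/
def scalarGroup (d : F) [Fact (∀ r : F, r ^ 2 ≠ d + 0 * r)] :
    Subgroup (QuadraticAlgebra F d 0)ˣ where
  carrier := {x | (x : QuadraticAlgebra F d 0).im = 0}
  mul_mem' := by
    intro x y hx hy
    simp only [Set.mem_ofPred_eq] at hx hy ⊢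
    simp [hx, hy]
  one_mem' := by simp [QuadraticAlgebra.im_one]
  inv_mem' := by
    intro x hx
    simp only [Set.mem_ofPred_eq] at hx ⊢
    rw [Units.val_inv_eq_inv_val, QuadraticAlgebra.im_inv]
    simp [hx]

omit [ValuativeRel F] [TopologicalSpace F] [IsNonarchimedeanLocalField F] in
lemma mem_scalarGroup {x : (QuadraticAlgebra F d 0)ˣ} :
    x ∈ scalarGroup d ↔ (x : QuadraticAlgebra F d 0).im = 0 := Iff.rfl

omit hd in
lemma one_add_slope {n : ℤ} (hn : 1 ≤ ord d + 2 * n) {z w : F} (hz : z ∈ primePow F n)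
    (hw : w ∈ primePow F n) : (1 : F) + d * (z * w) ≠ 0 ∧ ord (1 + d * (z * w)) = 0 := by
  have := ord_add_eq_left (x := (1 : F)) one_ne_zero (y := d * (z * w)) (primePow_anti
    (by simp; linarith) (mul_mem_primePow (self_mem_primePow d) (mul_mem_primePow hz hw)))
  simpa using this

/-- The elements `x + y √d` of the multiplicative group of `F(√d)` with `x ≠ 0` and
`y / x ∈ 𝔭 ^ n`. -/
def slopeGroup (d : F) [Fact (∀ r : F, r ^ 2 ≠ d + 0 * r)] {n : ℤ} (hn : 1 ≤ ord d + 2 * n) :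
    Subgroup (QuadraticAlgebra F d 0)ˣ where
  carrier := {x | (x : QuadraticAlgebra F d 0).re ≠ 0 ∧
    (x : QuadraticAlgebra F d 0).im / (x : QuadraticAlgebra F d 0).re ∈ primePow F n}
  mul_mem' := by
    rintro x y ⟨hx, hx'⟩ ⟨hy, hy'⟩
    simp only [Set.mem_ofPred_eq, Units.val_mul, QuadraticAlgebra.re_mul, QuadraticAlgebra.im_mul]
    set a := (x : QuadraticAlgebra F d 0).re
    set b := (x : QuadraticAlgebra F d 0).im
    set a' := (y : QuadraticAlgebra F d 0).re
    set b' := (y : QuadraticAlgebra F d 0).im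
    have h := one_add_slope hn hx' hy'
    have e : a * a' + d * b * b' = (a * a') * (1 + d * ((b / a) * (b' / a'))) := by
      field_simp
    have hne : a * a' + d * b * b' ≠ 0 := by
      rw [e]; exact mul_ne_zero (mul_ne_zero hx hy) h.1
    refine ⟨hne, ?_⟩
    have e2 : (a * b' + b * a' + 0 * b * b') / (a * a' + d * b * b') =
        (1 + d * ((b / a) * (b' / a')))⁻¹ * (b' / a' + b / a) := by
      rw [e]; have := h.1; field_simp; ring
    rw [e2, mul_mem_primePow_iff (inv_ne_zero h.1), ord_inv, h.2]
    simpa using add_mem_primePow hy' hx'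
  one_mem' := by simp [QuadraticAlgebra.re_one, QuadraticAlgebra.im_one]
  inv_mem' := by
    rintro x ⟨hx, hx'⟩
    have hN : QuadraticAlgebra.norm (x : QuadraticAlgebra F d 0) ≠ 0 := by
      rw [Ne, QuadraticAlgebra.norm_eq_zero_iff_eq_zero]; exact x.ne_zero
    simp only [Set.mem_ofPred_eq, Units.val_inv_eq_inv_val, QuadraticAlgebra.im_inv,
      QuadraticAlgebra.re_inv]
    refine ⟨by simp [hN, hx], ?_⟩
    rw [zero_mul, add_zero, neg_div, mul_div_mul_left _ _ (inv_ne_zero hN), neg_mem_primePow]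
    exact hx'

lemma mem_slopeGroup {n : ℤ} {hn : 1 ≤ ord d + 2 * n} {x : (QuadraticAlgebra F d 0)ˣ} :
    x ∈ slopeGroup d hn ↔ (x : QuadraticAlgebra F d 0).re ≠ 0 ∧
      (x : QuadraticAlgebra F d 0).im / (x : QuadraticAlgebra F d 0).re ∈ primePow F n := Iff.rfl

lemma scalarGroup_le_slopeGroup {n : ℤ} (hn : 1 ≤ ord d + 2 * n) :
    scalarGroup d ≤ slopeGroup d hn := by
  intro x hx
  rw [mem_scalarGroup] at hx
  rw [mem_slopeGroup, hx]
  refine ⟨fun h => x.ne_zero (QuadraticAlgebra.ext h hx), by simp⟩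

omit [ValuativeRel F] [TopologicalSpace F] [IsNonarchimedeanLocalField F] in
/-- Division in the quadratic extension, up to a scalar. -/
lemma exists_inv_mul_eq (x y : (QuadraticAlgebra F d 0)ˣ) : ∃ c : F, c ≠ 0 ∧
    ((x⁻¹ * y : (QuadraticAlgebra F d 0)ˣ) : QuadraticAlgebra F d 0).re =
      c * ((x : QuadraticAlgebra F d 0).re * (y : QuadraticAlgebra F d 0).re -
        d * (x : QuadraticAlgebra F d 0).im * (y : QuadraticAlgebra F d 0).im) ∧
    ((x⁻¹ * y : (QuadraticAlgebra F d 0)ˣ) : QuadraticAlgebra F d 0).im =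
      c * ((x : QuadraticAlgebra F d 0).re * (y : QuadraticAlgebra F d 0).im -
        (x : QuadraticAlgebra F d 0).im * (y : QuadraticAlgebra F d 0).re) := by
  have hN : QuadraticAlgebra.norm (x : QuadraticAlgebra F d 0) ≠ 0 := by
    rw [Ne, QuadraticAlgebra.norm_eq_zero_iff_eq_zero]; exact x.ne_zero
  refine ⟨(QuadraticAlgebra.norm (x : QuadraticAlgebra F d 0))⁻¹, inv_ne_zero hN, ?_, ?_⟩
  · rw [Units.val_mul, Units.val_inv_eq_inv_val, QuadraticAlgebra.re_mul,
      QuadraticAlgebra.re_inv, QuadraticAlgebra.im_inv]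
    ring
  · rw [Units.val_mul, Units.val_inv_eq_inv_val, QuadraticAlgebra.im_mul,
      QuadraticAlgebra.re_inv, QuadraticAlgebra.im_inv]
    ring

lemma inv_mul_mem_slopeGroup {n : ℤ} {hn : 1 ≤ ord d + 2 * n} {x y : (QuadraticAlgebra F d 0)ˣ}
    (h : (x : QuadraticAlgebra F d 0).re * (y : QuadraticAlgebra F d 0).re -
        d * (x : QuadraticAlgebra F d 0).im * (y : QuadraticAlgebra F d 0).im ≠ 0) :
    x⁻¹ * y ∈ slopeGroup d hn ↔
    ((x : QuadraticAlgebra F d 0).re * (y : QuadraticAlgebra F d 0).im -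
        (x : QuadraticAlgebra F d 0).im * (y : QuadraticAlgebra F d 0).re) /
      ((x : QuadraticAlgebra F d 0).re * (y : QuadraticAlgebra F d 0).re -
        d * (x : QuadraticAlgebra F d 0).im * (y : QuadraticAlgebra F d 0).im) ∈ primePow F n := by
  obtain ⟨c, hc, h1, h2⟩ := exists_inv_mul_eq x y
  rw [mem_slopeGroup, h1, h2, mul_div_mul_left _ _ hc]
  simp [hc, h]

/-- The unit `x + y √d` of `F(√d)`, for `(x, y) ≠ (0, 0)`. -/
noncomputable def mkUnit (d : F) [Fact (∀ r : F, r ^ 2 ≠ d + 0 * r)] (x y : F) (h : x ≠ 0 ∨ y ≠ 0) :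
    (QuadraticAlgebra F d 0)ˣ :=
  Units.mk0 ⟨x, y⟩ (by
    intro h0
    have h1 := congrArg QuadraticAlgebra.re h0
    have h2 := congrArg QuadraticAlgebra.im h0
    simp at h1 h2
    tauto)

omit [ValuativeRel F] [TopologicalSpace F] [IsNonarchimedeanLocalField F] in
@[simp] lemma mkUnit_re (x y : F) (h : x ≠ 0 ∨ y ≠ 0) :
    (mkUnit d x y h : QuadraticAlgebra F d 0).re = x := rfl

omit [ValuativeRel F] [TopologicalSpace F] [IsNonarchimedeanLocalField F] in
@[simp] lemma mkUnit_im (x y : F) (h : x ≠ 0 ∨ y ≠ 0) :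
    (mkUnit d x y h : QuadraticAlgebra F d 0).im = y := rfl

/-- A continuity statement: near a nonzero denominator, `s / (a + b s)` is small when `s` is. -/
lemma exists_forall_div_mem {a : F} (ha : a ≠ 0) (b : F) (n : ℤ) : ∃ m : ℤ, ∀ s ∈ primePow F m,
    a + b * s ≠ 0 ∧ s / (a + b * s) ∈ primePow F n := by
  refine ⟨max (ord a + 1 - ord b) (n + ord a), fun s hs => ?_⟩
  have h := ord_add_eq_left ha (y := b * s) (primePow_anti (by omega)
    (mul_mem_primePow (self_mem_primePow b) hs))
  refine ⟨h.1, ?_⟩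
  rw [div_eq_inv_mul, mul_mem_primePow_iff (inv_ne_zero h.1), ord_inv, h.2]
  exact primePow_anti (by omega) hs

/-- Modulo scalars every unit of `F(√d)` is `1 + z √d` or `z + √d` with `z ∈ 𝔬`, and its class modulo
the slope group is locally constant in `z`. -/
lemma index_slopeGroup_ne_zero {n : ℤ} (hn : 1 ≤ ord d + 2 * n) : (slopeGroup d hn).index ≠ 0 := by
  have hsq : ∀ r : F, r ^ 2 ≠ d := fun r => by simpa using hd.out r
  refine index_ne_zero_of_locallyConstant _ (fun z => mkUnit d 1 z (by simp))
    (fun z => mkUnit d z 1 (by simp)) ?_ ?_ ?_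
  · intro z _
    have h0 : 1 - d * z * z ≠ 0 := by
      intro h
      have hz : z ≠ 0 := by rintro rfl; simp at h
      refine hsq z⁻¹ ?_
      field_simp; linear_combination h
    obtain ⟨m, hm⟩ := exists_forall_div_mem h0 (-(d * z)) n
    refine ⟨m, fun s hs => ?_⟩
    obtain ⟨h1, h2⟩ := hm s hs
    have e : 1 * 1 - d * z * (z + s) = 1 - d * z * z + -(d * z) * s := by ring
    rw [inv_mul_mem_slopeGroup]
    · simp only [mkUnit_re, mkUnit_im, e]
      convert! h2 using 2; ring
    · simp only [mkUnit_re, mkUnit_im, e]; exact h1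
  · intro z _
    have h0 : z * z - d ≠ 0 := by
      intro h
      refine hsq z ?_
      linear_combination h
    obtain ⟨m, hm⟩ := exists_forall_div_mem h0 z n
    refine ⟨m, fun s hs => ?_⟩
    obtain ⟨h1, h2⟩ := hm s hs
    have e : z * (z + s) - d * 1 * 1 = z * z - d + z * s := by ring
    rw [inv_mul_mem_slopeGroup]
    · simp only [mkUnit_re, mkUnit_im, e]
      rw [← neg_mem_primePow]
      rw [← neg_div]; convert! h2 using 2; ring
    · simp only [mkUnit_re, mkUnit_im, e]; exact h1
  · intro a
    set x := (a : QuadraticAlgebra F d 0).re with hx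
    set y := (a : QuadraticAlgebra F d 0).im with hy
    have hxy : x ≠ 0 ∨ y ≠ 0 := by
      by_contra! h
      exact a.ne_zero (QuadraticAlgebra.ext h.1 h.2)
    have hsc : ∀ b : (QuadraticAlgebra F d 0)ˣ, (b : QuadraticAlgebra F d 0).re * y -
        (b : QuadraticAlgebra F d 0).im * x = 0 → b⁻¹ * a ∈ slopeGroup d hn := by
      intro b hb
      apply scalarGroup_le_slopeGroup
      obtain ⟨c, hc, h1, h2⟩ := exists_inv_mul_eq b a
      rw [mem_scalarGroup, h2, hb, mul_zero]
    by_cases hc : x ≠ 0 ∧ y / x ∈ primePow F 0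
    · refine ⟨y / x, hc.2, Or.inl (hsc _ ?_)⟩
      have := hc.1
      simp only [mkUnit_re, mkUnit_im]; field_simp; ring
    · have hy0 : y ≠ 0 := by
        rintro h
        rw [h] at hc hxy
        simp at hc hxy
        exact hxy hc
      refine ⟨x / y, ?_, Or.inr (hsc _ ?_)⟩
      · by_cases hx0 : x = 0
        · simp [hx0]
        · have h1 : y / x ∉ primePow F 0 := fun h => hc ⟨hx0, h⟩
          rw [mem_primePow_of_ne (div_ne_zero hy0 hx0), ord_div hy0 hx0] at h1
          rw [mem_primePow_of_ne (div_ne_zero hx0 hy0), ord_div hx0 hy0]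
          omega
      · simp only [mkUnit_re, mkUnit_im]; field_simp; ring

variable [CharZero F]

/-- Modulo scalars, squaring maps the slopes in `𝔭 ^ n` onto the slopes in `2 𝔭 ^ n`, by Hensel's
lemma. -/
lemma map_sq_slopeGroup {n : ℤ} (hn : 1 ≤ ord d + 2 * n)
    (hn2 : ord (2 : F) < n) (hn3 : 0 ≤ ord d + n) (hn' : 1 ≤ ord d + 2 * (n + ord (2 : F))) :
    (slopeGroup d hn).map (powMonoidHom 2) ⊔ scalarGroup d = slopeGroup d hn' := by
  have h0 := ord_two_nonneg (F := F)
  refine le_antisymm (sup_le ?_ (scalarGroup_le_slopeGroup hn')) ?_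
  · rintro _ ⟨x, ⟨hx, hx'⟩, rfl⟩
    rw [powMonoidHom_apply, mem_slopeGroup, pow_two, Units.val_mul, QuadraticAlgebra.re_mul,
      QuadraticAlgebra.im_mul]
    set a := (x : QuadraticAlgebra F d 0).re
    set b := (x : QuadraticAlgebra F d 0).im
    have h := one_add_slope hn hx' hx'
    have e : a * a + d * b * b = (a * a) * (1 + d * ((b / a) * (b / a))) := by
      field_simp
    refine ⟨by rw [e]; exact mul_ne_zero (mul_ne_zero hx hx) h.1, ?_⟩
    have e2 : (a * b + b * a + 0 * b * b) / (a * a + d * b * b) =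
        (1 + d * ((b / a) * (b / a)))⁻¹ * (2 * (b / a)) := by
      rw [e]; have := h.1; field_simp; ring
    rw [e2, mul_mem_primePow_iff (inv_ne_zero h.1), ord_inv, h.2,
      mul_mem_primePow_iff two_ne_zero]
    simpa using hx'
  · intro x hx
    obtain ⟨hx, hx'⟩ := mem_slopeGroup.1 hx
    set y := (x : QuadraticAlgebra F d 0).im / (x : QuadraticAlgebra F d 0).re with hy
    -- the slope `z` of a square root solves `2 z = y (1 + d z ^ 2)`
    have h1 : -(d * (y * y)) / 2 ∈ primePow F n := by
      rw [div_eq_inv_mul, mul_mem_primePow_iff (inv_ne_zero two_ne_zero), neg_mem_primePow, ord_inv]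
      exact primePow_anti (by omega)
        (mul_mem_primePow (self_mem_primePow d) (mul_mem_primePow hx' hx'))
    obtain ⟨s, hs, hs'⟩ := exists_one_add_sq_eq hn2 h1
    have hR := ord_add_eq_left (x := (2 : F)) two_ne_zero (y := s) (primePow_anti (by omega) hs)
    have hz : y / (2 + s) ∈ primePow F n := by
      rw [div_eq_inv_mul, mul_mem_primePow_iff (inv_ne_zero hR.1), ord_inv, hR.2]
      simpa using hx'
    have hs2 : (1 + s) ^ 2 = 1 - d * y ^ 2 := by
      rw [hs']; field_simp; ring
    rw [Subgroup.mem_sup]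
    refine ⟨(mkUnit d 1 (y / (2 + s)) (by simp)) ^ 2, ⟨mkUnit d 1 (y / (2 + s)) (by simp), ?_, rfl⟩,
      ((mkUnit d 1 (y / (2 + s)) (by simp)) ^ 2)⁻¹ * x, ?_, by simp⟩
    · rw [SetLike.mem_coe, mem_slopeGroup]
      simpa using hz
    · obtain ⟨c, hc, -, h3⟩ := exists_inv_mul_eq ((mkUnit d 1 (y / (2 + s)) (by simp)) ^ 2) x
      have hxim : (x : QuadraticAlgebra F d 0).im = y * (x : QuadraticAlgebra F d 0).re := by
        rw [hy]; field_simp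
      rw [mem_scalarGroup, h3, hxim]
      simp only [pow_two, Units.val_mul, QuadraticAlgebra.re_mul, QuadraticAlgebra.im_mul,
        mkUnit_re, mkUnit_im]
      have := hR.1
      have e : (1 * 1 + d * (y / (2 + s)) * (y / (2 + s))) * y -
          (1 * (y / (2 + s)) + y / (2 + s) * 1 + 0 * (y / (2 + s)) * (y / (2 + s))) = 0 := by
        field_simp
        linear_combination y * hs2
      linear_combination c * (x : QuadraticAlgebra F d 0).re * e

lemma relIndex_slopeGroup {n m : ℤ} (hn : 1 ≤ ord d + 2 * n) (hm : 1 ≤ ord d + 2 * m) :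
    (slopeGroup d hm).relIndex (slopeGroup d hn) =
      (primePowAdd F m).relIndex (primePowAdd F n) := by
  refine relIndex_eq_index_of_map
    (fun w => ⟨((w : (QuadraticAlgebra F d 0)ˣ) : QuadraticAlgebra F d 0).im /
      ((w : (QuadraticAlgebra F d 0)ˣ) : QuadraticAlgebra F d 0).re, w.2.2⟩) ?_ _ ?_
  · rintro ⟨y, hy⟩
    refine ⟨⟨mkUnit d 1 y (by simp), ?_⟩, ?_⟩
    · rw [mem_slopeGroup]
      simpa using mem_primePowAdd.1 hy
    · refine Subtype.ext ?_
      simp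
  · rintro ⟨w, hw, hw'⟩ ⟨v, hv, hv'⟩
    rw [AddSubgroup.mem_addSubgroupOf, mem_primePowAdd]
    simp only [AddSubgroup.coe_add, AddSubgroup.coe_neg]
    have h := one_add_slope hn (neg_mem_primePow.2 hw') hv'
    set a := (w : QuadraticAlgebra F d 0).re
    set b := (w : QuadraticAlgebra F d 0).im
    set a' := (v : QuadraticAlgebra F d 0).re
    set b' := (v : QuadraticAlgebra F d 0).im
    have e : a * a' - d * b * b' = (a * a') * (1 + d * (-(b / a) * (b' / a'))) := by
      field_simp; ring
    have hne : a * a' - d * b * b' ≠ 0 := by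
      rw [e]; exact mul_ne_zero (mul_ne_zero hw hv) h.1
    rw [inv_mul_mem_slopeGroup hne]
    have e2 : (a * b' - b * a') / (a * a' - d * b * b') =
        (1 + d * (-(b / a) * (b' / a')))⁻¹ * (-(b / a) + b' / a') := by
      rw [e]; have := h.1; field_simp; ring
    change (a * b' - b * a') / (a * a' - d * b * b') ∈ _ ↔ _
    rw [e2, mul_mem_primePow_iff (inv_ne_zero h.1), ord_inv, h.2]
    simp

/-- The index of the group generated by the squares and the scalars in the multiplicative group
of a quadratic extension. -/
lemma index_squares_sup_scalarGroup {n : ℤ} (hn2 : ord (2 : F) < n)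
    (hn3 : 0 ≤ ord d + n) :
    ((powMonoidHom 2 : (QuadraticAlgebra F d 0)ˣ →* _).range ⊔ scalarGroup d).index =
      2 * (primePowAdd F (n + ord (2 : F))).relIndex (primePowAdd F n) := by
  have h0 := ord_two_nonneg (F := F)
  have hn : 1 ≤ ord d + 2 * n := by omega
  have hn' : 1 ≤ ord d + 2 * (n + ord (2 : F)) := by omega
  -- `x ^ 2` is a scalar only for `x` in the base field or in its multiple by `√d`
  have hK : ∀ x : (QuadraticAlgebra F d 0)ˣ, x ∈ (scalarGroup d).comap (powMonoidHom 2) ↔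
      (x : QuadraticAlgebra F d 0).re = 0 ∨ (x : QuadraticAlgebra F d 0).im = 0 := by
    intro x
    rw [Subgroup.mem_comap, powMonoidHom_apply, mem_scalarGroup, pow_two, Units.val_mul,
      QuadraticAlgebra.im_mul]
    have : (x : QuadraticAlgebra F d 0).re * (x : QuadraticAlgebra F d 0).im +
        (x : QuadraticAlgebra F d 0).im * (x : QuadraticAlgebra F d 0).re +
        0 * (x : QuadraticAlgebra F d 0).im * (x : QuadraticAlgebra F d 0).im =
        2 * ((x : QuadraticAlgebra F d 0).re * (x : QuadraticAlgebra F d 0).im) := by ring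
    rw [this]; simp
  have h1 := index_range_sq_sup (scalarGroup d) (slopeGroup d hn)
    (scalarGroup_le_slopeGroup hn) (index_slopeGroup_ne_zero hn) (by
      rintro x ⟨hx, hxW⟩
      rcases (hK x).1 hx with h | h
      · exact absurd h hxW.1
      · exact h)
  have h2 : (scalarGroup d).relIndex ((scalarGroup d).comap (powMonoidHom 2)) = 2 := by
    rw [Subgroup.relIndex_eq_two_iff]
    refine ⟨mkUnit d 0 1 (by simp), (hK _).2 (Or.inl rfl), fun b hb => ?_⟩
    have hb' : ¬ ((b : QuadraticAlgebra F d 0).re = 0 ∧ (b : QuadraticAlgebra F d 0).im = 0) :=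
      fun h => b.ne_zero (QuadraticAlgebra.ext h.1 h.2)
    rw [hK] at hb
    rw [mem_scalarGroup, mem_scalarGroup, Units.val_mul, QuadraticAlgebra.im_mul]
    simp only [mkUnit_re, mkUnit_im, Xor]
    simp
    tauto
  rw [h1, map_sq_slopeGroup hn hn2 hn3 hn', relIndex_slopeGroup hn hn', h2]

/-- The norm group of a quadratic extension `E` of a local field `F` has index two. The norms that
are squares in `Fˣ` come exactly from `Eˣ² Fˣ`, so `[N Eˣ : Fˣ²] = [Eˣ : Eˣ² Fˣ] = 2 Q`, while
`[Fˣ : Fˣ²] = 4 Q`, for the same index `Q = [𝔭 ^ n : 2 𝔭 ^ n]`. -/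
theorem index_range_norm (hd0 : d ≠ 0) :
    (Units.map (QuadraticAlgebra.norm : QuadraticAlgebra F d 0 →* F)).range.index = 2 := by
  have h0 := ord_two_nonneg (F := F)
  have a1 := neg_abs_le (ord d)
  have a2 := abs_nonneg (ord d)
  set N := Units.map (QuadraticAlgebra.norm : QuadraticAlgebra F d 0 →* F)
  have hN : ∀ x, ((N x : Fˣ) : F) = (x : QuadraticAlgebra F d 0).re ^ 2 -
      d * (x : QuadraticAlgebra F d 0).im ^ 2 := fun x => norm_eq_sub _
  set n := ord (2 : F) + 1 + |ord d|
  have h1 := index_squares (F := F) (n := n) (by omega) (by omega)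
  have h2 := index_squares_sup_scalarGroup (d := d) (n := n) (by omega) (by omega)
  have hQ := relIndex_primePowAdd_ne_zero (F := F) (n + ord (2 : F)) n
  -- `N x = f ^ 2` with `f` in the base field forces `(x + f) ^ 2` to be a scalar multiple of `x`
  have h3 : (powMonoidHom 2 : Fˣ →* Fˣ).range.comap N =
      (powMonoidHom 2 : (QuadraticAlgebra F d 0)ˣ →* _).range ⊔ scalarGroup d := by
    refine le_antisymm ?_ (sup_le ?_ ?_)
    · rintro x ⟨f, hf⟩
      have hf' := congrArg Units.val hf
      simp only [powMonoidHom_apply, Units.val_pow_eq_pow_val, hN] at hf'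
      set a := (x : QuadraticAlgebra F d 0).re with ha
      set b := (x : QuadraticAlgebra F d 0).im with hb
      by_cases haf : a + f = 0
      · refine Subgroup.mem_sup_right (mem_scalarGroup.2 ?_)
        have : d * b ^ 2 = 0 := by
          have : (f : F) = -a := by linear_combination haf
          rw [this] at hf'; linear_combination hf'
        simpa [hd0] using this
      · rw [Subgroup.mem_sup]
        refine ⟨(mkUnit d (a + f) b (Or.inl haf)) ^ 2, ⟨_, rfl⟩,
          ((mkUnit d (a + f) b (Or.inl haf)) ^ 2)⁻¹ * x, ?_, by simp⟩
        obtain ⟨c, hc, -, h3⟩ := exists_inv_mul_eq ((mkUnit d (a + f) b (Or.inl haf)) ^ 2) x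
        rw [mem_scalarGroup, h3]
        simp only [pow_two, Units.val_mul, QuadraticAlgebra.re_mul, QuadraticAlgebra.im_mul,
          mkUnit_re, mkUnit_im, ← ha, ← hb]
        linear_combination c * b * hf'
    · rintro _ ⟨s, rfl⟩
      exact ⟨N s, by simp⟩
    · intro x hx
      rw [mem_scalarGroup] at hx
      have hre : (x : QuadraticAlgebra F d 0).re ≠ 0 :=
        fun h => x.ne_zero (QuadraticAlgebra.ext h hx)
      refine ⟨Units.mk0 _ hre, Units.ext ?_⟩
      rw [hN, hx]; simp
  have h4 : (powMonoidHom 2 : Fˣ →* Fˣ).range ≤ N.range := by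
    rintro _ ⟨s, rfl⟩
    refine ⟨mkUnit d s 0 (Or.inl s.ne_zero), Units.ext ?_⟩
    rw [hN]; simp
  have h5 := Subgroup.relIndex_mul_index h4
  rw [← Subgroup.index_comap, h3, h2, h1] at h5
  have : (2 * (primePowAdd F (n + ord (2 : F))).relIndex (primePowAdd F n)) * N.range.index =
      (2 * (primePowAdd F (n + ord (2 : F))).relIndex (primePowAdd F n)) * 2 := by
    rw [h5]; ring
  exact mul_left_cancel₀ (by simpa using hQ) this

end NormGroup

/-! ### The quadratic Hilbert symbol -/

section HilbertSymbol

variable {F : Type*} [Field F]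

/-- `t` is a value of the form `x² - d y²`; for `d` not a square, this says that `t` is a norm from
`F(√d)`. -/
def IsNormForm (d t : F) : Prop := ∃ x y : F, t = x ^ 2 - d * y ^ 2

lemma isNormForm_of_isSquare [CharZero F] {d : F} (hd0 : d ≠ 0) (hd : IsSquare d) (t : F) :
    IsNormForm d t := by
  obtain ⟨r, rfl⟩ := hd
  have hr : r ≠ 0 := fun h => hd0 (by simp [h])
  refine ⟨(t + 1) / 2, (t - 1) / (2 * r), ?_⟩
  have h2 : (2 : F) ≠ 0 := two_ne_zero
  field_simp
  ring

lemma hilbertSymbol_eq_one_iff [CharZero F] {a b : F} (hb : b ≠ 0) :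
    hilbertSymbol a b = 1 ↔ IsNormForm b a := by
  have : hilbertSymbol a b = 1 ↔
      ∃ x y z : F, (x ≠ 0 ∨ y ≠ 0 ∨ z ≠ 0) ∧ a * x ^ 2 + b * y ^ 2 = z ^ 2 := by
    unfold hilbertSymbol
    split_ifs with h
    · simpa using h
    · simp only [h, iff_false]; decide
  rw [this]
  constructor
  · rintro ⟨x, y, z, h0, h⟩
    by_cases hx : x = 0
    · subst hx
      have hy : y ≠ 0 := by
        rintro rfl
        simp only [ne_eq, not_true_eq_false, false_or] at h0
        exact h0 (by simpa using h.symm)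
      refine isNormForm_of_isSquare hb ⟨z / y, ?_⟩ a
      field_simp
      linear_combination h
    · refine ⟨z / x, y / x, ?_⟩
      field_simp
      linear_combination h
  · rintro ⟨x, y, h⟩
    exact ⟨1, y, x, Or.inl one_ne_zero, by rw [h]; ring⟩

lemma hilbertSymbol_comm (a b : F) : hilbertSymbol a b = hilbertSymbol b a := by
  unfold hilbertSymbol
  congr 1
  rw [eq_iff_iff]
  constructor <;> rintro ⟨x, y, z, h0, h⟩ <;> exact ⟨y, x, z, by tauto, by rw [add_comm, h]⟩

end HilbertSymbol

section LocalHilbertSymbol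

variable {F : Type*} [Field F] [ValuativeRel F] [TopologicalSpace F]
  [IsNonarchimedeanLocalField F] [CharZero F]

/-- The values of the norm form `x² - d y²` are a subgroup of index at most two. -/
lemma isNormForm_mul_iff {d s t : F} (hd0 : d ≠ 0) (hs : s ≠ 0) (ht : t ≠ 0) :
    IsNormForm d (s * t) ↔ (IsNormForm d s ↔ IsNormForm d t) := by
  by_cases hd : IsSquare d
  · simp [isNormForm_of_isSquare hd0 hd]
  · have : Fact (∀ r : F, r ^ 2 ≠ d + 0 * r) :=
      ⟨fun r hr => hd ⟨r, by rw [← pow_two, hr]; ring⟩⟩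
    have key : ∀ t : Fˣ, t ∈ (Units.map (QuadraticAlgebra.norm :
        QuadraticAlgebra F d 0 →* F)).range ↔ IsNormForm d (t : F) := by
      intro t
      constructor
      · rintro ⟨z, rfl⟩
        exact ⟨(z : QuadraticAlgebra F d 0).re, (z : QuadraticAlgebra F d 0).im, by
          rw [Units.coe_map]; exact norm_eq_sub _⟩
      · rintro ⟨x, y, h⟩
        have hxy : x ≠ 0 ∨ y ≠ 0 := by
          by_contra! h0
          exact t.ne_zero (by simp [h, h0.1, h0.2])
        refine ⟨mkUnit d x y hxy, Units.ext ?_⟩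
        rw [Units.coe_map, h]
        erw [norm_eq_sub]
        simp
    have := Subgroup.mul_mem_iff_of_index_two (index_range_norm hd0) (a := Units.mk0 s hs)
      (b := Units.mk0 t ht)
    simpa [key] using this

lemma hilbertSymbol_mul_left {a a' b : F} (ha : a ≠ 0) (ha' : a' ≠ 0) (hb : b ≠ 0) :
    hilbertSymbol (a * a') b = hilbertSymbol a b * hilbertSymbol a' b := by
  have h := isNormForm_mul_iff hb ha ha'
  simp only [← hilbertSymbol_eq_one_iff hb] at h
  rcases Int.units_eq_one_or (hilbertSymbol (a * a') b) with h1 | h1 <;>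
  rcases Int.units_eq_one_or (hilbertSymbol a b) with h2 | h2 <;>
  rcases Int.units_eq_one_or (hilbertSymbol a' b) with h3 | h3 <;>
  simp [h1, h2, h3] at h ⊢

lemma hilbertSymbol_mul_right {a b b' : F} (ha : a ≠ 0) (hb : b ≠ 0) (hb' : b' ≠ 0) :
    hilbertSymbol a (b * b') = hilbertSymbol a b * hilbertSymbol a b' := by
  simp only [hilbertSymbol_comm a, hilbertSymbol_mul_left hb hb' ha]

end LocalHilbertSymbol

/-! ### Weil constants and the Hilbert symbol -/

section WeilConstants

variable {F : Type*} [Field F] [ValuativeRel F] [TopologicalSpace F]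
  [IsNonarchimedeanLocalField F] [MeasurableSpace F] [BorelSpace F] [CharZero F]
  {ψ : AddChar F ℂ} {δ : F} (hψ : HasConductor ψ δ)
include hψ

/-- The plane quadratic forms `t (x² - d y²)` and `t s (x² - d y²)` have the same Weil constant, if
`s` is a value of `x² - d y²`. -/
lemma weilConst_mul_of_isNormForm {d s t : F} (hd : d ≠ 0) (hs : s ≠ 0) (ht : t ≠ 0)
    (h : IsNormForm d s) : weilConst ψ δ (t * s) * weilConst ψ δ (-(t * s * d)) =
      weilConst ψ δ t * weilConst ψ δ (-(t * d)) := by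
  have htd : -(t * d) ≠ 0 := neg_ne_zero.2 (mul_ne_zero ht hd)
  obtain ⟨x, y, rfl⟩ := h
  by_cases hy : y = 0
  · subst hy
    have hx : x ≠ 0 := by rintro rfl; simp at hs
    rw [← weilConst_mul_sq hψ ht hx, ← weilConst_mul_sq hψ htd hx]
    congr 2 <;> ring
  by_cases hx : x = 0
  · subst hx
    rw [← weilConst_mul_sq hψ ht (mul_ne_zero hd hy), ← weilConst_mul_sq hψ htd hy, mul_comm]
    congr 2 <;> ring
  have e : t * x ^ 2 + -(t * d) * y ^ 2 = t * (x ^ 2 - d * y ^ 2) := by ring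
  have h1 := weilConst_mul_weilConst hψ (mul_ne_zero ht (pow_ne_zero 2 hx))
    (mul_ne_zero htd (pow_ne_zero 2 hy)) (by rw [e]; exact mul_ne_zero ht hs)
  rw [weilConst_mul_sq hψ ht hx, weilConst_mul_sq hψ htd hy, e] at h1
  rw [h1, ← weilConst_mul_sq hψ (a := -(t * (x ^ 2 - d * y ^ 2) * d)) (b := t * x * y)
    (neg_ne_zero.2 (mul_ne_zero (mul_ne_zero ht hs) hd)) (mul_ne_zero (mul_ne_zero ht hx) hy)]
  congr 2; ring

omit [CharZero F] in
lemma continuous_gaussInt (N : ℤ) : Continuous fun t => gaussInt ψ t N := by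
  refine continuous_iff_continuousAt.2 fun t => ?_
  have : (fun t => gaussInt ψ t N) =ᶠ[nhds t] fun _ => gaussInt ψ t N := by
    rw [Filter.EventuallyEq, Filter.Eventually, mem_nhds_iff_primePow]
    refine ⟨-ord δ + 2 * N, fun y hy => ?_⟩
    refine setIntegral_congr_fun (measurableSet_primePow _) fun x hx => ?_
    have : y * x ^ 2 ∈ primePow F (-ord δ) := by
      refine primePow_anti ?_ (mul_mem_primePow hy (pow_two x ▸ mul_mem_primePow hx hx))
      omega
    simp only [add_mul, hψ.add_eq this]
  exact continuousAt_const.congr this.symm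

open Classical in
/-- For `d` not a square, the Gauss integrals of the forms `t (x² - d y²)`, `t` in `𝔬` but not in
`𝔭 ^ 2`, have mean zero. By orthogonality of characters, both integrals are multiples of volumes of
sets `{x² - d y² ∈ 𝔭 ^ j}` inside a large ball. These sets are related by scaling `x` and `y`, and the
ball does not matter because they are bounded, the form being anisotropic. -/
lemma integral_gaussInt_mul_gaussInt {d : F} (hd0 : d ≠ 0) (hd : ¬ IsSquare d) {N : ℤ}
    (hN : 2 * ord (2 : F) + |ord d| + |ord δ| + 1 ≤ N) :
    ∫ t in primePow F 0, gaussInt ψ t N * gaussInt ψ (-(t * d)) N ∂haarF F =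
      ∫ t in primePow F 2, gaussInt ψ t N * gaussInt ψ (-(t * d)) N ∂haarF F := by
  have hc := hψ.continuous
  have hg := continuous_gaussInt hψ N
  set V : ℤ → ℤ → ℂ := fun N j => ∫ x in primePow F (-N), ∫ y in primePow F (-N),
    (if x ^ 2 - d * y ^ 2 ∈ primePow F j then (1 : ℂ) else 0) ∂haarF F ∂haarF F with hV
  have key : ∀ k : ℤ, ∫ t in primePow F k, gaussInt ψ t N * gaussInt ψ (-(t * d)) N ∂haarF F =
      ((resCard F : ℝ) ^ (-k) : ℝ) * V N (-ord δ - k) := by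
    intro k
    calc ∫ t in primePow F k, gaussInt ψ t N * gaussInt ψ (-(t * d)) N ∂haarF F
        = ∫ t in primePow F k, ∫ x in primePow F (-N),
            ψ (t * x ^ 2) * gaussInt ψ (-(t * d)) N ∂haarF F ∂haarF F := by
          refine setIntegral_congr_fun (measurableSet_primePow _) fun t _ => ?_
          simp only [gaussInt]
          rw [integral_mul_const]
      _ = ∫ x in primePow F (-N), ∫ t in primePow F k,
            ψ (t * x ^ 2) * gaussInt ψ (-(t * d)) N ∂haarF F ∂haarF F := by
          refine setIntegral_swap (f := fun t x => ψ (t * x ^ 2) * gaussInt ψ (-(t * d)) N) ?_ _ _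
          have : Continuous fun p : F × F => gaussInt ψ (-(p.1 * d)) N :=
            hg.comp (by fun_prop)
          simp only [Function.uncurry_def]
          fun_prop
      _ = ∫ x in primePow F (-N), ∫ t in primePow F k, ∫ y in primePow F (-N),
            ψ ((x ^ 2 - d * y ^ 2) * t) ∂haarF F ∂haarF F ∂haarF F := by
          refine setIntegral_congr_fun (measurableSet_primePow _) fun x _ => ?_
          refine setIntegral_congr_fun (measurableSet_primePow _) fun t _ => ?_
          simp only [gaussInt]
          rw [← integral_const_mul]
          refine setIntegral_congr_fun (measurableSet_primePow _) fun y _ => ?_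
          simp only [← AddChar.map_add_eq_mul]
          congr 1; ring
      _ = ∫ x in primePow F (-N), ∫ y in primePow F (-N), ∫ t in primePow F k,
            ψ ((x ^ 2 - d * y ^ 2) * t) ∂haarF F ∂haarF F ∂haarF F := by
          refine setIntegral_congr_fun (measurableSet_primePow _) fun x _ => ?_
          refine setIntegral_swap (f := fun t y => ψ ((x ^ 2 - d * y ^ 2) * t)) ?_ _ _
          simp only [Function.uncurry_def]
          fun_prop
      _ = _ := by
          simp only [hψ.setIntegral, hV]
          rw [← integral_const_mul]
          refine setIntegral_congr_fun (measurableSet_primePow _) fun x _ => ?_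
          rw [← integral_const_mul]
          refine setIntegral_congr_fun (measurableSet_primePow _) fun y _ => ?_
          simp only [mul_ite, mul_one, mul_zero]
  have hq := (resCard_pos F).ne'
  -- scaling by an element of order `-1`
  have hscale : V N (-ord δ - 2) = ((resCard F : ℝ) ^ (2 : ℤ) : ℝ) * V (N - 1) (-ord δ) := by
    obtain ⟨a, ha, hao⟩ := exists_ord_eq F (-1)
    have hna : nabs a = resCard F := by rw [nabs_of_ne ha, hao]; simp
    have e1 : ∀ f : F → ℂ, ∫ x in primePow F (-N), f x ∂haarF F =
        (resCard F : ℂ) * ∫ x in primePow F (-(N - 1)), f (a * x) ∂haarF F := by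
      intro f
      rw [setIntegral_comp_mul ha, hna, hao, show -(N - 1) + -1 = -N by ring, ← mul_assoc]
      have : (resCard F : ℂ) ≠ 0 := by exact_mod_cast hq
      push_cast
      rw [mul_inv_cancel₀ this, one_mul]
    simp only [hV]
    rw [e1, zpow_ofNat]
    simp_rw [e1]
    rw [integral_const_mul, ← mul_assoc, ← pow_two]
    push_cast
    congr 1
    refine setIntegral_congr_fun (measurableSet_primePow _) fun x _ => ?_
    refine setIntegral_congr_fun (measurableSet_primePow _) fun y _ => ?_
    have : (a * x) ^ 2 - d * (a * y) ^ 2 = a * (a * (x ^ 2 - d * y ^ 2)) := by ring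
    simp only [this, mul_mem_primePow_iff ha, hao]
    congr 2
    ring_nf
  -- the set where `x² - d y²` is small already lies in the smaller ball
  have hsupp : V N (-ord δ) = V (N - 1) (-ord δ) := by
    have hN' : 2 * ord (2 : F) + |ord d| + |-ord δ| ≤ N - 1 := by rw [abs_neg]; omega
    have h2 : -N ≤ -(N - 1) := by omega
    simp only [hV]
    rw [← setIntegral_ite_mem_primePow h2]
    refine setIntegral_congr_fun (measurableSet_primePow _) fun x _ => ?_
    rw [← setIntegral_ite_mem_primePow h2]
    split_ifs with hx
    · refine setIntegral_congr_fun (measurableSet_primePow _) fun y _ => ?_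
      by_cases h : x ^ 2 - d * y ^ 2 ∈ primePow F (-ord δ)
      · have := (mem_primePow_of_norm hd0 hd _ hN' h).2
        rw [if_pos h, if_pos this]
      · simp [h]
    · rw [setIntegral_congr_fun (g := fun _ => (0 : ℂ)) (measurableSet_primePow _), integral_zero]
      intro y _
      simp only [ite_eq_right_iff]
      intro h
      exact absurd (mem_primePow_of_norm hd0 hd _ hN' h).1 hx
  rw [key 0, key 2, hscale, sub_zero, hsupp, ← mul_assoc, ← Complex.ofReal_mul,
    ← zpow_add₀ hq]
  norm_num

omit hψ [MeasurableSpace F] [BorelSpace F] in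
lemma exists_ord_eq_one_not_isNormForm {d u : F} (hd0 : d ≠ 0) (hu0 : u ≠ 0)
    (hu : ¬ IsNormForm d u) : ∃ t : F, t ≠ 0 ∧ ord t = 1 ∧ ¬ IsNormForm d t := by
  obtain ⟨π, hπ, hπo⟩ := exists_ord_eq F 1
  by_cases h : IsNormForm d π
  · refine ⟨u * π ^ (1 - ord u), mul_ne_zero hu0 (zpow_ne_zero _ hπ), ?_, ?_⟩
    · rw [ord_mul hu0 (zpow_ne_zero _ hπ), ord_zpow, hπo]; ring
    · rw [isNormForm_mul_iff hd0 hu0 (zpow_ne_zero _ hπ)]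
      have : ∀ n : ℤ, IsNormForm d (π ^ n) := by
        have h1 : IsNormForm d 1 := ⟨1, 0, by simp⟩
        intro n
        induction n using Int.induction_on with
        | zero => simpa using h1
        | succ n ih =>
          rw [zpow_add_one₀ hπ, isNormForm_mul_iff hd0 (zpow_ne_zero _ hπ) hπ]; tauto
        | pred n ih =>
          have e : π ^ (-(n : ℤ)) = π ^ (-(n : ℤ) - 1) * π := by
            rw [← zpow_add_one₀ hπ]; ring_nf
          rw [e, isNormForm_mul_iff hd0 (zpow_ne_zero _ hπ) hπ] at ih; tauto
      tauto
  · exact ⟨π, hπ, hπo, h⟩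

lemma gaussInt_mul_gaussInt_eq {d t : F} (hd : d ≠ 0) (ht : t ≠ 0) {N : ℤ}
    (h1 : IsStable δ t N) (h2 : IsStable δ (-(t * d)) N) :
    gaussInt ψ t N * gaussInt ψ (-(t * d)) N =
      ((nabs (2 : F) * nabs δ * Real.sqrt (nabs d))⁻¹ : ℝ) * ((nabs t)⁻¹ : ℝ) *
        (weilConst ψ δ t * weilConst ψ δ (-(t * d))) := by
  have htd := neg_ne_zero.2 (mul_ne_zero ht hd)
  rw [h1.gaussInt_eq hψ ht, h2.gaussInt_eq hψ htd, weilConst_eq hψ ht, weilConst_eq hψ htd]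
  have e : Real.sqrt (nabs (2 * -(t * d))) =
      Real.sqrt (nabs (2 * t)) * Real.sqrt (nabs d) := by
    rw [← Real.sqrt_mul (nabs_nonneg _)]; congr 1; simp [mul_assoc]
  have s1 := sqrt_nabs_mul_self (2 * t)
  have s2 := sqrt_nabs_mul_self δ
  have n1 : (nabs (2 : F) : ℂ) ≠ 0 := by exact_mod_cast nabs_ne_zero two_ne_zero
  have n2 : (nabs δ : ℂ) ≠ 0 := by exact_mod_cast nabs_ne_zero hψ.ne_zero
  have n3 : (nabs t : ℂ) ≠ 0 := by exact_mod_cast nabs_ne_zero ht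
  have n4 : (Real.sqrt (nabs d) : ℂ) ≠ 0 := by
    exact_mod_cast (Real.sqrt_pos.2 (nabs_pos hd)).ne'
  rw [e]
  rw [nabs_mul] at s1 ⊢
  push_cast at s1 ⊢
  field_simp
  linear_combination (- gaussVal ψ δ t * gaussVal ψ δ (-(t * d)) * (Real.sqrt (nabs δ)) ^ 2) * s1
    - gaussVal ψ δ t * gaussVal ψ δ (-(t * d)) * (nabs (2 : F) * nabs t) * s2

/-- The Weil constant `h t` of the form `t (x² - d y²)` takes opposite values on norms and non-norms
`t`. For a non-norm `r` of order one, the sum `h t + h (r t)` is constant, and the Gauss integrals of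
the forms with `ord t = 0` and `ord t = 1` together have mean zero. -/
lemma weilConst_mul_of_not_isNormForm {d u : F} (hd0 : d ≠ 0) (hu0 : u ≠ 0)
    (hu : ¬ IsNormForm d u) : weilConst ψ δ u * weilConst ψ δ (-(u * d)) =
      -(weilConst ψ δ 1 * weilConst ψ δ (-d)) := by
  have hd : ¬ IsSquare d := fun h => hu (isNormForm_of_isSquare hd0 h u)
  obtain ⟨r, hr, hro, hrn⟩ := exists_ord_eq_one_not_isNormForm hd0 hu0 hu
  set h : F → ℂ := fun t => weilConst ψ δ t * weilConst ψ δ (-(t * d)) with hh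
  have hinv : ∀ s t : F, s ≠ 0 → t ≠ 0 → (IsNormForm d s ↔ IsNormForm d t) → h s = h t := by
    intro s t hs ht hst
    have h1 : IsNormForm d (s / t) := by
      have := isNormForm_mul_iff hd0 (div_ne_zero hs ht) ht
      rw [div_mul_cancel₀ _ ht] at this
      tauto
    have := weilConst_mul_of_isNormForm hψ hd0 (div_ne_zero hs ht) ht h1
    rwa [mul_div_cancel₀ _ ht] at this
  have hone : IsNormForm d 1 := ⟨1, 0, by simp⟩
  have hsum : ∀ t : F, t ≠ 0 → h t + h (r * t) = h 1 + h r := by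
    intro t ht
    have hrt := isNormForm_mul_iff hd0 hr ht
    by_cases htn : IsNormForm d t
    · rw [hinv t 1 ht one_ne_zero (by tauto), hinv (r * t) r (mul_ne_zero hr ht) hr (by tauto)]
    · rw [hinv t r ht hr (by tauto), hinv (r * t) 1 (mul_ne_zero hr ht) one_ne_zero (by tauto),
        add_comm]
  suffices h1r : h 1 + h r = 0 by
    have hur : h u = h r := hinv u r hu0 hr (by tauto)
    have : h u = - h 1 := by rw [hur]; linear_combination h1r
    simpa [hh] using this
  have a0 := ord_two_nonneg (F := F)
  set N := 2 * ord (2 : F) + |ord d| + |ord δ| + 2 with hN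
  have hst : ∀ t : F, t ≠ 0 → 0 ≤ ord t → ord t ≤ 1 → IsStable δ t N ∧ IsStable δ (-(t * d)) N := by
    intro t ht h0 h1
    have := le_abs_self (ord δ)
    have := le_abs_self (ord d)
    have := abs_nonneg (ord δ)
    have := abs_nonneg (ord d)
    constructor <;> constructor <;>
      simp only [ord_mul two_ne_zero ht, ord_neg, ord_mul ht hd0,
        ord_mul two_ne_zero (neg_ne_zero.2 (mul_ne_zero ht hd0))] <;> omega
  set G : F → ℂ := fun t => gaussInt ψ t N * gaussInt ψ (-(t * d)) N with hG
  have hg := continuous_gaussInt hψ N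
  have hGc : Continuous G := hg.mul (hg.comp (by fun_prop))
  have hzero := integral_gaussInt_mul_gaussInt hψ hd0 hd (N := N) (by omega)
  have hnr : nabs r ≠ 0 := nabs_ne_zero hr
  have e0 := setIntegral_comp_mul hr 0 G
  have e1 := setIntegral_comp_mul hr 1 G
  rw [hro] at e0 e1
  set κ : ℂ := (((nabs (2 : F) * nabs δ * Real.sqrt (nabs d))⁻¹ : ℝ) : ℂ) with hκ
  have hκ0 : κ ≠ 0 := by
    rw [hκ]
    exact_mod_cast inv_ne_zero (mul_ne_zero (mul_ne_zero (nabs_ne_zero two_ne_zero)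
      (nabs_ne_zero hψ.ne_zero)) (Real.sqrt_pos.2 (nabs_pos hd0)).ne')
  -- by the substitution `r t`, this is the integral of `G` over `𝔬` without `𝔭 ^ 2`
  have hshell : ∫ t in primePow F 0 \ primePow F 1, (G t + (nabs r : ℂ) * G (r * t)) ∂haarF F =
      0 := by
    have hint : ∀ n, IntegrableOn (fun t => G t + (nabs r : ℂ) * G (r * t)) (primePow F n)
        (haarF F) := fun n => integrableOn_primePow (by fun_prop) n
    have hi1 : ∀ n, IntegrableOn G (primePow F n) (haarF F) :=
      fun n => integrableOn_primePow hGc n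
    have hi2 : ∀ n, IntegrableOn (fun t => (nabs r : ℂ) * G (r * t)) (primePow F n) (haarF F) :=
      fun n => integrableOn_primePow (by fun_prop) n
    rw [setIntegral_sdiff (measurableSet_primePow 1) (hint 0) (primePow_anti (by norm_num)),
      integral_add (hi1 0) (hi2 0), integral_add (hi1 1) (hi2 1), integral_const_mul,
      integral_const_mul, e0, e1]
    have hnr' : (nabs r : ℂ) ≠ 0 := by exact_mod_cast hnr
    push_cast
    rw [mul_inv_cancel_left₀ hnr', mul_inv_cancel_left₀ hnr']
    simp only [hG]
    rw [hzero]
    ring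
  -- on the unit shell the integrand is constant
  have hconst : ∫ t in primePow F 0 \ primePow F 1, (G t + (nabs r : ℂ) * G (r * t)) ∂haarF F =
      ((haarF F).real (primePow F 0 \ primePow F 1) : ℂ) * (κ * (h 1 + h r)) := by
    rw [setIntegral_congr_fun (g := fun _ => κ * (h 1 + h r))
      ((measurableSet_primePow 0).diff (measurableSet_primePow 1)), setIntegral_const,
      Complex.real_smul]
    rintro t ⟨ht0, ht1⟩
    have ht : t ≠ 0 := by rintro rfl; simp at ht1
    rw [mem_primePow_of_ne ht] at ht0 ht1
    have hto : ord t = 0 := by omega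
    have hrt := mul_ne_zero hr ht
    have hrto : ord (r * t) = 1 := by rw [ord_mul hr ht]; omega
    obtain ⟨s1, s2⟩ := hst t ht (by omega) (by omega)
    obtain ⟨s3, s4⟩ := hst (r * t) hrt (by omega) (by omega)
    simp only [hG]
    rw [gaussInt_mul_gaussInt_eq hψ hd0 ht s1 s2, gaussInt_mul_gaussInt_eq hψ hd0 hrt s3 s4,
      ← hsum t ht]
    have n1 : nabs t = 1 := by rw [nabs_of_ne ht, hto]; simp
    rw [nabs_mul, n1]
    have hnr' : (nabs r : ℂ) ≠ 0 := by exact_mod_cast hnr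
    simp only [hh, ← hκ]
    push_cast
    field_simp
  rw [hshell] at hconst
  have hvol : ((haarF F).real (primePow F 0 \ primePow F 1) : ℂ) ≠ 0 := by
    have hfin : (haarF F) (primePow F 0) ≠ ⊤ := by rw [haarF_primePow]; simp
    rw [measureReal_sdiff (primePow_anti (m := 0) (by norm_num)) (measurableSet_primePow 1) hfin,
      measureReal_primePow, measureReal_primePow]
    have : (resCard F : ℝ)⁻¹ < 1 :=
      inv_lt_one_of_one_lt₀ (by exact_mod_cast one_lt_resCard F)
    have : (1 : ℝ) - (resCard F : ℝ)⁻¹ ≠ 0 := by linarith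
    simp only [neg_zero, zpow_zero, zpow_neg, zpow_one]
    exact_mod_cast this
  rcases mul_eq_zero.1 hconst.symm with h0 | h0
  · exact absurd h0 hvol
  · exact (mul_eq_zero.1 h0).resolve_left hκ0

/-- Weil's formula `α(a) α(b) = ⟨a, b⟩ α(1) α(ab)`. -/
theorem weilConst_mul {a b : F} (ha : a ≠ 0) (hb : b ≠ 0) :
    weilConst ψ δ a * weilConst ψ δ b =
      ((hilbertSymbol a b : ℤ) : ℂ) * (weilConst ψ δ 1 * weilConst ψ δ (a * b)) := by
  have hab := mul_ne_zero ha hb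
  have w1 := weilConst_ne_zero hψ hb
  have w2 := weilConst_ne_zero hψ hab
  have n1 := weilConst_neg hψ hb
  have n2 := weilConst_neg hψ hab
  rcases Int.units_eq_one_or (hilbertSymbol a b) with h | h
  · have h1 := weilConst_mul_of_isNormForm hψ hb ha one_ne_zero
      ((hilbertSymbol_eq_one_iff hb).1 h)
    rw [one_mul, one_mul, n1, n2] at h1
    rw [h]
    field_simp at h1
    simp
    linear_combination h1
  · have h1 := weilConst_mul_of_not_isNormForm hψ hb ha
      (fun h' => by rw [(hilbertSymbol_eq_one_iff hb).2 h'] at h; exact absurd h (by decide))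
    rw [n1, n2] at h1
    rw [h]
    field_simp at h1
    simp
    linear_combination h1

end WeilConstants

/-! ### Relations between the operators of the Weil representation -/

section HilbertSymbolSquares

variable {F : Type*} [Field F]

lemma hilbertSymbol_mul_sq_left (a b : F) {r : F} (hr : r ≠ 0) :
    hilbertSymbol (a * r ^ 2) b = hilbertSymbol a b := by
  unfold hilbertSymbol
  congr 1
  rw [eq_iff_iff]
  constructor
  · rintro ⟨x, y, z, h0, h⟩
    refine ⟨r * x, y, z, ?_, by rw [← h]; ring⟩
    simpa [hr] using h0
  · rintro ⟨x, y, z, h0, h⟩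
    refine ⟨x / r, y, z, ?_, by rw [← h]; field_simp⟩
    simpa [hr] using h0

lemma hilbertSymbol_mul_sq_right (a b : F) {r : F} (hr : r ≠ 0) :
    hilbertSymbol a (b * r ^ 2) = hilbertSymbol a b := by
  rw [hilbertSymbol_comm, hilbertSymbol_mul_sq_left _ _ hr, hilbertSymbol_comm]

lemma hilbertSymbol_inv_left (a b : F) : hilbertSymbol a⁻¹ b = hilbertSymbol a b := by
  by_cases ha : a = 0
  · simp [ha]
  · rw [← hilbertSymbol_mul_sq_left a⁻¹ b ha]
    congr 1; field_simp

lemma hilbertSymbol_inv_right (a b : F) : hilbertSymbol a b⁻¹ = hilbertSymbol a b := by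
  rw [hilbertSymbol_comm, hilbertSymbol_inv_left, hilbertSymbol_comm]

/-- The sign `⟨a, b⟩` as a complex number. -/
noncomputable def hilbertC (a b : F) : ℂ := ((hilbertSymbol a b : ℤ) : ℂ)

lemma hilbertC_mul_self (a b : F) : hilbertC a b * hilbertC a b = 1 := by
  unfold hilbertC
  rcases Int.units_eq_one_or (hilbertSymbol a b) with h | h <;> simp [h]

end HilbertSymbolSquares

section Relations

variable {F : Type*} [Field F] [ValuativeRel F] [TopologicalSpace F]
  [IsNonarchimedeanLocalField F] [MeasurableSpace F] [BorelSpace F]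
  {ψ : AddChar F ℂ} {δ : F}

omit [ValuativeRel F] [TopologicalSpace F] [IsNonarchimedeanLocalField F] [MeasurableSpace F]
  [BorelSpace F] in
lemma weilU_weilU (b b' : F) (φ : F → ℂ) : weilU ψ b (weilU ψ b' φ) = weilU ψ (b + b') φ := by
  ext t
  simp only [weilU, ← mul_assoc, ← AddChar.map_add_eq_mul, add_mul]

omit [ValuativeRel F] [TopologicalSpace F] [IsNonarchimedeanLocalField F] [MeasurableSpace F]
  [BorelSpace F] in
lemma weilU_zero (φ : F → ℂ) : weilU ψ 0 φ = φ := by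
  ext t; simp [weilU]

lemma weilM_weilU (a b : F) (φ : F → ℂ) :
    weilM ψ δ a (weilU ψ b φ) = weilU ψ (a ^ 2 * b) (weilM ψ δ a φ) := by
  ext t
  simp only [weilM, weilU]
  rw [show b * (a * t) ^ 2 = a ^ 2 * b * t ^ 2 by ring]
  ring

omit [ValuativeRel F] [TopologicalSpace F] [IsNonarchimedeanLocalField F] [MeasurableSpace F]
  [BorelSpace F] in
lemma weilU_smul (b : F) (z : ℂ) (φ : F → ℂ) : weilU ψ b (z • φ) = z • weilU ψ b φ := by
  ext t; simp only [weilU, Pi.smul_apply, smul_eq_mul]; ring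

lemma weilM_smul (a : F) (z : ℂ) (φ : F → ℂ) : weilM ψ δ a (z • φ) = z • weilM ψ δ a φ := by
  ext t; simp only [weilM, Pi.smul_apply, smul_eq_mul]; ring

lemma weilW_smul (a : F) (z : ℂ) (φ : F → ℂ) : weilW ψ δ a (z • φ) = z • weilW ψ δ a φ := by
  ext t
  have : fourierT ψ δ (z • φ) = fun x => z * fourierT ψ δ φ x := fourierT_smul z φ
  simp only [weilW, this, Pi.smul_apply, smul_eq_mul]; ring

omit [MeasurableSpace F] [BorelSpace F] in
lemma IsSchwartz.weilU (hψ : HasConductor ψ δ) {φ : F → ℂ} (h : IsSchwartz φ) (b : F) :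
    IsSchwartz (weilU ψ b φ) := h.psi_sq_mul hψ b

lemma IsSchwartz.weilM {φ : F → ℂ} (h : IsSchwartz φ) {a : F} (ha : a ≠ 0) :
    IsSchwartz (weilM ψ δ a φ) := (h.comp_mul ha).const_mul _

variable [CharZero F] (hψ : HasConductor ψ δ)
include hψ

lemma IsSchwartz.weilW {φ : F → ℂ} (h : IsSchwartz φ) {a : F} (ha : a ≠ 0) :
    IsSchwartz (weilW ψ δ a φ) :=
  ((h.isSchwartz_fourierT hψ).comp_mul
    (mul_ne_zero (neg_ne_zero.2 two_ne_zero) (inv_ne_zero ha))).const_mul _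

/-- A form of Weil's formula adapted to the normalizing factors `α(1) / α(a)`. -/
lemma weilConst_one_div_mul {a b : F} (ha : a ≠ 0) (hb : b ≠ 0) :
    weilConst ψ δ 1 / (weilConst ψ δ a * weilConst ψ δ b) =
      hilbertC a b / weilConst ψ δ (a * b) := by
  have h := weilConst_mul hψ ha hb
  rw [← hilbertC] at h
  have h1 := weilConst_ne_zero hψ one_ne_zero
  have h2 := weilConst_ne_zero hψ (mul_ne_zero ha hb)
  have h3 := hilbertC_mul_self a b
  have h4 : hilbertC a b ≠ 0 := left_ne_zero_of_mul_eq_one h3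
  rw [h]
  field_simp
  linear_combination -h3

lemma weilConst_inv {a : F} (ha : a ≠ 0) : weilConst ψ δ a⁻¹ = weilConst ψ δ a := by
  rw [← weilConst_mul_sq hψ (inv_ne_zero ha) ha]; congr 1; field_simp

lemma weilM_weilM {a b : F} (ha : a ≠ 0) (hb : b ≠ 0) (φ : F → ℂ) :
    weilM ψ δ a (weilM ψ δ b φ) = hilbertC a b • weilM ψ δ (a * b) φ := by
  have h := weilConst_one_div_mul hψ ha hb
  have h1 := weilConst_ne_zero hψ ha
  have h2 := weilConst_ne_zero hψ hb
  have h3 := weilConst_ne_zero hψ (mul_ne_zero ha hb)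
  ext t
  simp only [weilM, Pi.smul_apply, smul_eq_mul, nabs_mul, Real.sqrt_mul (nabs_nonneg a)]
  push_cast
  rw [show b * (a * t) = a * b * t by ring]
  calc _ = weilConst ψ δ 1 * (weilConst ψ δ 1 / (weilConst ψ δ a * weilConst ψ δ b)) *
        (Real.sqrt (nabs a) * Real.sqrt (nabs b)) * φ (a * b * t) := by field_simp
    _ = _ := by rw [h]; ring

lemma weilM_one (φ : F → ℂ) : weilM ψ δ 1 φ = φ := by
  ext t
  simp [weilM, weilConst_ne_zero hψ (one_ne_zero (α := F))]

lemma weilM_weilW {b c : F} (hb : b ≠ 0) (hc : c ≠ 0) (φ : F → ℂ) :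
    weilM ψ δ b (weilW ψ δ c φ) = hilbertC b c • weilW ψ δ (c / b) φ := by
  have h := weilConst_one_div_mul hψ hb hc
  have h1 := weilConst_ne_zero hψ hb
  have h2 := weilConst_ne_zero hψ hc
  have hcb : c / b ≠ 0 := div_ne_zero hc hb
  have e : weilConst ψ δ (b * c) = weilConst ψ δ (c / b) := by
    rw [← weilConst_mul_sq hψ hcb hb]; congr 1; field_simp
  have e2 : (2 : F) * (c / b)⁻¹ = b * (2 * c⁻¹) := by field_simp
  ext t
  simp only [weilM, weilW, Pi.smul_apply, smul_eq_mul, conj_weilConst hψ hc,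
    conj_weilConst hψ hcb, e2]
  rw [nabs_mul b, Real.sqrt_mul (nabs_nonneg b), ← e] at *
  push_cast
  rw [show -2 * (c / b)⁻¹ * t = -2 * c⁻¹ * (b * t) by field_simp]
  calc _ = (weilConst ψ δ 1 / (weilConst ψ δ b * weilConst ψ δ c)) *
        (Real.sqrt (nabs b) * Real.sqrt (nabs (2 * c⁻¹))) *
          fourierT ψ δ φ (-2 * c⁻¹ * (b * t)) := by field_simp
    _ = _ := by rw [h]; ring

lemma weilW_weilM {b c : F} (hb : b ≠ 0) (hc : c ≠ 0) (φ : F → ℂ) :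
    weilW ψ δ c (weilM ψ δ b φ) = hilbertC b c • weilW ψ δ (c * b) φ := by
  have h := weilConst_one_div_mul hψ hb hc
  have h1 := weilConst_ne_zero hψ hb
  have h2 := weilConst_ne_zero hψ hc
  have hcb : c * b ≠ 0 := mul_ne_zero hc hb
  have e2 : (2 : F) * (c * b)⁻¹ = b⁻¹ * (2 * c⁻¹) := by field_simp
  have hF : fourierT ψ δ (weilM ψ δ b φ) = fun x => weilConst ψ δ 1 / weilConst ψ δ b *
      (Real.sqrt (nabs b) : ℂ) * (((nabs b)⁻¹ : ℝ) * fourierT ψ δ φ (x / b)) := by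
    have : weilM ψ δ b φ = fun t => (weilConst ψ δ 1 / weilConst ψ δ b *
      (Real.sqrt (nabs b) : ℂ)) * (fun y => φ (b * y)) t := rfl
    rw [this, fourierT_smul]
    ext x
    rw [fourierT_comp_mul hb]
  ext t
  simp only [weilW, hF, Pi.smul_apply, smul_eq_mul, conj_weilConst hψ hc,
    conj_weilConst hψ hcb, e2]
  rw [nabs_mul b⁻¹, nabs_inv, Real.sqrt_mul (inv_nonneg.2 (nabs_nonneg b)), Real.sqrt_inv]
  have hs := sqrt_nabs_mul_self b
  have hsb : (Real.sqrt (nabs b) : ℂ) ≠ 0 := by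
    exact_mod_cast (Real.sqrt_pos.2 (nabs_pos hb)).ne'
  push_cast
  rw [show -2 * (c * b)⁻¹ * t = -2 * c⁻¹ * t / b by field_simp, ← hs]
  calc _ = (weilConst ψ δ 1 / (weilConst ψ δ b * weilConst ψ δ c)) *
        ((Real.sqrt (nabs b) : ℂ)⁻¹ * Real.sqrt (nabs (2 * c⁻¹))) *
          fourierT ψ δ φ (-2 * c⁻¹ * t / b) := by field_simp
    _ = _ := by rw [h, mul_comm b c]; ring

lemma weilW_weilW {a b : F} (ha : a ≠ 0) (hb : b ≠ 0) {φ : F → ℂ} (hφ : IsSchwartz φ) :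
    weilW ψ δ a (weilW ψ δ b φ) = hilbertC (-a) (-b) • weilM ψ δ (-(b / a)) φ := by
  have h := weilConst_one_div_mul hψ (neg_ne_zero.2 ha) (neg_ne_zero.2 hb)
  rw [neg_mul_neg] at h
  have h1 := weilConst_ne_zero hψ ha
  have h2 := weilConst_ne_zero hψ hb
  have h4 := weilConst_ne_zero hψ (one_ne_zero (α := F))
  have hba : -(b / a) ≠ 0 := neg_ne_zero.2 (div_ne_zero hb ha)
  have e : weilConst ψ δ (-(b / a)) = (weilConst ψ δ (a * b))⁻¹ := by
    rw [← weilConst_neg hψ (mul_ne_zero ha hb), ← weilConst_mul_sq hψ hba ha]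
    congr 1; field_simp
  have hk : -2 * b⁻¹ ≠ 0 := mul_ne_zero (neg_ne_zero.2 two_ne_zero) (inv_ne_zero hb)
  have hF : fourierT ψ δ (weilW ψ δ b φ) = fun x => (weilConst ψ δ b)⁻¹ *
      (Real.sqrt (nabs (2 * b⁻¹)) : ℂ) * (((nabs (2 * b⁻¹))⁻¹ : ℝ) * φ (x * (b / 2))) := by
    have : weilW ψ δ b φ = fun t => (conj (weilConst ψ δ b) *
      (Real.sqrt (nabs (2 * b⁻¹)) : ℂ)) * (fun y => fourierT ψ δ φ (-2 * b⁻¹ * y)) t := rfl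
    rw [this, fourierT_smul]
    ext x
    rw [fourierT_comp_mul hk, hφ.fourierT_fourierT hψ, conj_weilConst hψ hb]
    rw [show nabs (-2 * b⁻¹) = nabs (2 * b⁻¹) by simp,
      show -(x / (-2 * b⁻¹)) = x * (b / 2) by field_simp]
  ext t
  simp only [weilW, hF, weilM, Pi.smul_apply, smul_eq_mul, conj_weilConst hψ ha, e]
  rw [weilConst_neg hψ ha, weilConst_neg hψ hb] at h
  have e1 : nabs (-(b / a)) * nabs (2 * b⁻¹) = nabs (2 * a⁻¹) := by
    rw [← nabs_mul, show -(b / a) * (2 * b⁻¹) = -(2 * a⁻¹) by field_simp, nabs_neg]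
  rw [← e1, Real.sqrt_mul (nabs_nonneg _)]
  have hs := sqrt_nabs_mul_self (2 * b⁻¹)
  have hsb : (Real.sqrt (nabs (2 * b⁻¹)) : ℂ) ≠ 0 := by
    exact_mod_cast (Real.sqrt_pos.2 (nabs_pos (mul_ne_zero two_ne_zero (inv_ne_zero hb)))).ne'
  push_cast
  rw [show -2 * a⁻¹ * t * (b / 2) = -(b / a) * t by field_simp, ← hs]
  generalize (Real.sqrt (nabs (2 * b⁻¹)) : ℂ) = σ at *
  generalize φ (-(b / a) * t) = z
  have h5 : (weilConst ψ δ a)⁻¹ * (weilConst ψ δ b)⁻¹ =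
      hilbertC (-a) (-b) * (weilConst ψ δ 1 / (weilConst ψ δ (a * b))⁻¹) := by
    have h3 := hilbertC_mul_self (-a) (-b)
    have h6 := weilConst_ne_zero hψ (mul_ne_zero ha hb)
    have h7 : hilbertC (-a) (-b) ≠ 0 := left_ne_zero_of_mul_eq_one h3
    field_simp at h
    field_simp
    linear_combination (-hilbertC (-a) (-b)) * h - h3
  calc _ = ((weilConst ψ δ a)⁻¹ * (weilConst ψ δ b)⁻¹) *
        Real.sqrt (nabs (-(b / a))) * z := by field_simp
    _ = _ := by rw [h5]; ring

/-- The Bruhat relation in the big cell, which is the defining identity of the Weil constant. -/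
lemma weilW_weilU_weilW {b c c' : F} (hb : b ≠ 0) (hc : c ≠ 0) (hc' : c' ≠ 0) {φ : F → ℂ}
    (hφ : IsSchwartz φ) : weilW ψ δ c (weilU ψ b (weilW ψ δ c' φ)) =
      hilbertC (c' * b) (c * b) • weilU ψ (-(1 / (c ^ 2 * b)))
        (weilW ψ δ (c * c' * b) (weilU ψ (-(1 / (c' ^ 2 * b))) φ)) := by
  set c'' := c * c' * b with hc''
  have hc''0 : c'' ≠ 0 := mul_ne_zero (mul_ne_zero hc hc') hb
  set a := -(1 / (c' ^ 2 * b)) with ha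
  have ha0 : a ≠ 0 := by
    rw [ha]; exact neg_ne_zero.2 (one_div_ne_zero (mul_ne_zero (pow_ne_zero 2 hc') hb))
  have h2 : (2 : F) ≠ 0 := two_ne_zero
  ext t
  set s := t * c' / c with hs
  set J : ℂ := ∫ y, ψ (b * y ^ 2 + (-2 * c⁻¹ * t) * y) * fourierT ψ δ φ (-2 * c'⁻¹ * y) ∂haarF F
    with hJ
  have hL : weilW ψ δ c (weilU ψ b (weilW ψ δ c' φ)) t =
      (weilConst ψ δ c)⁻¹ * (weilConst ψ δ c')⁻¹ * Real.sqrt (nabs (2 * c⁻¹)) *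
        Real.sqrt (nabs (2 * c'⁻¹)) * Real.sqrt (nabs δ) * J := by
    simp only [weilW, fourierT, weilU, conj_weilConst hψ hc, conj_weilConst hψ hc', hJ]
    rw [← mul_assoc, ← integral_const_mul, ← integral_const_mul]
    congr 1; ext y
    rw [AddChar.map_add_eq_mul]; ring
  -- complete the square on the right-hand side
  have hR : weilU ψ (-(1 / (c ^ 2 * b))) (weilW ψ δ c'' (weilU ψ a φ)) t =
      (weilConst ψ δ c'')⁻¹ * Real.sqrt (nabs (2 * c''⁻¹)) * Real.sqrt (nabs δ) *
        ∫ y, φ (y + -s) * ψ (a * y ^ 2) ∂haarF F := by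
    simp only [weilW, fourierT, weilU, conj_weilConst hψ hc''0]
    rw [← integral_add_right_eq_self (fun y => φ (y + -s) * ψ (a * y ^ 2)) s,
      ← mul_assoc, ← mul_assoc, ← integral_const_mul, ← integral_const_mul]
    congr 1; ext y
    have : ψ (a * (y + s) ^ 2) = ψ (-(1 / (c ^ 2 * b)) * t ^ 2) * ψ (a * y ^ 2) *
        ψ (-2 * c''⁻¹ * t * y) := by
      rw [← AddChar.map_add_eq_mul, ← AddChar.map_add_eq_mul]
      congr 1
      simp only [ha, hs, hc'']
      field_simp
      ring
    rw [this, add_neg_cancel_right]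
    ring
  have hJ' : ∫ y, φ (y + -s) * ψ (a * y ^ 2) ∂haarF F =
      weilConst ψ δ a * ((Real.sqrt (nabs (2 * a)))⁻¹ : ℝ) * (nabs (2 * c'⁻¹) * J) := by
    rw [(hφ.comp_add (-s)).integral_mul_psi hψ ha0]
    congr 1
    have hF : ∀ x, fourierT ψ δ (fun y => φ (y + -s)) x = ψ (x * s) * fourierT ψ δ φ x := by
      intro x
      simp only [fourierT]
      rw [← integral_add_right_eq_self (fun y => φ (y + -s) * ψ (x * y)) s, mul_left_comm]
      congr 1
      rw [← integral_const_mul]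
      congr 1; ext y
      rw [add_neg_cancel_right, mul_add, AddChar.map_add_eq_mul]; ring
    simp only [hF]
    have hk : -2 * c'⁻¹ ≠ 0 := mul_ne_zero (neg_ne_zero.2 two_ne_zero) (inv_ne_zero hc')
    have hsub := integral_comp_mul hk
      (fun x => ψ (x * s) * fourierT ψ δ φ x * ψ (-(x ^ 2 / (4 * a))))
    rw [show nabs (-2 * c'⁻¹) = nabs (2 * c'⁻¹) by simp, Complex.real_smul] at hsub
    have hn : (nabs (2 * c'⁻¹) : ℂ) ≠ 0 := by
      exact_mod_cast nabs_ne_zero (mul_ne_zero two_ne_zero (inv_ne_zero hc'))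
    have : J = ∫ y, ψ (-2 * c'⁻¹ * y * s) * fourierT ψ δ φ (-2 * c'⁻¹ * y) *
        ψ (-((-2 * c'⁻¹ * y) ^ 2 / (4 * a))) ∂haarF F := by
      rw [hJ]
      congr 1; ext y
      have : ψ (b * y ^ 2 + (-2 * c⁻¹ * t) * y) = ψ (-2 * c'⁻¹ * y * s) *
          ψ (-((-2 * c'⁻¹ * y) ^ 2 / (4 * a))) := by
        rw [← AddChar.map_add_eq_mul]
        congr 1
        have h4 : (4 : F) ≠ 0 := by norm_num
        simp only [ha, hs]
        field_simp
        ring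
      rw [this]; ring
    rw [this, hsub]
    push_cast
    rw [mul_inv_cancel_left₀ hn]
  rw [hL, Pi.smul_apply, hR, hJ', smul_eq_mul]
  -- comparison of the absolute values and of the Weil constants
  have wa : weilConst ψ δ a = (weilConst ψ δ b)⁻¹ := by
    have hbi : b⁻¹ ≠ 0 := inv_ne_zero hb
    rw [← weilConst_inv hψ hb, ← weilConst_neg hψ hbi,
      ← weilConst_mul_sq hψ (neg_ne_zero.2 hbi) (inv_ne_zero hc')]
    congr 1; rw [ha]; field_simp
  have habs : Real.sqrt (nabs (2 * c⁻¹)) * Real.sqrt (nabs (2 * c'⁻¹)) =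
      Real.sqrt (nabs (2 * c''⁻¹)) * (Real.sqrt (nabs (2 * a)))⁻¹ * nabs (2 * c'⁻¹) := by
    have n1 := nabs_pos h2
    have n2 := nabs_pos hc
    have n3 := nabs_pos hc'
    have n4 := nabs_pos hb
    rw [← Real.sqrt_inv, ← Real.sqrt_mul (nabs_nonneg _), ← Real.sqrt_mul (nabs_nonneg _)]
    conv_rhs => rw [← Real.sqrt_sq (nabs_nonneg (2 * c'⁻¹))]
    rw [← Real.sqrt_mul (mul_nonneg (nabs_nonneg _) (inv_nonneg.2 (nabs_nonneg _)))]
    congr 1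
    simp only [hc'', ha, nabs_mul, nabs_inv, nabs_neg, nabs_div, nabs_pow, nabs_one]
    field_simp
  have hconst : (weilConst ψ δ c)⁻¹ * (weilConst ψ δ c')⁻¹ =
      hilbertC (c' * b) (c * b) * ((weilConst ψ δ c'')⁻¹ * (weilConst ψ δ b)⁻¹) := by
    have hcc' := mul_ne_zero hc hc'
    have h3 := weilConst_mul hψ hc hc'
    have h4 := weilConst_mul hψ hc''0 hb
    have h5 : weilConst ψ δ (c'' * b) = weilConst ψ δ (c * c') := by
      rw [← weilConst_mul_sq hψ hcc' hb]; congr 1; rw [hc'']; ring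
    have h6 : hilbertSymbol (c' * b) (c * b) = hilbertSymbol c c' * hilbertSymbol c'' b := by
      rw [hc'', hilbertSymbol_mul_left hc' hb (mul_ne_zero hc hb),
        hilbertSymbol_mul_right hc' hc hb, hilbertSymbol_mul_right hb hc hb,
        hilbertSymbol_mul_left hcc' hb hb, hilbertSymbol_mul_left hc hc' hb,
        hilbertSymbol_comm c' c, hilbertSymbol_comm b c]
      ac_rfl
    have h7 : hilbertC (c' * b) (c * b) = hilbertC c c' * hilbertC c'' b := by
      simp only [hilbertC, h6]; push_cast; rfl
    rw [← hilbertC] at h3 h4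
    have h8 := hilbertC_mul_self c c'
    have n1 := weilConst_ne_zero hψ hcc'
    have n2 := weilConst_ne_zero hψ (one_ne_zero (α := F))
    have n3 : hilbertC c c' ≠ 0 := left_ne_zero_of_mul_eq_one h8
    have n4 : hilbertC c'' b ≠ 0 := left_ne_zero_of_mul_eq_one (hilbertC_mul_self c'' b)
    rw [← mul_inv, ← mul_inv, h3, h4, h5, h7]
    field_simp
    linear_combination -h8
  have habs' : (Real.sqrt (nabs (2 * c⁻¹)) : ℂ) * Real.sqrt (nabs (2 * c'⁻¹)) =
      Real.sqrt (nabs (2 * c''⁻¹)) * ((Real.sqrt (nabs (2 * a)))⁻¹ : ℝ) * nabs (2 * c'⁻¹) := by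
    exact_mod_cast habs
  calc _ = ((weilConst ψ δ c)⁻¹ * (weilConst ψ δ c')⁻¹) *
        ((Real.sqrt (nabs (2 * c⁻¹)) : ℂ) * Real.sqrt (nabs (2 * c'⁻¹))) *
        Real.sqrt (nabs δ) * J := by ring
    _ = _ := by rw [hconst, habs', wa]; ring

end Relations

/-! ### Kubota's cocycle and the Weil representation -/

section Entries

variable {F : Type*} [Field F]

lemma sl_det (g : SL(2, F)) : g.1 0 0 * g.1 1 1 - g.1 0 1 * g.1 1 0 = 1 := by
  rw [← Matrix.det_fin_two]; exact g.2

lemma sl_mul_apply (g h : SL(2, F)) (i j : Fin 2) :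
    (g * h).1 i j = g.1 i 0 * h.1 0 j + g.1 i 1 * h.1 1 j := by
  change (g.1 * h.1) i j = _
  rw [Matrix.mul_apply, Fin.sum_univ_two]

lemma tau_of_ne {g : SL(2, F)} (h : g.1 1 0 ≠ 0) : tau g = g.1 1 0 := if_pos h

lemma tau_of_eq {g : SL(2, F)} (h : g.1 1 0 = 0) : tau g = g.1 1 1 := if_neg (by simpa using h)

@[simp] lemma Mp.mul_g (x y : Mp F) : (x * y).g = x.g * y.g := rfl

@[simp] lemma Mp.mul_ζ (x y : Mp F) : (x * y).ζ = x.ζ * y.ζ * kubota x.g y.g := rfl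

@[simp] lemma Mp.inv_g (x : Mp F) : x⁻¹.g = x.g⁻¹ := rfl

@[simp] lemma bracket_g (g : SL(2, F)) : (bracket g).g = g := rfl

@[simp] lemma bracket_ζ (g : SL(2, F)) : (bracket g).ζ = 1 := rfl

@[simp] lemma mem_tilde {S : Set SL(2, F)} {x : Mp F} : x ∈ tilde S ↔ x.g ∈ S := Iff.rfl

lemma sign_sq (ζ : ℤˣ) : ((ζ : ℤ) : ℂ) * ((ζ : ℤ) : ℂ) = 1 := by
  rcases Int.units_eq_one_or ζ with h | h <;> simp [h]

end Entries

section Representation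

variable {F : Type*} [Field F] [ValuativeRel F] [TopologicalSpace F]
  [IsNonarchimedeanLocalField F] [MeasurableSpace F] [BorelSpace F]
  {ψ : AddChar F ℂ} {δ : F}

lemma weil_eq_smul (x : Mp F) (φ : F → ℂ) :
    weil ψ δ x φ = ((x.ζ : ℤ) : ℂ) • weil ψ δ (bracket x.g) φ := by
  by_cases h : x.g.1 1 0 = 0 <;> simp [weil, h]

lemma weil_bracket_of_ne {g : SL(2, F)} (h : g.1 1 0 ≠ 0) (φ : F → ℂ) :
    weil ψ δ (bracket g) φ = weilU ψ (g.1 0 0 / g.1 1 0)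
      (weilW ψ δ (g.1 1 0) (weilU ψ (g.1 1 1 / g.1 1 0) φ)) := by
  simp [weil, h]

lemma weil_bracket_of_eq {g : SL(2, F)} (h : g.1 1 0 = 0) (φ : F → ℂ) :
    weil ψ δ (bracket g) φ = weilU ψ (g.1 0 0 * g.1 0 1) (weilM ψ δ (g.1 0 0) φ) := by
  simp [weil, h]

lemma weil_bracket_smul (g : SL(2, F)) (z : ℂ) (φ : F → ℂ) :
    weil ψ δ (bracket g) (z • φ) = z • weil ψ δ (bracket g) φ := by
  by_cases h : g.1 1 0 = 0
  · simp only [weil_bracket_of_eq h, weilM_smul, weilU_smul]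
  · simp only [weil_bracket_of_ne h, weilW_smul, weilU_smul]

lemma weil_smul (x : Mp F) (z : ℂ) (φ : F → ℂ) :
    weil ψ δ x (z • φ) = z • weil ψ δ x φ := by
  rw [weil_eq_smul, weil_eq_smul x φ, weil_bracket_smul, smul_comm]

variable [CharZero F] (hψ : HasConductor ψ δ)
include hψ

lemma IsSchwartz.weil {φ : F → ℂ} (hφ : IsSchwartz φ) (x : Mp F) :
    IsSchwartz (weil ψ δ x φ) := by
  rw [weil_eq_smul]
  refine IsSchwartz.smul ?_ _
  by_cases h : x.g.1 1 0 = 0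
  · rw [weil_bracket_of_eq h]
    refine IsSchwartz.weilU hψ (hφ.weilM ?_) _
    intro h0
    have := sl_det x.g
    simp [h, h0] at this
  · rw [weil_bracket_of_ne h]
    exact IsSchwartz.weilU hψ ((hφ.weilU hψ _).weilW hψ h) _

/-- The cocycle of the operators `ω_ψ([g])` is Kubota's cocycle. In every case of the Bruhat
decomposition the product of the normalizing factors is evaluated by Weil's formula. -/
theorem weil_bracket_mul (g h : SL(2, F)) {φ : F → ℂ} (hφ : IsSchwartz φ) :
    weil ψ δ (bracket g) (weil ψ δ (bracket h) φ) =
      ((kubota g h : ℤ) : ℂ) • weil ψ δ (bracket (g * h)) φ := by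
  have hg := sl_det g
  have hh := sl_det h
  have e00 := sl_mul_apply g h 0 0
  have e01 := sl_mul_apply g h 0 1
  have e10 := sl_mul_apply g h 1 0
  have e11 := sl_mul_apply g h 1 1
  by_cases hc : g.1 1 0 = 0 <;> by_cases hc' : h.1 1 0 = 0
  · -- both upper triangular
    have ha : g.1 0 0 ≠ 0 := fun h0 => by simp [hc, h0] at hg
    have ha' : h.1 0 0 ≠ 0 := fun h0 => by simp [hc', h0] at hh
    have hc'' : (g * h).1 1 0 = 0 := by rw [e10, hc, hc']; ring
    simp only [hc, hc', mul_zero, sub_zero, zero_mul, add_zero, zero_add] at hg hh e00 e01 e10 e11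
    have hd : g.1 1 1 = (g.1 0 0)⁻¹ := eq_inv_of_mul_eq_one_right hg
    have hd' : h.1 1 1 = (h.1 0 0)⁻¹ := eq_inv_of_mul_eq_one_right hh
    have hk : ((kubota g h : ℤ) : ℂ) = hilbertC (g.1 0 0) (h.1 0 0) := by
      rw [kubota, tau_of_eq hc, tau_of_eq hc', tau_of_eq hc'', e11, hd, hd',
        show (g.1 0 0)⁻¹ / ((g.1 0 0)⁻¹ * (h.1 0 0)⁻¹) = h.1 0 0 by field_simp,
        show (h.1 0 0)⁻¹ / ((g.1 0 0)⁻¹ * (h.1 0 0)⁻¹) = g.1 0 0 by field_simp,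
        hilbertSymbol_comm, hilbertC]
    rw [weil_bracket_of_eq hc, weil_bracket_of_eq hc', weil_bracket_of_eq hc'', hk, weilM_weilU,
      weilU_weilU, weilM_weilM hψ ha ha', weilU_smul, e00, e01, hd']
    congr 2
    field_simp
    ring
  · -- only the first upper triangular
    have ha : g.1 0 0 ≠ 0 := fun h0 => by simp [hc, h0] at hg
    simp only [hc, mul_zero, sub_zero, zero_mul, zero_add] at hg hh e00 e01 e10 e11
    have hd : g.1 1 1 = (g.1 0 0)⁻¹ := eq_inv_of_mul_eq_one_right hg
    have hd0 : g.1 1 1 ≠ 0 := by rw [hd]; exact inv_ne_zero ha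
    have hc'' : (g * h).1 1 0 ≠ 0 := by rw [e10]; exact mul_ne_zero hd0 hc'
    have hk : ((kubota g h : ℤ) : ℂ) = hilbertC (g.1 0 0) (h.1 1 0) := by
      rw [kubota, tau_of_eq hc, tau_of_ne hc', tau_of_ne hc'', e10,
        show g.1 1 1 / (g.1 1 1 * h.1 1 0) = (h.1 1 0)⁻¹ by field_simp,
        show h.1 1 0 / (g.1 1 1 * h.1 1 0) = (g.1 1 1)⁻¹ by field_simp, hd, inv_inv,
        hilbertSymbol_inv_left, hilbertSymbol_comm, hilbertC]
    rw [weil_bracket_of_eq hc, weil_bracket_of_ne hc', weil_bracket_of_ne hc'', hk, weilM_weilU,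
      weilU_weilU, weilM_weilW hψ ha hc', weilU_smul, e00, e10, e11, hd]
    congr 2
    · field_simp; ring
    · congr 2
      · field_simp
      · field_simp
  · -- only the second upper triangular
    have ha' : h.1 0 0 ≠ 0 := fun h0 => by simp [hc', h0] at hh
    simp only [hc', mul_zero, sub_zero, add_zero] at hg hh e00 e01 e10 e11
    have hd' : h.1 1 1 = (h.1 0 0)⁻¹ := eq_inv_of_mul_eq_one_right hh
    have hc'' : (g * h).1 1 0 ≠ 0 := by rw [e10]; exact mul_ne_zero hc ha'
    have hk : ((kubota g h : ℤ) : ℂ) = hilbertC (h.1 0 0) (g.1 1 0) := by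
      rw [kubota, tau_of_ne hc, tau_of_eq hc', tau_of_ne hc'', e10, hd',
        show g.1 1 0 / (g.1 1 0 * h.1 0 0) = (h.1 0 0)⁻¹ by field_simp,
        show (h.1 0 0)⁻¹ / (g.1 1 0 * h.1 0 0) = (g.1 1 0 * (h.1 0 0) ^ 2)⁻¹ by field_simp,
        hilbertSymbol_inv_left, hilbertSymbol_inv_right, hilbertSymbol_mul_sq_right _ _ ha',
        hilbertC]
    have hUM : ∀ b : F, weilU ψ b (weilM ψ δ (h.1 0 0) φ) =
        weilM ψ δ (h.1 0 0) (weilU ψ (b / (h.1 0 0) ^ 2) φ) := by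
      intro b
      rw [weilM_weilU, mul_div_cancel₀ _ (pow_ne_zero 2 ha')]
    rw [weil_bracket_of_ne hc, weil_bracket_of_eq hc', weil_bracket_of_ne hc'', hk, weilU_weilU,
      hUM, weilW_weilM hψ ha' hc, weilU_smul, e00, e10, e11, hd']
    congr 2
    · field_simp
    · congr 2
      field_simp
      ring
  · -- both in the big cell; the product is upper triangular if and only if `β = 0`
    set β := g.1 1 1 / g.1 1 0 + h.1 0 0 / h.1 1 0 with hβ
    have hc''β : (g * h).1 1 0 = g.1 1 0 * h.1 1 0 * β := by
      rw [e10, hβ]; field_simp; ring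
    rw [weil_bracket_of_ne hc, weil_bracket_of_ne hc', weilU_weilU, ← hβ]
    by_cases hβ0 : β = 0
    · have hc'' : (g * h).1 1 0 = 0 := by rw [hc''β, hβ0, mul_zero]
      have e00' : (g * h).1 0 0 = -(h.1 1 0 / g.1 1 0) := by
        rw [e10] at hc''
        rw [e00]; field_simp
        linear_combination (-h.1 1 0) * hg + g.1 0 0 * hc''
      have e11' : (g * h).1 1 1 = -(g.1 1 0 / h.1 1 0) := by
        rw [e10] at hc''
        rw [e11]; field_simp
        linear_combination (-g.1 1 0) * hh + h.1 1 1 * hc''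
      have hk : ((kubota g h : ℤ) : ℂ) = hilbertC (-(g.1 1 0)) (-(h.1 1 0)) := by
        rw [kubota, tau_of_ne hc, tau_of_ne hc', tau_of_eq hc'', e11',
          show g.1 1 0 / -(g.1 1 0 / h.1 1 0) = -(h.1 1 0) by field_simp,
          show h.1 1 0 / -(g.1 1 0 / h.1 1 0) = -(g.1 1 0) * (h.1 1 0 / g.1 1 0) ^ 2 by field_simp,
          hilbertSymbol_mul_sq_right _ _ (div_ne_zero hc' hc), hilbertSymbol_comm, hilbertC]
      rw [weil_bracket_of_eq hc'', hβ0, weilU_zero, weilW_weilW hψ hc hc' (hφ.weilU hψ _),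
        weilM_weilU, weilU_smul, weilU_weilU, hk, e00']
      congr 2
      rw [e01]
      rw [e10] at hc''
      field_simp
      linear_combination (-g.1 0 0 * g.1 1 0) * hh + g.1 0 0 * h.1 1 1 * hc'' -
        h.1 1 0 * h.1 1 1 * hg
    · have hc'' : (g * h).1 1 0 ≠ 0 := by
        rw [hc''β]; exact mul_ne_zero (mul_ne_zero hc hc') hβ0
      have hk : ((kubota g h : ℤ) : ℂ) = hilbertC (h.1 1 0 * β) (g.1 1 0 * β) := by
        rw [kubota, tau_of_ne hc, tau_of_ne hc', tau_of_ne hc'', hc''β,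
          show g.1 1 0 / (g.1 1 0 * h.1 1 0 * β) = (h.1 1 0 * β)⁻¹ by field_simp,
          show h.1 1 0 / (g.1 1 0 * h.1 1 0 * β) = (g.1 1 0 * β)⁻¹ by field_simp,
          hilbertSymbol_inv_left, hilbertSymbol_inv_right, hilbertC]
      rw [weil_bracket_of_ne hc'', weilW_weilU_weilW hψ hβ0 hc hc' (hφ.weilU hψ _), weilU_smul,
        weilU_weilU, weilU_weilU, hk, ← hc''β]
      have hβ' : β = (g * h).1 1 0 / (g.1 1 0 * h.1 1 0) := by
        rw [hc''β]; field_simp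
      congr 2
      · rw [hβ']
        field_simp
        rw [e10, e00]
        linear_combination h.1 1 0 * hg
      · congr 2
        rw [hβ']
        field_simp
        rw [e10, e11]
        linear_combination g.1 1 0 * hh

/-- The Weil representation is a homomorphism on Schwartz functions. -/
theorem weil_mul (x y : Mp F) {φ : F → ℂ} (hφ : IsSchwartz φ) :
    weil ψ δ (x * y) φ = weil ψ δ x (weil ψ δ y φ) := by
  rw [weil_eq_smul, weil_eq_smul x, weil_eq_smul y, weil_bracket_smul, weil_bracket_mul hψ _ _ hφ,
    smul_smul, smul_smul]
  simp

lemma weil_bracket_one (φ : F → ℂ) : weil ψ δ (bracket 1) φ = φ := by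
  rw [weil_bracket_of_eq (by simp)]
  simp [weilM_one hψ, weilU_zero]

omit [CharZero F] in
lemma innerF_weilU (b : F) (φ φ' : F → ℂ) :
    innerF (weilU ψ b φ) (weilU ψ b φ') = innerF φ φ' := by
  simp only [innerF, weilU, map_mul]
  congr 1; ext t
  have : ψ (b * t ^ 2) * conj (ψ (b * t ^ 2)) = 1 := by
    rw [Complex.mul_conj, Complex.normSq_eq_norm_sq, hψ.norm_eq_one]; simp
  linear_combination φ t * conj (φ' t) * this

lemma innerF_weilM {a : F} (ha : a ≠ 0) (φ φ' : F → ℂ) :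
    innerF (weilM ψ δ a φ) (weilM ψ δ a φ') = innerF φ φ' := by
  have h := integral_comp_mul ha (fun t => φ t * conj (φ' t))
  have h1 := weilConst_mul_conj hψ ha
  have h2 := weilConst_mul_conj hψ (one_ne_zero (α := F))
  have h3 := sqrt_nabs_mul_self a
  have h4 : (nabs a : ℂ) ≠ 0 := by exact_mod_cast nabs_ne_zero ha
  have h5 := weilConst_ne_zero hψ ha
  have h6 : conj (weilConst ψ δ a) ≠ 0 := by simpa using h5
  rw [Complex.real_smul] at h
  have : innerF φ φ' = (nabs a : ℂ) * ∫ t, φ (a * t) * conj (φ' (a * t)) ∂haarF F := by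
    rw [h]; push_cast; rw [mul_inv_cancel_left₀ h4]; rfl
  rw [this, ← integral_const_mul]
  simp only [innerF, weilM, map_mul, map_div₀, Complex.conj_ofReal]
  congr 1; ext t
  have : weilConst ψ δ 1 / weilConst ψ δ a * (conj (weilConst ψ δ 1) / conj (weilConst ψ δ a)) =
      1 := by rw [div_mul_div_comm, h1, h2, div_one]
  calc _ = (weilConst ψ δ 1 / weilConst ψ δ a * (conj (weilConst ψ δ 1) / conj (weilConst ψ δ a)))
        * ((Real.sqrt (nabs a) : ℂ) * Real.sqrt (nabs a)) * (φ (a * t) * conj (φ' (a * t))) := by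
        ring
    _ = _ := by rw [this, h3]; ring

lemma innerF_weilW {a : F} (ha : a ≠ 0) {φ φ' : F → ℂ} (h : IsSchwartz φ) (h' : IsSchwartz φ') :
    innerF (weilW ψ δ a φ) (weilW ψ δ a φ') = innerF φ φ' := by
  rw [← innerF_fourierT hψ h h']
  have hk : -2 * a⁻¹ ≠ 0 := mul_ne_zero (neg_ne_zero.2 two_ne_zero) (inv_ne_zero ha)
  have h0 := integral_comp_mul hk (fun t => fourierT ψ δ φ t * conj (fourierT ψ δ φ' t))
  have h1 := weilConst_mul_conj hψ ha
  have h3 := sqrt_nabs_mul_self (2 * a⁻¹)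
  have h4 : (nabs (2 * a⁻¹) : ℂ) ≠ 0 := by
    exact_mod_cast nabs_ne_zero (mul_ne_zero two_ne_zero (inv_ne_zero ha))
  rw [Complex.real_smul, show nabs (-2 * a⁻¹) = nabs (2 * a⁻¹) by simp] at h0
  have : innerF (fourierT ψ δ φ) (fourierT ψ δ φ') = (nabs (2 * a⁻¹) : ℂ) *
      ∫ t, fourierT ψ δ φ (-2 * a⁻¹ * t) * conj (fourierT ψ δ φ' (-2 * a⁻¹ * t)) ∂haarF F := by
    rw [h0]; push_cast; rw [mul_inv_cancel_left₀ (by simpa using h4)]; rfl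
  rw [this, ← integral_const_mul]
  simp only [innerF, weilW, map_mul, Complex.conj_ofReal, Complex.conj_conj]
  congr 1; ext t
  rw [← h3]
  linear_combination (((Real.sqrt (nabs (2 * a⁻¹)) : ℂ) * Real.sqrt (nabs (2 * a⁻¹))) *
    fourierT ψ δ φ (-2 * a⁻¹ * t) * conj (fourierT ψ δ φ' (-2 * a⁻¹ * t))) * h1

/-- The Weil representation is unitary. -/
theorem innerF_weil (x : Mp F) {φ φ' : F → ℂ} (h : IsSchwartz φ) (h' : IsSchwartz φ') :
    innerF (weil ψ δ x φ) (weil ψ δ x φ') = innerF φ φ' := by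
  rw [weil_eq_smul, weil_eq_smul x φ', innerF_smul_left, innerF_smul_right, ← mul_assoc]
  have : ((x.ζ : ℤ) : ℂ) * conj ((x.ζ : ℤ) : ℂ) = 1 := by
    rw [map_intCast (starRingEnd ℂ)]; exact sign_sq _
  rw [this, one_mul]
  by_cases hc : x.g.1 1 0 = 0
  · have ha : x.g.1 0 0 ≠ 0 := fun h0 => by
      have := sl_det x.g
      simp [hc, h0] at this
    rw [weil_bracket_of_eq hc, weil_bracket_of_eq hc, innerF_weilU hψ, innerF_weilM hψ ha]
  · rw [weil_bracket_of_ne hc, weil_bracket_of_ne hc, innerF_weilU hψ,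
      innerF_weilW hψ hc (h.weilU hψ _) (h'.weilU hψ _), innerF_weilU hψ]

end Representation

/-! ### The congruence subgroups -/

section Inverse

variable {F : Type*} [Field F]

@[simp] lemma sl_inv_00 (g : SL(2, F)) : g⁻¹.1 0 0 = g.1 1 1 := by
  simp [Matrix.adjugate_fin_two]
@[simp] lemma sl_inv_01 (g : SL(2, F)) : g⁻¹.1 0 1 = -g.1 0 1 := by
  simp [Matrix.adjugate_fin_two]
@[simp] lemma sl_inv_10 (g : SL(2, F)) : g⁻¹.1 1 0 = -g.1 1 0 := by
  simp [Matrix.adjugate_fin_two]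
@[simp] lemma sl_inv_11 (g : SL(2, F)) : g⁻¹.1 1 1 = g.1 0 0 := by
  simp [Matrix.adjugate_fin_two]

end Inverse

section Codifferent

variable {F : Type*} [Field F] [ValuativeRel F] [TopologicalSpace F]
  [IsNonarchimedeanLocalField F] (p : ℕ) [Fact p.Prime] [Algebra ℚ_[p] F]

/-- The different determines its inverse, because the inverse different is an `𝔬`-module. -/
lemma codifferent_eq {c : ℤ} (hc : different F p = primePow F c) :
    codifferent F p = primePow F (-c) := by
  have hmul : ∀ x ∈ codifferent F p, ∀ y ∈ primePow F 0, x * y ∈ codifferent F p := by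
    intro x hx y hy z hz
    rw [mul_assoc]
    refine hx _ (mem_integers_iff.2 ?_)
    simpa using mul_mem_primePow hy (mem_integers_iff.1 hz)
  have hsub : codifferent F p ⊆ primePow F (-c) := by
    intro y hy
    obtain ⟨z, hz, hzo⟩ := exists_ord_eq F c
    have hzd : z ∈ different F p := by rw [hc]; exact Or.inr hzo.ge
    have := mem_integers_iff.1 (hzd y hy)
    rw [mul_mem_primePow_iff hz] at this
    simpa [hzo] using this
  refine hsub.antisymm fun x hx => ?_
  -- otherwise the inverse different is contained in a smaller lattice, and the different is larger
  have hex : ∃ y ∈ codifferent F p, y ≠ 0 ∧ ord y = -c := by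
    by_contra! h
    obtain ⟨z, hz, hzo⟩ := exists_ord_eq F (c - 1)
    have hzd : z ∈ different F p := by
      intro y hy
      rw [mem_integers_iff, mul_mem_primePow_iff hz, hzo]
      by_cases hy0 : y = 0
      · simp [hy0]
      · have h1 := (mem_primePow_of_ne hy0).1 (hsub hy)
        have h2 := h y hy hy0
        rw [mem_primePow_of_ne hy0]
        omega
    rw [hc, mem_primePow_of_ne hz] at hzd
    omega
  obtain ⟨y, hy, hy0, hyo⟩ := hex
  have : x = y * (y⁻¹ * x) := by field_simp
  rw [this]
  refine hmul y hy _ ?_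
  rw [mul_mem_primePow_iff (inv_ne_zero hy0)]
  simpa [hyo] using hx

end Codifferent

section LatticeGroup

variable {F : Type*} [Field F] [ValuativeRel F] [TopologicalSpace F]
  [IsNonarchimedeanLocalField F]

lemma mul_mem_of_eq {m n k : ℤ} {x y : F} (hx : x ∈ primePow F m) (hy : y ∈ primePow F n)
    (h : k ≤ m + n) : x * y ∈ primePow F k := primePow_anti h (mul_mem_primePow hx hy)

/-- The group of matrices with `a, d ∈ 𝔬`, `b ∈ 𝔭 ^ (-D)` and `c ∈ 𝔭 ^ (D + k)`. -/
def latticeGroup (D : ℤ) (k : ℕ) : Subgroup SL(2, F) where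
  carrier := {g | g.1 0 0 ∈ primePow F 0 ∧ g.1 1 1 ∈ primePow F 0 ∧ g.1 0 1 ∈ primePow F (-D) ∧
    g.1 1 0 ∈ primePow F (D + k)}
  mul_mem' := by
    rintro g h ⟨h1, h2, h3, h4⟩ ⟨h1', h2', h3', h4'⟩
    refine ⟨?_, ?_, ?_, ?_⟩ <;> rw [sl_mul_apply] <;> apply add_mem_primePow
    · exact mul_mem_of_eq h1 h1' (by omega)
    · exact mul_mem_of_eq h3 h4' (by omega)
    · exact mul_mem_of_eq h4 h3' (by omega)
    · exact mul_mem_of_eq h2 h2' (by omega)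
    · exact mul_mem_of_eq h1 h3' (by omega)
    · exact mul_mem_of_eq h3 h2' (by omega)
    · exact mul_mem_of_eq h4 h1' (by omega)
    · exact mul_mem_of_eq h2 h4' (by omega)
  one_mem' := by simp [one_mem_primePow_zero]
  inv_mem' := by
    rintro g ⟨h1, h2, h3, h4⟩
    simp [h1, h2, h3, h4]

lemma mem_latticeGroup {D : ℤ} {k : ℕ} {g : SL(2, F)} : g ∈ latticeGroup D k ↔
    g.1 0 0 ∈ primePow F 0 ∧ g.1 1 1 ∈ primePow F 0 ∧ g.1 0 1 ∈ primePow F (-D) ∧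
    g.1 1 0 ∈ primePow F (D + k) := Iff.rfl

/-- The group of matrices with `a, d ∈ 1 + 𝔭 ^ k`, `b ∈ 𝔭 ^ (-D)` and `c ∈ 𝔭 ^ (D + k)`. -/
def principalGroup (D : ℤ) (k : ℕ) : Subgroup SL(2, F) where
  carrier := {g | g.1 0 0 - 1 ∈ primePow F k ∧ g.1 1 1 - 1 ∈ primePow F k ∧
    g.1 0 1 ∈ primePow F (-D) ∧ g.1 1 0 ∈ primePow F (D + k)}
  mul_mem' := by
    have hone : ∀ x : F, x - 1 ∈ primePow F k → x ∈ primePow F 0 := fun x hx => by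
      simpa using add_mem_primePow (primePow_anti (by omega) hx) one_mem_primePow_zero
    rintro g h ⟨h1, h2, h3, h4⟩ ⟨h1', h2', h3', h4'⟩
    refine ⟨?_, ?_, ?_, ?_⟩ <;> rw [sl_mul_apply]
    · rw [show g.1 0 0 * h.1 0 0 + g.1 0 1 * h.1 1 0 - 1 =
        ((g.1 0 0 - 1) * h.1 0 0 + (h.1 0 0 - 1)) + g.1 0 1 * h.1 1 0 by ring]
      exact add_mem_primePow (add_mem_primePow (mul_mem_of_eq h1 (hone _ h1') (by omega)) h1')
        (mul_mem_of_eq h3 h4' (by omega))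
    · rw [show g.1 1 0 * h.1 0 1 + g.1 1 1 * h.1 1 1 - 1 =
        ((g.1 1 1 - 1) * h.1 1 1 + (h.1 1 1 - 1)) + g.1 1 0 * h.1 0 1 by ring]
      exact add_mem_primePow (add_mem_primePow (mul_mem_of_eq h2 (hone _ h2') (by omega)) h2')
        (mul_mem_of_eq h4 h3' (by omega))
    · exact add_mem_primePow (mul_mem_of_eq (hone _ h1) h3' (by omega))
        (mul_mem_of_eq h3 (hone _ h2') (by omega))
    · exact add_mem_primePow (mul_mem_of_eq h4 (hone _ h1') (by omega))
        (mul_mem_of_eq (hone _ h2) h4' (by omega))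
  one_mem' := by simp
  inv_mem' := by
    rintro g ⟨h1, h2, h3, h4⟩
    simp [h1, h2, h3, h4]

lemma mem_principalGroup {D : ℤ} {k : ℕ} {g : SL(2, F)} : g ∈ principalGroup D k ↔
    g.1 0 0 - 1 ∈ primePow F k ∧ g.1 1 1 - 1 ∈ primePow F k ∧
    g.1 0 1 ∈ primePow F (-D) ∧ g.1 1 0 ∈ primePow F (D + k) := Iff.rfl

lemma principalGroup_le (D : ℤ) {k j : ℕ} (h : j ≤ k) :
    (principalGroup D k : Subgroup SL(2, F)) ≤ latticeGroup D j := by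
  have hone : ∀ x : F, x - 1 ∈ primePow F k → x ∈ primePow F 0 := fun x hx => by
    simpa using add_mem_primePow (primePow_anti (by omega) hx) one_mem_primePow_zero
  rintro g ⟨h1, h2, h3, h4⟩
  exact ⟨hone _ h1, hone _ h2, h3, primePow_anti (by omega) h4⟩

lemma latticeGroup_anti (D : ℤ) {k j : ℕ} (h : j ≤ k) :
    (latticeGroup D k : Subgroup SL(2, F)) ≤ latticeGroup D j := by
  rintro g ⟨h1, h2, h3, h4⟩
  exact ⟨h1, h2, h3, primePow_anti (by omega) h4⟩

variable (p : ℕ) [Fact p.Prime] [Algebra ℚ_[p] F]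

lemma Lam_eq {c : ℤ} (hc : different F p = primePow F c) :
    Lam F p = (latticeGroup c 0 : Subgroup SL(2, F)) := by
  ext g
  rw [Lam, congrGroup, codifferent_eq p hc, hc]
  simp only [mem_integers_iff, Set.mem_ofPred_eq, SetLike.mem_coe, mem_latticeGroup]
  simp

lemma Gam_eq [CharZero F] {c : ℤ} (hc : different F p = primePow F c) :
    Gam F p = (latticeGroup c (2 * (ord (2 : F)).toNat) : Subgroup SL(2, F)) := by
  have h4 : (4 : F) ≠ 0 := by norm_num
  have ho : ord (4 : F) = 2 * ord (2 : F) := by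
    rw [show (4 : F) = 2 * 2 by norm_num, ord_mul two_ne_zero two_ne_zero]; ring
  have himg : (fun x => 4 * x) '' primePow F c = primePow F (c + 2 * ord (2 : F)) := by
    ext x
    constructor
    · rintro ⟨y, hy, rfl⟩
      simpa only [mul_mem_primePow_iff h4, ho, add_sub_cancel_right] using hy
    · intro hx
      refine ⟨4⁻¹ * x, ?_, by field_simp⟩
      rw [mul_mem_primePow_iff (inv_ne_zero h4)]
      simpa [ho] using hx
  have h0 := ord_two_nonneg (F := F)
  ext g
  rw [Gam, congrGroup, codifferent_eq p hc, hc, himg]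
  simp only [mem_integers_iff, Set.mem_ofPred_eq, SetLike.mem_coe, mem_latticeGroup]
  rw [show ((2 * (ord (2 : F)).toNat : ℕ) : ℤ) = 2 * ord (2 : F) by omega]

end LatticeGroup

/-! ### The vector `φ₀` and the action of the congruence subgroups -/

section Matrices

variable {F : Type*} [Field F]

/-- The matrix `(1, x; 0, 1)`. -/
def upperUni (x : F) : SL(2, F) := ⟨!![1, x; 0, 1], by simp [Matrix.det_fin_two_of]⟩

/-- The matrix `(1, 0; x, 1)`. -/
def lowerUni (x : F) : SL(2, F) := ⟨!![1, 0; x, 1], by simp [Matrix.det_fin_two_of]⟩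

/-- The matrix `(0, -a⁻¹; a, 0)`. -/
def weylMat (a : F) (ha : a ≠ 0) : SL(2, F) :=
  ⟨!![0, -a⁻¹; a, 0], by simp [Matrix.det_fin_two_of, ha]⟩

@[simp] lemma upperUni_00 (x : F) : (upperUni x).1 0 0 = 1 := rfl
@[simp] lemma upperUni_01 (x : F) : (upperUni x).1 0 1 = x := rfl
@[simp] lemma upperUni_10 (x : F) : (upperUni x).1 1 0 = 0 := rfl
@[simp] lemma upperUni_11 (x : F) : (upperUni x).1 1 1 = 1 := rfl

@[simp] lemma lowerUni_00 (x : F) : (lowerUni x).1 0 0 = 1 := rfl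
@[simp] lemma lowerUni_01 (x : F) : (lowerUni x).1 0 1 = 0 := rfl
@[simp] lemma lowerUni_10 (x : F) : (lowerUni x).1 1 0 = x := rfl
@[simp] lemma lowerUni_11 (x : F) : (lowerUni x).1 1 1 = 1 := rfl

@[simp] lemma weylMat_00 (a : F) (ha : a ≠ 0) : (weylMat a ha).1 0 0 = 0 := rfl
@[simp] lemma weylMat_01 (a : F) (ha : a ≠ 0) : (weylMat a ha).1 0 1 = -a⁻¹ := rfl
@[simp] lemma weylMat_10 (a : F) (ha : a ≠ 0) : (weylMat a ha).1 1 0 = a := rfl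
@[simp] lemma weylMat_11 (a : F) (ha : a ≠ 0) : (weylMat a ha).1 1 1 = 0 := rfl

lemma sl_ext {g h : SL(2, F)} (h00 : g.1 0 0 = h.1 0 0) (h01 : g.1 0 1 = h.1 0 1)
    (h10 : g.1 1 0 = h.1 1 0) (h11 : g.1 1 1 = h.1 1 1) : g = h := by
  refine Subtype.ext (Matrix.ext fun i j => ?_)
  fin_cases i <;> fin_cases j <;> assumption

lemma lowerUni_eq {a : F} (ha : a ≠ 0) (x : F) :
    lowerUni x = (weylMat a ha)⁻¹ * upperUni (-(x / a ^ 2)) * weylMat a ha := by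
  apply sl_ext <;> simp [sl_mul_apply, ha]
  field_simp

end Matrices

section Phi0

variable {F : Type*} [Field F] [ValuativeRel F] [TopologicalSpace F]
  [IsNonarchimedeanLocalField F]

lemma phi0_eq : phi0 F = (primePow F 0).indicator fun _ => (1 : ℂ) := by
  have : {x : F | x ∈ 𝒪[F]} = primePow F 0 := Set.ext fun x => mem_integers_iff
  rw [phi0, this]; rfl

lemma phi0_of_mem {t : F} (h : t ∈ primePow F 0) : phi0 F t = 1 := by
  rw [phi0_eq, Set.indicator_of_mem h]

lemma phi0_of_notMem {t : F} (h : t ∉ primePow F 0) : phi0 F t = 0 := by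
  rw [phi0_eq, Set.indicator_of_notMem h]

@[simp] lemma phi0_zero : phi0 F 0 = 1 := phi0_of_mem (zero_mem_primePow 0)

variable [MeasurableSpace F] [BorelSpace F]

omit [MeasurableSpace F] [BorelSpace F] in
lemma isBounded_phi0 : IsBounded (phi0 F) 0 0 := by
  rw [phi0_eq]; exact isBounded_indicator_primePow le_rfl

omit [MeasurableSpace F] [BorelSpace F] in
lemma isSchwartz_phi0 : IsSchwartz (phi0 F) := ⟨_, _, isBounded_phi0⟩

/-- Pairing an `𝔬`-periodic function with `φ₀` evaluates it at `0`. -/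
lemma IsBounded.innerF_phi0 {f : F → ℂ} {m : ℤ} (h : IsBounded f m 0) :
    innerF f (phi0 F) = f 0 := by
  have : innerF f (phi0 F) = ∫ t, phi0 F t * f t ∂haarF F := by
    simp only [innerF]
    congr 1; ext t
    by_cases ht : t ∈ primePow F 0
    · rw [phi0_of_mem ht]; simp
    · rw [phi0_of_notMem ht]; simp
  rw [this, isBounded_phi0.integral_eq, setIntegral_congr_fun (g := fun _ => f 0)
    (measurableSet_primePow 0), setIntegral_const_primePow]
  · simp
  · intro t ht
    have := h.inv 0 t ht
    rw [zero_add] at this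
    simp only [phi0_of_mem ht, this, one_mul]

variable {ψ : AddChar F ℂ} {δ : F} (hψ : HasConductor ψ δ)
include hψ

open Classical in
lemma fourierT_phi0 (x : F) : fourierT ψ δ (phi0 F) x =
    (Real.sqrt (nabs δ) : ℂ) * if x ∈ primePow F (-ord δ) then 1 else 0 := by
  rw [fourierT, isBounded_phi0.integral_eq, setIntegral_congr_fun (g := fun y => ψ (x * y))
    (measurableSet_primePow 0), hψ.setIntegral]
  · simp
  · intro y hy
    simp only [phi0_of_mem hy, one_mul]

end Phi0

section EigenGroup

variable {F : Type*} [Field F] [ValuativeRel F] [TopologicalSpace F]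
  [IsNonarchimedeanLocalField F] [MeasurableSpace F] [BorelSpace F] [CharZero F]
  {ψ : AddChar F ℂ} {δ : F} (hψ : HasConductor ψ δ)
include hψ

/-- The matrices whose inverse images in the metaplectic group act on `φ₀` by a scalar. -/
def eigenGroup : Subgroup SL(2, F) where
  carrier := {g | ∃ z : ℂ, weil ψ δ (bracket g) (phi0 F) = z • phi0 F}
  mul_mem' := by
    rintro g h ⟨z, hz⟩ ⟨z', hz'⟩
    refine ⟨((kubota g h : ℤ) : ℂ) * z' * z, ?_⟩
    have := weil_bracket_mul hψ g h isSchwartz_phi0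
    rw [hz', weil_bracket_smul, hz] at this
    calc _ = ((kubota g h : ℤ) : ℂ) • ((kubota g h : ℤ) : ℂ) •
          weil ψ δ (bracket (g * h)) (phi0 F) := by rw [smul_smul, sign_sq, one_smul]
      _ = _ := by rw [← this, smul_smul, smul_smul]
  one_mem' := ⟨1, by rw [weil_bracket_one hψ, one_smul]⟩
  inv_mem' := by
    rintro g ⟨z, hz⟩
    have := weil_bracket_mul hψ g⁻¹ g isSchwartz_phi0
    rw [hz, weil_bracket_smul, inv_mul_cancel, weil_bracket_one hψ] at this
    have hz0 : z ≠ 0 := by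
      rintro rfl
      have h0 := congrFun this 0
      rcases Int.units_eq_one_or (kubota g⁻¹ g) with h | h <;> simp [h] at h0
    refine ⟨z⁻¹ * ((kubota g⁻¹ g : ℤ) : ℂ), ?_⟩
    rw [mul_smul, ← this, smul_smul, inv_mul_cancel₀ hz0, one_smul]

lemma mem_eigenGroup_of_upper {g : SL(2, F)} (hg : g ∈ latticeGroup (ord δ) 0)
    (hc : g.1 1 0 = 0) : g ∈ eigenGroup hψ := by
  obtain ⟨h1, h2, h3, -⟩ := hg
  have hdet := sl_det g
  rw [hc, mul_zero, sub_zero] at hdet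
  have ha : g.1 0 0 ≠ 0 := left_ne_zero_of_mul_eq_one hdet
  have hd : g.1 1 1 ≠ 0 := right_ne_zero_of_mul_eq_one hdet
  have hao : ord (g.1 0 0) = 0 := by
    have := ord_mul ha hd
    rw [hdet, ord_one] at this
    rw [mem_primePow_of_ne ha] at h1
    rw [mem_primePow_of_ne hd] at h2
    omega
  refine ⟨weilConst ψ δ 1 / weilConst ψ δ (g.1 0 0), ?_⟩
  rw [weil_bracket_of_eq hc]
  ext t
  have hna : nabs (g.1 0 0) = 1 := by rw [nabs_of_ne ha, hao]; simp
  simp only [weilU, weilM, Pi.smul_apply, smul_eq_mul, hna]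
  have hat : g.1 0 0 * t ∈ primePow F 0 ↔ t ∈ primePow F 0 := by
    rw [mul_mem_primePow_iff ha, hao, sub_zero]
  by_cases ht : t ∈ primePow F 0
  · rw [phi0_of_mem ht, phi0_of_mem (hat.2 ht), hψ.eq_one]
    · simp
    · refine mul_mem_of_eq (mul_mem_of_eq h1 h3 le_rfl) (pow_two t ▸ mul_mem_primePow ht ht) ?_
      omega
  · rw [phi0_of_notMem ht, phi0_of_notMem (mt hat.1 ht)]
    simp

omit [MeasurableSpace F] [BorelSpace F] [CharZero F] hψ in
lemma upperUni_mem {D : ℤ} {k : ℕ} {y : F} (hy : y ∈ primePow F (-D)) :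
    upperUni y ∈ latticeGroup D k := by
  simp [mem_latticeGroup, hy, one_mem_primePow_zero]

omit [MeasurableSpace F] [BorelSpace F] [CharZero F] hψ in
lemma lowerUni_mem {D : ℤ} {k : ℕ} {y : F} (hy : y ∈ primePow F (D + k)) :
    lowerUni y ∈ latticeGroup D k := by
  simp [mem_latticeGroup, hy, one_mem_primePow_zero]

lemma upperUni_mem_eigenGroup {y : F} (hy : y ∈ primePow F (-ord δ)) :
    upperUni y ∈ eigenGroup hψ :=
  mem_eigenGroup_of_upper hψ (upperUni_mem hy) (by simp)

lemma weylMat_mem_eigenGroup : weylMat (2 * δ) (mul_ne_zero two_ne_zero hψ.ne_zero) ∈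
    eigenGroup hψ := by
  classical
  have hδ := hψ.ne_zero
  have h2δ : 2 * δ ≠ 0 := mul_ne_zero two_ne_zero hδ
  refine ⟨conj (weilConst ψ δ (2 * δ)), ?_⟩
  have e1 : (weylMat (2 * δ) h2δ).1 1 0 = 2 * δ := by simp
  have e2 : (weylMat (2 * δ) h2δ).1 0 0 = 0 := by simp
  have e3 : (weylMat (2 * δ) h2δ).1 1 1 = 0 := by simp
  rw [weil_bracket_of_ne (by rwa [e1]), e1, e2, e3, zero_div, weilU_zero, weilU_zero]
  ext t
  have e4 : (2 : F) * (2 * δ)⁻¹ = δ⁻¹ := by field_simp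
  have e5 : (-2 : F) * (2 * δ)⁻¹ = -δ⁻¹ := by field_simp
  have e6 : -δ⁻¹ * t ∈ primePow F (-ord δ) ↔ t ∈ primePow F 0 := by
    rw [mul_mem_primePow_iff (neg_ne_zero.2 (inv_ne_zero hδ))]; simp
  have hn : (Real.sqrt (nabs δ) : ℂ) ≠ 0 := by
    exact_mod_cast (Real.sqrt_pos.2 (nabs_pos hδ)).ne'
  simp only [weilW, Pi.smul_apply, smul_eq_mul, e4, e5, fourierT_phi0 hψ, e6, nabs_inv,
    Real.sqrt_inv]
  push_cast
  by_cases ht : t ∈ primePow F 0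
  · rw [phi0_of_mem ht, if_pos ht]; field_simp
  · rw [phi0_of_notMem ht, if_neg ht]; simp

lemma lowerUni_mem_eigenGroup {x : F} (hx : x ∈ primePow F (ord δ + 2 * ord (2 : F))) :
    lowerUni x ∈ eigenGroup hψ := by
  have hδ := hψ.ne_zero
  have h2δ : 2 * δ ≠ 0 := mul_ne_zero two_ne_zero hδ
  have hw := weylMat_mem_eigenGroup hψ
  rw [lowerUni_eq h2δ]
  refine mul_mem (mul_mem (inv_mem hw) (upperUni_mem_eigenGroup hψ ?_)) hw
  rw [neg_mem_primePow, div_eq_inv_mul, mul_mem_primePow_iff (inv_ne_zero (pow_ne_zero 2 h2δ)),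
    ord_inv, ord_pow, ord_mul two_ne_zero hδ]
  refine primePow_anti ?_ hx
  push_cast
  linarith

/-- `Γ` acts on `φ₀` by scalars: it is generated by upper and lower triangular matrices. -/
lemma latticeGroup_le_eigenGroup {k : ℕ} (hk : 2 * ord (2 : F) ≤ k) :
    latticeGroup (ord δ) k ≤ eigenGroup hψ := by
  have key : ∀ g ∈ latticeGroup (ord δ) k, g.1 1 1 ≠ 0 → ord (g.1 1 1) = 0 →
      g ∈ eigenGroup hψ := by
    intro g hg hd hdo
    have hx : -(g.1 1 0 / g.1 1 1) ∈ primePow F (ord δ + k) := by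
      rw [neg_mem_primePow, div_eq_inv_mul, mul_mem_primePow_iff (inv_ne_zero hd), ord_inv, hdo]
      simpa using hg.2.2.2
    have hn := lowerUni_mem_eigenGroup hψ (x := -(g.1 1 0 / g.1 1 1))
      (primePow_anti (by omega) hx)
    have hup : g * lowerUni (-(g.1 1 0 / g.1 1 1)) ∈ eigenGroup hψ := by
      refine mem_eigenGroup_of_upper hψ (latticeGroup_anti _ (Nat.zero_le k)
        (mul_mem hg (lowerUni_mem hx))) ?_
      rw [sl_mul_apply]
      simp
      field_simp
      ring
    simpa using mul_mem hup (inv_mem hn)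
  intro g hg
  obtain ⟨h1, h2, h3, h4⟩ := hg
  by_cases hd : g.1 1 1 ∈ primePow F 1
  · have hdet := sl_det g
    have hone : (1 : F) ∉ primePow F 1 := by
      rw [mem_primePow_of_ne one_ne_zero, ord_one]; norm_num
    have hbc : g.1 1 0 ∉ primePow F (ord δ + 1) := by
      intro h
      refine hone ?_
      rw [← hdet]
      exact sub_mem_primePow (mul_mem_of_eq h1 hd (by norm_num)) (mul_mem_of_eq h3 h (by omega))
    have hc : g.1 1 0 ≠ 0 := by intro h; rw [h] at hbc; simp at hbc
    rw [mem_primePow_of_ne hc] at hbc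
    have hy : (1 - g.1 1 1) / g.1 1 0 ∈ primePow F (-ord δ) := by
      rw [div_eq_inv_mul, mul_mem_primePow_iff (inv_ne_zero hc), ord_inv]
      exact primePow_anti (by omega) (sub_mem_primePow one_mem_primePow_zero h2)
    have e : (g * upperUni ((1 - g.1 1 1) / g.1 1 0)).1 1 1 = 1 := by
      rw [sl_mul_apply]
      simp
      field_simp
      ring
    have := key (g * upperUni ((1 - g.1 1 1) / g.1 1 0))
      (mul_mem (show g ∈ latticeGroup (ord δ) k from ⟨h1, h2, h3, h4⟩) (upperUni_mem hy))
      (by rw [e]; exact one_ne_zero) (by rw [e, ord_one])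
    simpa using mul_mem this (inv_mem (upperUni_mem_eigenGroup hψ hy))
  · have hd0 : g.1 1 1 ≠ 0 := by intro h; rw [h] at hd; simp at hd
    rw [mem_primePow_of_ne hd0] at hd h2
    exact key g ⟨h1, Or.inr h2, h3, h4⟩ hd0 (by omega)

lemma weil_phi0 {x : Mp F} (hx : x.g ∈ eigenGroup hψ) :
    weil ψ δ x (phi0 F) = (eps ψ δ x)⁻¹ • phi0 F := by
  obtain ⟨z, hz⟩ := hx
  have h : weil ψ δ x (phi0 F) = (((x.ζ : ℤ) : ℂ) * z) • phi0 F := by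
    rw [weil_eq_smul, hz, smul_smul]
  have h0 := congrFun h 0
  simp only [Pi.smul_apply, phi0_zero, smul_eq_mul, mul_one] at h0
  rw [eps, inv_inv, h0, h]

omit [CharZero F] hψ in
lemma innerF_phi0_phi0 : innerF (phi0 F) (phi0 F) = 1 := by
  rw [isBounded_phi0.innerF_phi0, phi0_zero]

/-- The character `ε` is unitary. -/
lemma eps_mul_conj {x : Mp F} (hx : x.g ∈ eigenGroup hψ) :
    eps ψ δ x * conj (eps ψ δ x) = 1 := by
  have h := innerF_weil hψ x (isSchwartz_phi0 (F := F)) isSchwartz_phi0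
  rw [weil_phi0 hψ hx, innerF_smul_left, innerF_smul_right, innerF_phi0_phi0, mul_one,
    map_inv₀, ← mul_inv] at h
  exact inv_eq_one.1 h

/-- Near the identity `[g]` fixes `φ₀`: the eigenvalue is found at `t = 0`, where the diagonal entries
are squares and the Gauss integral over `𝔬` is already stable. -/
lemma weil_bracket_phi0_of_mem_principalGroup {k : ℕ} (hk : 2 * ord (2 : F) < k) {g : SL(2, F)}
    (hg : g ∈ principalGroup (ord δ) k) : weil ψ δ (bracket g) (phi0 F) = phi0 F := by
  have h0 := ord_two_nonneg (F := F)
  have hE : g ∈ eigenGroup hψ := latticeGroup_le_eigenGroup hψ (k := k) (by omega)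
    (principalGroup_le _ le_rfl hg)
  suffices h : weil ψ δ (bracket g) (phi0 F) 0 = 1 by
    have := weil_phi0 hψ (x := bracket g) hE
    rw [this, eps, inv_inv, h, one_smul]
  have hunit : ∀ x : F, x - 1 ∈ primePow F k → x ≠ 0 ∧ ord x = 0 ∧ ∃ r ≠ 0, r ^ 2 = x := by
    intro x hx
    obtain ⟨r, hr, hr2⟩ := isSquare_one_add (primePow_anti (m := 2 * ord (2 : F) + 1)
      (by omega) hx)
    obtain ⟨h1, h2⟩ := ord_add_eq_left (x := (1 : F)) (y := x - 1) one_ne_zero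
      (by rw [ord_one]; exact primePow_anti (by omega) hx)
    rw [add_sub_cancel] at h1 h2 hr2
    exact ⟨h1, by simpa using h2, r, hr, hr2⟩
  obtain ⟨ha, hao, r, hr, har⟩ := hunit _ hg.1
  obtain ⟨hd, hdo, s, hs, hds⟩ := hunit _ hg.2.1
  by_cases hc : g.1 1 0 = 0
  · rw [weil_bracket_of_eq hc]
    have hna : nabs (g.1 0 0) = 1 := by rw [nabs_of_ne ha, hao]; simp
    have hw := weilConst_mul_sq hψ one_ne_zero hr
    rw [one_mul, har] at hw
    simp [weilU, weilM, hna, hw, weilConst_ne_zero hψ (one_ne_zero (α := F))]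
  · have hdc : g.1 1 1 / g.1 1 0 ≠ 0 := div_ne_zero hd hc
    have hco := (mem_primePow_of_ne hc).1 hg.2.2.2
    have hst : IsStable δ (g.1 1 1 / g.1 1 0) 0 := by
      rw [IsStable, ord_mul two_ne_zero hdc, ord_div hd hc, hdo]
      constructor <;> omega
    have hF : fourierT ψ δ (weilU ψ (g.1 1 1 / g.1 1 0) (phi0 F)) 0 =
        Real.sqrt (nabs δ) * gaussVal ψ δ (g.1 1 1 / g.1 1 0) := by
      rw [← hst.gaussInt_eq hψ hdc, fourierT, gaussInt]
      congr 1
      have : ∀ y, weilU ψ (g.1 1 1 / g.1 1 0) (phi0 F) y * ψ (0 * y) =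
          phi0 F y * ψ (g.1 1 1 / g.1 1 0 * y ^ 2) := by
        intro y; simp [weilU, mul_comm]
      simp only [this]
      rw [isBounded_phi0.integral_eq, neg_zero]
      refine setIntegral_congr_fun (measurableSet_primePow 0) fun y hy => ?_
      simp only [phi0_of_mem hy, one_mul]
    rw [weil_bracket_of_ne hc]
    simp only [weilU, weilW, mul_zero]
    have hF' : fourierT ψ δ (fun t => ψ (g.1 1 1 / g.1 1 0 * t ^ 2) * phi0 F t) 0 =
        Real.sqrt (nabs δ) * gaussVal ψ δ (g.1 1 1 / g.1 1 0) := hF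
    erw [hF']
    have hw : weilConst ψ δ (g.1 1 1 / g.1 1 0) = weilConst ψ δ (g.1 1 0) := by
      rw [← weilConst_mul_sq hψ hc (div_ne_zero hs hc), div_pow, hds]
      congr 1; field_simp
    have hn : nabs (2 * (g.1 1 0)⁻¹) = nabs (2 * (g.1 1 1 / g.1 1 0)) := by
      rw [nabs_mul, nabs_mul, nabs_div, nabs_inv, show nabs (g.1 1 1) = 1 by
        rw [nabs_of_ne hd, hdo]; simp, one_div]
    have h1 := weilConst_mul_conj hψ hc
    rw [hn]
    have h2 := weilConst_eq hψ hdc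
    rw [hw] at h2
    simp only [ne_eq, OfNat.ofNat_ne_zero, not_false_eq_true, zero_pow, mul_zero,
      AddChar.map_zero_eq_one, one_mul]
    linear_combination h1 - conj (weilConst ψ δ (g.1 1 0)) * h2

/-- Kubota's cocycle is trivial on a small congruence subgroup. -/
lemma kubota_eq_one {k : ℕ} (hk : 2 * ord (2 : F) < k) {g h : SL(2, F)}
    (hg : g ∈ principalGroup (ord δ) k) (hh : h ∈ principalGroup (ord δ) k) : kubota g h = 1 := by
  have := weil_bracket_mul hψ g h isSchwartz_phi0
  rw [weil_bracket_phi0_of_mem_principalGroup hψ hk hh,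
    weil_bracket_phi0_of_mem_principalGroup hψ hk hg,
    weil_bracket_phi0_of_mem_principalGroup hψ hk (mul_mem hg hh)] at this
  have h0 := congrFun this 0
  rcases Int.units_eq_one_or (kubota g h) with h1 | h1
  · exact h1
  · rw [h1] at h0
    norm_num at h0

omit [MeasurableSpace F] [BorelSpace F] [CharZero F] in
lemma IsBounded.weilU_of_mem {f : F → ℂ} (h : IsBounded f (-ord (2 : F)) 0) {b : F}
    (hb : b ∈ primePow F (-ord δ)) : IsBounded (Metaplectic.weilU ψ b f) (-ord (2 : F)) 0 := by
  refine ⟨fun x hx => by simp [Metaplectic.weilU, h.supp x hx], fun x y hy => ?_⟩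
  simp only [Metaplectic.weilU, h.inv x y hy]
  by_cases hx : x ∈ primePow F (-ord (2 : F))
  · rw [show b * (x + y) ^ 2 = b * x ^ 2 + b * (2 * x * y + y ^ 2) by ring, hψ.add_eq]
    refine mul_mem_of_eq hb (n := 0) (add_mem_primePow ?_ ?_) (by omega)
    · exact mul_mem_of_eq (mul_mem_primePow (self_mem_primePow 2) hx) hy (by omega)
    · exact pow_two y ▸ mul_mem_of_eq hy hy (by omega)
  · rw [h.supp x hx, mul_zero, mul_zero]

lemma IsBounded.weilW_of_ord {f : F → ℂ} (h : IsBounded f (-ord (2 : F)) 0) {c : F}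
    (hc : c ≠ 0) (hco : ord c = ord δ) :
    IsBounded (Metaplectic.weilW ψ δ c f) (-ord (2 : F)) 0 := by
  have hF := h.isBounded_fourierT hψ
  have hk : -2 * c⁻¹ ≠ 0 := mul_ne_zero (neg_ne_zero.2 two_ne_zero) (inv_ne_zero hc)
  have hko : ord (-2 * c⁻¹) = ord (2 : F) - ord δ := by
    rw [ord_mul (neg_ne_zero.2 two_ne_zero) (inv_ne_zero hc), ord_neg, ord_inv, hco]; ring
  refine ⟨fun x hx => ?_, fun x y hy => ?_⟩
  · simp only [Metaplectic.weilW]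
    rw [hF.supp, mul_zero]
    rw [mul_mem_primePow_iff hk, hko]
    exact fun h => hx (primePow_anti (by omega) h)
  · simp only [Metaplectic.weilW, mul_add]
    rw [hF.inv]
    rw [mul_mem_primePow_iff hk, hko]
    exact primePow_anti (by omega) hy

/-- The `𝔬`-periodic functions with support in `½ 𝔬` are stable under the inverse image of `Λ`. -/
lemma IsBounded.weil_of_mem {f : F → ℂ} (h : IsBounded f (-ord (2 : F)) 0) {x : Mp F}
    (hx : x.g ∈ latticeGroup (ord δ) 0) :
    IsBounded (Metaplectic.weil ψ δ x f) (-ord (2 : F)) 0 := by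
  have hsmul : ∀ (z : ℂ) {f : F → ℂ}, IsBounded f (-ord (2 : F)) 0 →
      IsBounded (z • f) (-ord (2 : F)) 0 := fun z f h =>
    ⟨fun x hx => by simp [h.supp x hx], fun x y hy => by simp [h.inv x y hy]⟩
  have key : ∀ g ∈ latticeGroup (ord δ) 0, g.1 1 0 ≠ 0 → ord (g.1 1 0) = ord δ →
      ∀ {f : F → ℂ}, IsBounded f (-ord (2 : F)) 0 →
        IsBounded (Metaplectic.weil ψ δ (bracket g) f) (-ord (2 : F)) 0 := by
    intro g hg hc hco f hf
    have hdiv : ∀ y ∈ primePow F 0, y / g.1 1 0 ∈ primePow F (-ord δ) := by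
      intro y hy
      rw [div_eq_inv_mul, mul_mem_primePow_iff (inv_ne_zero hc), ord_inv, hco]
      simpa using hy
    rw [weil_bracket_of_ne hc]
    exact ((hf.weilU_of_mem hψ (hdiv _ hg.2.1)).weilW_of_ord hψ hc hco).weilU_of_mem hψ
      (hdiv _ hg.1)
  rw [weil_eq_smul]
  refine hsmul _ ?_
  set g := x.g
  by_cases hc : g.1 1 0 ∈ primePow F (ord δ + 1)
  · -- multiply by a Weyl element to make the lower left entry a generator of `𝔡`
    have hδ := hψ.ne_zero
    have hdet := sl_det g
    have hd : g.1 1 1 ∉ primePow F 1 := by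
      intro hd
      have : (1 : F) ∈ primePow F 1 := by
        rw [← hdet]
        exact sub_mem_primePow (mul_mem_of_eq hx.1 hd (by norm_num))
          (mul_mem_of_eq hx.2.2.1 hc (by omega))
      rw [mem_primePow_of_ne one_ne_zero, ord_one] at this
      norm_num at this
    have hd0 : g.1 1 1 ≠ 0 := by intro h; rw [h] at hd; simp at hd
    have hdo : ord (g.1 1 1) = 0 := by
      rw [mem_primePow_of_ne hd0] at hd
      have := (mem_primePow_of_ne hd0).1 hx.2.1
      omega
    have hw : weylMat δ hδ ∈ latticeGroup (ord δ) 0 := by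
      simp [mem_latticeGroup, mem_primePow_of_ne (inv_ne_zero hδ), mem_primePow_of_ne hδ]
    have e1 : (g * weylMat δ hδ).1 1 0 = g.1 1 1 * δ := by
      rw [sl_mul_apply]; simp
    have e2 : ((weylMat δ hδ)⁻¹).1 1 0 = -δ := by simp
    have h1 := key (weylMat δ hδ)⁻¹ (inv_mem hw) (by rw [e2]; exact neg_ne_zero.2 hδ)
      (by rw [e2, ord_neg]) h
    have h2 := key (g * weylMat δ hδ) (mul_mem hx hw) (by rw [e1]; exact mul_ne_zero hd0 hδ)
      (by rw [e1, ord_mul hd0 hδ, hdo, zero_add]) h1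
    rw [weil_bracket_mul hψ _ _ ⟨_, _, h⟩, mul_inv_cancel_right] at h2
    have h3 := hsmul ((kubota (g * weylMat δ hδ) (weylMat δ hδ)⁻¹ : ℤ) : ℂ) h2
    rwa [smul_smul, sign_sq, one_smul] at h3
  · have hc0 : g.1 1 0 ≠ 0 := by intro h; rw [h] at hc; simp at hc
    rw [mem_primePow_of_ne hc0] at hc
    have h4 := (mem_primePow_of_ne hc0).1 hx.2.2.2
    refine key g hx hc0 ?_ h
    push_cast at h4
    omega

omit [MeasurableSpace F] [BorelSpace F] hψ in
lemma isBounded_phi0_half : IsBounded (phi0 F) (-ord (2 : F)) 0 := by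
  have h0 := ord_two_nonneg (F := F)
  exact isBounded_phi0.mono (by omega) le_rfl

end EigenGroup

/-! ### Topology of `SL₂(F)` and of the metaplectic group -/

section Topology

variable {F : Type*} [Field F] [ValuativeRel F] [TopologicalSpace F]
  [IsNonarchimedeanLocalField F]

omit [ValuativeRel F] [IsNonarchimedeanLocalField F] in
lemma continuous_sl_entry (i j : Fin 2) : Continuous fun g : SL(2, F) => g.1 i j :=
  (continuous_apply_apply i j).comp continuous_subtype_val

lemma isOpen_entry_mem (i j : Fin 2) (x : F) (n : ℤ) :
    IsOpen {g : SL(2, F) | g.1 i j - x ∈ primePow F n} :=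
  (isOpen_primePow n).preimage ((continuous_sl_entry i j).sub continuous_const)

lemma isOpen_principalGroup (D : ℤ) (k : ℕ) :
    IsOpen ((principalGroup D k : Subgroup SL(2, F)) : Set SL(2, F)) := by
  have := (((isOpen_entry_mem (F := F) 0 0 1 k).inter (isOpen_entry_mem 1 1 1 k)).inter
    (isOpen_entry_mem 0 1 0 (-D))).inter (isOpen_entry_mem 1 0 0 (D + k))
  convert! this using 1
  ext g
  simp [mem_principalGroup, and_assoc]

lemma isOpen_of_principalGroup_le {D : ℤ} {k : ℕ} {K : Subgroup SL(2, F)}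
    (h : principalGroup D k ≤ K) : IsOpen (K : Set SL(2, F)) :=
  Subgroup.isOpen_mono h (isOpen_principalGroup D k)

lemma isOpen_latticeGroup (D : ℤ) (k : ℕ) :
    IsOpen ((latticeGroup D k : Subgroup SL(2, F)) : Set SL(2, F)) :=
  isOpen_of_principalGroup_le (principalGroup_le D le_rfl)

lemma isCompact_latticeGroup (D : ℤ) (k : ℕ) :
    IsCompact ((latticeGroup D k : Subgroup SL(2, F)) : Set SL(2, F)) := by
  have := t2Space F
  have hemb : Topology.IsClosedEmbedding (Subtype.val : SL(2, F) → Matrix (Fin 2) (Fin 2) F) := by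
    refine IsClosed.isClosedEmbedding_subtypeVal ?_
    exact isClosed_singleton.preimage (f := fun A : Matrix (Fin 2) (Fin 2) F => A.det)
      (Continuous.matrix_det continuous_id) (t := {1})
  set N : Fin 2 → Fin 2 → ℤ := ![![0, -D], ![D + k, 0]] with hN
  have hc : IsCompact (Set.univ.pi fun i => Set.univ.pi fun j => primePow F (N i j)) :=
    isCompact_univ_pi fun i => isCompact_univ_pi fun j => isCompact_primePow _
  have e : ((latticeGroup D k : Subgroup SL(2, F)) : Set SL(2, F)) =
      Subtype.val ⁻¹' (Set.univ.pi fun i => Set.univ.pi fun j => primePow F (N i j)) := by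
    ext g
    have hmem : ∀ A : Fin 2 → Fin 2 → F,
        (A ∈ Set.univ.pi fun i => Set.univ.pi fun j => primePow F (N i j)) ↔
          (A 0 0 ∈ primePow F 0 ∧ A 0 1 ∈ primePow F (-D)) ∧
            A 1 0 ∈ primePow F (D + k) ∧ A 1 1 ∈ primePow F 0 := by
      intro A
      simp [Fin.forall_fin_two, hN]
    rw [SetLike.mem_coe, mem_latticeGroup]
    refine Iff.trans ?_ (hmem g.1).symm
    tauto
  rw [e]
  exact hemb.isCompact_preimage hc

lemma isClopen_latticeGroup (D : ℤ) (k : ℕ) :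
    IsClopen ((latticeGroup D k : Subgroup SL(2, F)) : Set SL(2, F)) :=
  ⟨(latticeGroup D k).isClosed_of_isOpen (isOpen_latticeGroup D k), isOpen_latticeGroup D k⟩

end Topology

section MetaplecticTopology

variable {F : Type*} [Field F] [TopologicalSpace F]

lemma Mp.isOpen_iff {U : Set (Mp F)} :
    IsOpen U ↔ ∀ x ∈ U, ∃ V ∈ nhds (1 : SL(2, F)), ∀ k ∈ V, x * bracket k ∈ U := Iff.rfl

/-- A function invariant under right translation by the `[k]`, for `k` near the identity, is locally
constant. -/
lemma isLocallyConstant_of_mul_bracket {f : Mp F → ℂ} {V : Set SL(2, F)}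
    (hV : V ∈ nhds (1 : SL(2, F))) (h : ∀ x, ∀ k ∈ V, f (x * bracket k) = f x) :
    IsLocallyConstant f := by
  intro s
  rw [Mp.isOpen_iff]
  intro x hx
  refine ⟨V, hV, fun k hk => ?_⟩
  rw [Set.mem_preimage, h x k hk]
  exact hx

lemma isClosed_tilde {K : Subgroup SL(2, F)} (hK : (K : Set SL(2, F)) ∈ nhds 1) :
    IsClosed (tilde (K : Set SL(2, F))) := by
  rw [← isOpen_compl_iff, Mp.isOpen_iff]
  intro x hx
  refine ⟨K, hK, fun k hk hxk => hx ?_⟩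
  simp only [mem_tilde, Mp.mul_g, bracket_g, SetLike.mem_coe] at hxk hk ⊢
  exact (mul_mem_cancel_right hk).1 hxk

end MetaplecticTopology

/-! ### The metaplectic group law -/

section GroupLaw

variable {F : Type*} [Field F]

lemma units_mul_self (ζ : ℤˣ) : ζ * ζ = 1 := Int.units_mul_self ζ

lemma Mp.mul_inv_cancel' (x : Mp F) : x * x⁻¹ = bracket 1 := by
  refine Mp.ext (by simp) ?_
  change x.ζ * (x.ζ * kubota x.g x.g⁻¹) * kubota x.g x.g⁻¹ = 1
  rw [mul_assoc x.ζ, mul_assoc x.ζ, units_mul_self, mul_one, units_mul_self]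

end GroupLaw

section WeilGroup

variable {F : Type*} [Field F] [ValuativeRel F] [TopologicalSpace F]
  [IsNonarchimedeanLocalField F] [MeasurableSpace F] [BorelSpace F] [CharZero F]
  {ψ : AddChar F ℂ} {δ : F} (hψ : HasConductor ψ δ)
include hψ

lemma weil_weil_inv (x : Mp F) {φ : F → ℂ} (hφ : IsSchwartz φ) :
    weil ψ δ x (weil ψ δ x⁻¹ φ) = φ := by
  rw [← weil_mul hψ _ _ hφ, Mp.mul_inv_cancel', weil_bracket_one hψ]

lemma innerF_weil_left (x : Mp F) {φ φ' : F → ℂ} (h : IsSchwartz φ) (h' : IsSchwartz φ') :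
    innerF (weil ψ δ x φ) φ' = innerF φ (weil ψ δ x⁻¹ φ') := by
  rw [← innerF_weil hψ x h (h'.weil hψ x⁻¹), weil_weil_inv hψ x h']

lemma innerF_weil_right (x : Mp F) {φ φ' : F → ℂ} (h : IsSchwartz φ) (h' : IsSchwartz φ') :
    innerF φ (weil ψ δ x φ') = innerF (weil ψ δ x⁻¹ φ) φ' := by
  rw [← innerF_weil hψ x (h.weil hψ x⁻¹) h', weil_weil_inv hψ x h]

/-- The Weil representation separates the elements of the metaplectic group above the same matrix. -/
lemma Mp.ext_of_weil {x y : Mp F} (hg : x.g = y.g)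
    (h : weil ψ δ x (phi0 F) = weil ψ δ y (phi0 F)) : x = y := by
  refine Mp.ext hg ?_
  have h1 := innerF_weil hψ x (isSchwartz_phi0 (F := F)) isSchwartz_phi0
  rw [innerF_phi0_phi0] at h1
  nth_rewrite 2 [h] at h1
  rw [weil_eq_smul, weil_eq_smul y, hg, innerF_smul_left, innerF_smul_right,
    innerF_weil hψ _ isSchwartz_phi0 isSchwartz_phi0, innerF_phi0_phi0] at h1
  rcases Int.units_eq_one_or x.ζ with h2 | h2 <;> rcases Int.units_eq_one_or y.ζ with h3 | h3 <;>
    simp [h2, h3] at h1 ⊢ <;> norm_num at h1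

lemma Mp.mul_assoc' (x y z : Mp F) : x * y * z = x * (y * z) := by
  refine Mp.ext_of_weil hψ (by simp [mul_assoc]) ?_
  have h := isSchwartz_phi0 (F := F)
  rw [weil_mul hψ _ _ h, weil_mul hψ _ _ (h.weil hψ z), weil_mul hψ _ _ h, weil_mul hψ _ _ h]

/-- The inverse image of a compact set is compact: it is covered by finitely many translates of
the compact set of the `[k]` with `k` in a small compact open subgroup. -/
lemma isCompact_tilde {K : Subgroup SL(2, F)} (hKo : (K : Set SL(2, F)) ∈ nhds 1)
    (hK : IsCompact (K : Set SL(2, F))) : IsCompact (tilde (K : Set SL(2, F))) := by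
  have h0 := ord_two_nonneg (F := F)
  set P : Subgroup SL(2, F) := principalGroup (ord δ) (2 * (ord (2 : F)).toNat + 1) with hP
  have hk : 2 * ord (2 : F) < ((2 * (ord (2 : F)).toNat + 1 : ℕ) : ℤ) := by push_cast; omega
  have hPo : IsOpen (P : Set SL(2, F)) := isOpen_principalGroup _ _
  have hPc : IsCompact (P : Set SL(2, F)) :=
    (isCompact_latticeGroup (ord δ) 0).of_isClosed_subset (P.isClosed_of_isOpen hPo)
      (principalGroup_le _ (Nat.zero_le _))
  have hsec : ∀ x : Mp F, ContinuousOn (fun k => x * bracket k) (P : Set SL(2, F)) := by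
    intro x
    rw [continuousOn_open_iff hPo]
    intro U hU
    rw [isOpen_iff_mem_nhds]
    rintro k ⟨hkP, hkU⟩
    obtain ⟨V, hV, h⟩ := Mp.isOpen_iff.1 hU _ hkU
    have hVP : V ∩ P ∈ nhds (1 : SL(2, F)) := Filter.inter_mem hV (hPo.mem_nhds (one_mem P))
    have hmul : Filter.Tendsto (fun y => k⁻¹ * y) (nhds k) (nhds 1) := by
      have : Continuous fun y : SL(2, F) => k⁻¹ * y := continuous_const.mul continuous_id
      simpa using this.tendsto k
    filter_upwards [hmul hVP] with y hy
    have hyP : y ∈ P := by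
      have := mul_mem hkP hy.2
      simpa using this
    refine ⟨hyP, ?_⟩
    have h1 := h _ hy.1
    rw [Mp.mul_assoc' hψ] at h1
    have h2 : bracket k * bracket (k⁻¹ * y) = bracket y := by
      refine Mp.ext (by simp) ?_
      have : kubota k (k⁻¹ * y) = 1 := kubota_eq_one hψ hk hkP hy.2
      simp [this]
    rwa [h2] at h1
  obtain ⟨t, -, ht⟩ := hK.elim_nhds_subcover (fun g => (fun y => g⁻¹ * y) ⁻¹' (P : Set SL(2, F)))
    fun g _ => by
      refine (hPo.preimage (continuous_const.mul continuous_id)).mem_nhds ?_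
      simp [one_mem]
  have hcomp : IsCompact (⋃ g ∈ t, ⋃ ζ : ℤˣ, (fun k => (⟨g, ζ⟩ : Mp F) * bracket k) ''
      (P : Set SL(2, F))) :=
    t.isCompact_biUnion fun g _ => isCompact_iUnion fun ζ => hPc.image_of_continuousOn (hsec _)
  refine hcomp.of_isClosed_subset (isClosed_tilde hKo) fun x hx => ?_
  obtain ⟨g, hg, hgx⟩ := Set.mem_iUnion₂.1 (ht hx)
  refine Set.mem_iUnion₂.2 ⟨g, hg, Set.mem_iUnion.2 ⟨x.ζ * kubota g (g⁻¹ * x.g),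
    g⁻¹ * x.g, hgx, ?_⟩⟩
  refine Mp.ext (by simp) ?_
  simp [mul_assoc]

end WeilGroup

/-! ### Matrix coefficients in the Hecke algebra -/

section HeckeElement

variable {F : Type*} [Field F] [ValuativeRel F] [TopologicalSpace F]
  [IsNonarchimedeanLocalField F] [MeasurableSpace F] [BorelSpace F]

open Classical in
/-- The matrix coefficient `q^e (φ₀, ω_ψ(g) φ₀)` restricted to the inverse image of `K`. -/
noncomputable def coeffOn (ψ : AddChar F ℂ) (δ : F) (K : Subgroup SL(2, F)) (x : Mp F) : ℂ :=
  if x.g ∈ K then (resCard F : ℂ) ^ ord (2 : F) * innerF (phi0 F) (weil ψ δ x (phi0 F)) else 0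

variable {ψ : AddChar F ℂ} {δ : F}

lemma coeffOn_of_mem {K : Subgroup SL(2, F)} {x : Mp F} (h : x.g ∈ K) : coeffOn ψ δ K x =
    (resCard F : ℂ) ^ ord (2 : F) * innerF (phi0 F) (weil ψ δ x (phi0 F)) := if_pos h

lemma coeffOn_of_notMem {K : Subgroup SL(2, F)} {x : Mp F} (h : x.g ∉ K) : coeffOn ψ δ K x = 0 :=
  if_neg h

variable [CharZero F] (hψ : HasConductor ψ δ)
include hψ

/-- Over a compact subgroup `K` containing `Γ`, the matrix coefficient lies in the Hecke algebra: `φ₀`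
is fixed by the `[k]` with `k` near the identity and is an eigenvector of the inverse image of
`Γ`. -/
theorem coeffOn_mem_heckeAlg (p : ℕ) [Fact p.Prime] [Algebra ℚ_[p] F]
    (hc : different F p = primePow F (ord δ)) {K : Subgroup SL(2, F)}
    (hΓ : latticeGroup (ord δ) (2 * (ord (2 : F)).toNat) ≤ K)
    (hK : IsCompact (K : Set SL(2, F))) : coeffOn ψ δ K ∈ heckeAlg p ψ δ := by
  have h0 := ord_two_nonneg (F := F)
  have hφ := isSchwartz_phi0 (F := F)
  set P : Subgroup SL(2, F) := principalGroup (ord δ) (2 * (ord (2 : F)).toNat + 1) with hP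
  have hk : 2 * ord (2 : F) < ((2 * (ord (2 : F)).toNat + 1 : ℕ) : ℤ) := by push_cast; omega
  have hPK : P ≤ K := (principalGroup_le _ (by omega)).trans hΓ
  have hPn : (P : Set SL(2, F)) ∈ nhds 1 := (isOpen_principalGroup _ _).mem_nhds (one_mem P)
  have hKn : (K : Set SL(2, F)) ∈ nhds 1 := Filter.mem_of_superset hPn hPK
  refine ⟨?_, ?_, ?_⟩
  · refine isLocallyConstant_of_mul_bracket hPn fun x k hk' => ?_
    have hm : (x * bracket k).g ∈ K ↔ x.g ∈ K := by
      rw [Mp.mul_g, bracket_g, mul_mem_cancel_right (hPK hk')]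
    by_cases hx : x.g ∈ K
    · rw [coeffOn_of_mem (hm.2 hx), coeffOn_of_mem hx, weil_mul hψ _ _ hφ,
        weil_bracket_phi0_of_mem_principalGroup hψ hk hk']
    · rw [coeffOn_of_notMem (mt hm.1 hx), coeffOn_of_notMem hx]
  · refine HasCompactSupport.intro' (isCompact_tilde hψ hKn hK) (isClosed_tilde hKn) fun x hx => ?_
    exact if_neg hx
  · intro γ₁ h₁ γ₂ h₂ x
    rw [Gam_eq p hc] at h₁ h₂
    simp only [mem_tilde, SetLike.mem_coe] at h₁ h₂
    have e : 2 * ord (2 : F) ≤ ((2 * (ord (2 : F)).toNat : ℕ) : ℤ) := by omega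
    have e₁ := latticeGroup_le_eigenGroup hψ e h₁
    have e₂ := latticeGroup_le_eigenGroup hψ e h₂
    have c₂ := eps_mul_conj hψ e₂
    have n₁ := left_ne_zero_of_mul_eq_one (eps_mul_conj hψ e₁)
    have w₁ : phi0 F = weil ψ δ γ₁ (eps ψ δ γ₁ • phi0 F) := by
      rw [weil_smul, weil_phi0 hψ e₁, smul_smul, mul_inv_cancel₀ n₁, one_smul]
    have hleft : ∀ v, IsSchwartz v →
        innerF (phi0 F) (weil ψ δ γ₁ v) = eps ψ δ γ₁ * innerF (phi0 F) v := by
      intro v hv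
      nth_rewrite 1 [w₁]
      rw [innerF_weil hψ _ (hφ.smul _) hv, innerF_smul_left]
    have key : innerF (phi0 F) (weil ψ δ (γ₁ * x * γ₂) (phi0 F)) =
        eps ψ δ γ₁ * eps ψ δ γ₂ * innerF (phi0 F) (weil ψ δ x (phi0 F)) := by
      have c₂' : conj (eps ψ δ γ₂)⁻¹ = eps ψ δ γ₂ := by
        rw [map_inv₀]; exact inv_eq_of_mul_eq_one_left c₂
      rw [weil_mul hψ _ _ hφ, weil_phi0 hψ e₂, weil_smul, innerF_smul_right, weil_mul hψ _ _ hφ,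
        hleft _ (hφ.weil hψ x), c₂']
      ring
    have hm : (γ₁ * x * γ₂).g ∈ K ↔ x.g ∈ K := by
      rw [Mp.mul_g, Mp.mul_g, mul_mem_cancel_right (hΓ h₂), mul_mem_cancel_left (hΓ h₁)]
    by_cases hx : x.g ∈ K
    · rw [coeffOn_of_mem (hm.2 hx), coeffOn_of_mem hx, key]
      ring
    · rw [coeffOn_of_notMem (mt hm.1 hx), coeffOn_of_notMem hx, mul_zero]

end HeckeElement

/-! ### Invariance of the Haar measure under right translations -/

section RightTranslation

variable {G : Type*} [Group G] [TopologicalSpace G] [IsTopologicalGroup G] [MeasurableSpace G]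
  [BorelSpace G] (μ : Measure G) [μ.IsHaarMeasure]

/-- Right translation by `n` preserves the `μ`-integrals of continuous functions of compact
support. -/
def RightInvariantUnder (n : G) : Prop :=
  ∀ f : G → ℂ, Continuous f → HasCompactSupport f → ∫ h, f (h * n) ∂μ = ∫ h, f h ∂μ

/-- Right translation scales the integrals of continuous functions of compact support, here with
complex values, by a constant. -/
lemma exists_integral_mul_right_eq (n : G) : ∃ c : ℝ, 0 ≤ c ∧
    ∀ f : G → ℂ, Continuous f → HasCompactSupport f →
      ∫ h, f (h * n) ∂μ = c * ∫ h, f h ∂μ := by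
  set ν := Measure.map (· * n) μ with hν
  refine ⟨(ν.haarScalarFactor μ : ℝ), NNReal.coe_nonneg _, fun f hf hf' => ?_⟩
  have hmap : ∀ {E : Type} [NormedAddCommGroup E] [NormedSpace ℝ E] (f : G → E),
      ∫ h, f h ∂ν = ∫ h, f (h * n) ∂μ := fun f =>
    (Homeomorph.mulRight n).measurableEmbedding.integral_map (μ := μ) f
  have hreal : ∀ r : G → ℝ, Continuous r → HasCompactSupport r →
      ∫ h, r h ∂ν = (ν.haarScalarFactor μ : ℝ) * ∫ h, r h ∂μ := by
    intro r hr hr'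
    rw [Measure.integral_isMulLeftInvariant_eq_smul_of_hasCompactSupport ν μ hr hr',
      integral_smul_nnreal_measure]
    rfl
  have h1 := hreal (fun h => (f h).re) (Complex.continuous_re.comp hf)
    (hf'.comp_left (g := Complex.re) Complex.zero_re)
  have h2 := hreal (fun h => (f h).im) (Complex.continuous_im.comp hf)
    (hf'.comp_left (g := Complex.im) Complex.zero_im)
  have e : ∀ (ν' : Measure G), Integrable f ν' → ∫ h, f h ∂ν' =
      ((∫ h, (f h).re ∂ν' : ℝ) : ℂ) + ((∫ h, (f h).im ∂ν' : ℝ) : ℂ) * Complex.I :=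
    fun ν' h => (integral_re_add_im h).symm
  rw [← hmap f, e ν (hf.integrable_of_hasCompactSupport hf'),
    e μ (hf.integrable_of_hasCompactSupport hf'), h1, h2]
  push_cast
  ring

omit [MeasurableSpace G] [BorelSpace G] in
lemma frontier_subgroup_eq_empty {K : Subgroup G} (hK : IsOpen (K : Set G)) :
    frontier (K : Set G) = ∅ :=
  IsClopen.frontier_eq ⟨K.isClosed_of_isOpen hK, hK⟩

omit [MeasurableSpace G] [BorelSpace G] in
lemma continuous_indicator_one {K : Subgroup G} (hK : IsOpen (K : Set G)) :
    Continuous ((K : Set G).indicator fun _ => (1 : ℂ)) :=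
  continuous_const.indicator (by simp [frontier_subgroup_eq_empty hK])

omit [MeasurableSpace G] [BorelSpace G] in
lemma hasCompactSupport_indicator {K : Subgroup G} (hK : IsOpen (K : Set G))
    (hK' : IsCompact (K : Set G)) (f : G → ℂ) :
    HasCompactSupport ((K : Set G).indicator f) :=
  HasCompactSupport.intro' hK' (K.isClosed_of_isOpen hK) fun _ hx => Set.indicator_of_notMem hx _

variable {μ}

omit [IsTopologicalGroup G] in
lemma integral_indicator_one_ne_zero {K : Subgroup G} (hK : IsOpen (K : Set G))
    (hK' : IsCompact (K : Set G)) : ∫ h, (K : Set G).indicator (fun _ => (1 : ℂ)) h ∂μ ≠ 0 := by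
  rw [integral_indicator hK.measurableSet, setIntegral_const]
  have h1 : μ.real (K : Set G) ≠ 0 := by
    rw [Measure.real, ENNReal.toReal_ne_zero]
    exact ⟨(hK.measure_pos μ ⟨1, K.one_mem⟩).ne', hK'.measure_lt_top.ne⟩
  simpa using h1

/-- The scaling constant of right translation by an element of a compact open subgroup `K` is one,
as seen on the indicator function of `K`. -/
lemma rightInvariantUnder_of_mem {K : Subgroup G} (hK : IsOpen (K : Set G))
    (hK' : IsCompact (K : Set G)) {n : G} (hn : n ∈ K) : RightInvariantUnder μ n := by
  obtain ⟨c, -, hc⟩ := exists_integral_mul_right_eq μ n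
  have h1 := hc _ (continuous_indicator_one hK) (hasCompactSupport_indicator hK hK' _)
  have h2 : ∀ h, (K : Set G).indicator (fun _ => (1 : ℂ)) (h * n) =
      (K : Set G).indicator (fun _ => (1 : ℂ)) h := by
    intro h
    by_cases hh : h ∈ K
    · rw [Set.indicator_of_mem (mul_mem hh hn), Set.indicator_of_mem hh]
    · rw [Set.indicator_of_notMem hh,
        Set.indicator_of_notMem (mt (mul_mem_cancel_right hn).1 hh)]
  simp only [h2] at h1
  have hc1 : (c : ℂ) = 1 := by
    have := mul_right_cancel₀ (integral_indicator_one_ne_zero (μ := μ) hK hK')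
      ((one_mul _).trans h1)
    exact this.symm
  intro f hf hf'
  rw [hc f hf hf', hc1, one_mul]

/-- If `n²` is central, right translation by `n²` is a left translation, so the square of the scaling
constant of `n` is one. -/
lemma rightInvariantUnder_of_sq_central {K : Subgroup G} (hK : IsOpen (K : Set G))
    (hK' : IsCompact (K : Set G)) {n : G} (hn : ∀ h, h * (n * n) = n * n * h) :
    RightInvariantUnder μ n := by
  obtain ⟨c, hc0, hc⟩ := exists_integral_mul_right_eq μ n
  set f := (K : Set G).indicator (fun _ => (1 : ℂ)) with hf
  have f1 := continuous_indicator_one hK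
  have f2 := hasCompactSupport_indicator hK hK' (fun _ => (1 : ℂ))
  have h1 := hc (fun h => f (h * n)) (f1.comp (continuous_mul_const n))
    (f2.comp_homeomorph (Homeomorph.mulRight n))
  rw [hc f f1 f2] at h1
  simp only [mul_assoc _ n n, hn] at h1
  rw [integral_mul_left_eq_self f (n * n), ← mul_assoc] at h1
  have h2 := mul_right_cancel₀ (integral_indicator_one_ne_zero (μ := μ) hK hK')
    ((one_mul _).trans h1)
  have hc1 : c = 1 := by
    have : c * c = 1 := by exact_mod_cast h2.symm
    nlinarith
  intro f hf hf'
  rw [hc f hf hf', hc1, Complex.ofReal_one, one_mul]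

omit [MeasurableSpace G] [BorelSpace G] in
lemma continuous_of_left_invariant {X : Type*} [TopologicalSpace X] {P : Subgroup G}
    (hP : IsOpen (P : Set G)) {f : G → X} (h : ∀ γ ∈ P, ∀ x, f (γ * x) = f x) :
    Continuous f := by
  refine continuous_iff_continuousAt.2 fun x => ?_
  have : f =ᶠ[nhds x] fun _ => f x := by
    have hV : (fun y => y * x⁻¹) ⁻¹' (P : Set G) ∈ nhds x :=
      (hP.preimage (continuous_mul_const _)).mem_nhds (by simp)
    filter_upwards [hV] with y hy
    rw [← h _ hy x, inv_mul_cancel_right]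
  exact continuousAt_const.congr this.symm

/-- Right translation by an element of the compact open subgroup `K` preserves integrals over `K`. -/
lemma setIntegral_mul_right {K P : Subgroup G} (hP : IsOpen (P : Set G)) (hPK : P ≤ K)
    (hK' : IsCompact (K : Set G)) {n : G} (hn : n ∈ K) {f : G → ℂ}
    (h : ∀ γ ∈ P, ∀ x, f (γ * x) = f x) :
    ∫ x in (K : Set G), f (x * n) ∂μ = ∫ x in (K : Set G), f x ∂μ := by
  have hK : IsOpen (K : Set G) := Subgroup.isOpen_mono hPK hP
  rw [← integral_indicator hK.measurableSet, ← integral_indicator hK.measurableSet,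
    ← rightInvariantUnder_of_mem (μ := μ) hK hK' hn _
      ((continuous_of_left_invariant hP h).indicator (by simp [frontier_subgroup_eq_empty hK]))
      (hasCompactSupport_indicator hK hK' f)]
  congr 1; ext x
  by_cases hx : x ∈ K
  · rw [Set.indicator_of_mem hx, Set.indicator_of_mem (mul_mem hx hn)]
  · rw [Set.indicator_of_notMem hx,
      Set.indicator_of_notMem (mt (mul_mem_cancel_right hn).1 hx)]

end RightTranslation

/-! ### Orthogonality relations on `Λ` -/

section Orthogonality

variable {F : Type*} [Field F] [ValuativeRel F] [TopologicalSpace F]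
  [IsNonarchimedeanLocalField F] [MeasurableSpace F] [BorelSpace F]

/-- The vector `ω_ψ([h⁻¹]) φ₀`. The element `[h⁻¹]` differs from the inverse of `[h]` by a sign in
general. -/
noncomputable def orbitVec (ψ : AddChar F ℂ) (δ : F) (h : SL(2, F)) : F → ℂ :=
  weil ψ δ (bracket h⁻¹) (phi0 F)

/-- The kernel `conj f(s) f(t)`, where `f = ω_ψ([h⁻¹]) φ₀`; it does not depend on the choice of the
element `[h⁻¹]` above `h⁻¹`. -/
noncomputable def orbitKernel (ψ : AddChar F ℂ) (δ : F) (h : SL(2, F)) (s t : F) : ℂ :=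
  conj (orbitVec ψ δ h s) * orbitVec ψ δ h t

variable [CharZero F] {ψ : AddChar F ℂ} {δ : F} (hψ : HasConductor ψ δ)
include hψ

lemma isSchwartz_orbitVec (h : SL(2, F)) : IsSchwartz (orbitVec ψ δ h) :=
  isSchwartz_phi0.weil hψ _

lemma isBounded_orbitVec {h : SL(2, F)} (hh : h ∈ latticeGroup (ord δ) 0) :
    IsBounded (orbitVec ψ δ h) (-ord (2 : F)) 0 :=
  isBounded_phi0_half.weil_of_mem hψ (by simpa using inv_mem hh)

lemma innerF_orbitVec_self (h : SL(2, F)) : innerF (orbitVec ψ δ h) (orbitVec ψ δ h) = 1 := by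
  rw [orbitVec, innerF_weil hψ _ isSchwartz_phi0 isSchwartz_phi0, innerF_phi0_phi0]

lemma orbitVec_mul (h n : SL(2, F)) : orbitVec ψ δ (h * n) =
    ((kubota n⁻¹ h⁻¹ : ℤ) : ℂ) • weil ψ δ (bracket n⁻¹) (orbitVec ψ δ h) := by
  rw [orbitVec, orbitVec, weil_bracket_mul hψ _ _ isSchwartz_phi0, smul_smul, sign_sq, one_smul,
    mul_inv_rev]

lemma orbitKernel_mul (h n : SL(2, F)) (s t : F) : orbitKernel ψ δ (h * n) s t =
    conj (weil ψ δ (bracket n⁻¹) (orbitVec ψ δ h) s) *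
      weil ψ δ (bracket n⁻¹) (orbitVec ψ δ h) t := by
  simp only [orbitKernel, orbitVec_mul hψ, Pi.smul_apply, smul_eq_mul, map_mul,
    map_intCast (starRingEnd ℂ)]
  have := sign_sq (kubota n⁻¹ h⁻¹)
  linear_combination (conj (weil ψ δ (bracket n⁻¹) (orbitVec ψ δ h) s) *
      weil ψ δ (bracket n⁻¹) (orbitVec ψ δ h) t) * this

/-- Elements acting on `φ₀` by scalars change `ω_ψ([h⁻¹]) φ₀` by a scalar of absolute value one. -/
lemma exists_orbitVec_mul_left {γ : SL(2, F)} (hγ : γ ∈ eigenGroup hψ) (h : SL(2, F)) :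
    ∃ z : ℂ, z * conj z = 1 ∧ orbitVec ψ δ (γ * h) = z • orbitVec ψ δ h := by
  obtain ⟨z, hz⟩ := inv_mem hγ
  have e : orbitVec ψ δ (γ * h) =
      (((kubota h⁻¹ γ⁻¹ : ℤ) : ℂ) * z) • orbitVec ψ δ h := by
    rw [orbitVec_mul hψ, orbitVec, orbitVec, hz, weil_bracket_smul, smul_smul]
  refine ⟨_, ?_, e⟩
  have h1 := innerF_orbitVec_self hψ (γ * h)
  rw [e, innerF_smul_left, innerF_smul_right, innerF_orbitVec_self hψ, mul_one] at h1
  exact h1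

lemma orbitKernel_mul_left {γ : SL(2, F)} (hγ : γ ∈ eigenGroup hψ) (h : SL(2, F)) (s t : F) :
    orbitKernel ψ δ (γ * h) s t = orbitKernel ψ δ h s t := by
  obtain ⟨z, hz, e⟩ := exists_orbitVec_mul_left hψ hγ h
  simp only [orbitKernel, e, Pi.smul_apply, smul_eq_mul, map_mul]
  linear_combination (conj (orbitVec ψ δ h s) * orbitVec ψ δ h t) * hz

lemma isOpen_eigenGroup : IsOpen (eigenGroup hψ : Set SL(2, F)) := by
  have h0 := ord_two_nonneg (F := F)
  exact Subgroup.isOpen_mono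
    (latticeGroup_le_eigenGroup hψ (k := 2 * (ord (2 : F)).toNat) (by omega))
    (isOpen_latticeGroup _ _)

/-- The kernel is locally constant in `(h, s)`, uniformly in `t`. -/
lemma eventually_orbitKernel_eq (p : SL(2, F) × F) :
    ∀ᶠ p' in nhds p, ∀ t, orbitKernel ψ δ p'.1 p'.2 t = orbitKernel ψ δ p.1 p.2 t := by
  obtain ⟨h, s⟩ := p
  obtain ⟨m, n, hb⟩ := isSchwartz_orbitVec hψ h
  have hV : (fun y => y * h⁻¹) ⁻¹' (eigenGroup hψ : Set SL(2, F)) ∈ nhds h :=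
    ((isOpen_eigenGroup hψ).preimage (continuous_mul_const _)).mem_nhds (by simp)
  have hn : (fun y => y - s) ⁻¹' primePow F n ∈ nhds s :=
    ((isOpen_primePow n).preimage (continuous_sub_right s)).mem_nhds (by simp)
  filter_upwards [prod_mem_nhds hV hn] with ⟨y, s'⟩ ⟨hy, hs⟩ t
  have e1 := orbitKernel_mul_left hψ hy h s' t
  rw [inv_mul_cancel_right] at e1
  have e2 := hb.inv s _ hs
  rw [add_sub_cancel] at e2
  rw [e1]
  simp only [orbitKernel, e2]

lemma continuous_orbitKernel_left (t : F) :
    Continuous fun p : SL(2, F) × F => orbitKernel ψ δ p.1 p.2 t :=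
  continuous_iff_continuousAt.2 fun p => continuousAt_const.congr <| by
    filter_upwards [eventually_orbitKernel_eq hψ p] with p' hp' using (hp' t).symm

lemma continuous_orbitKernel_right (s : F) :
    Continuous fun p : SL(2, F) × F => orbitKernel ψ δ p.1 s p.2 := by
  have e : (fun p : SL(2, F) × F => orbitKernel ψ δ p.1 s p.2) =
      fun p => conj (orbitKernel ψ δ p.1 p.2 s) := by
    ext p
    simp only [orbitKernel, map_mul, Complex.conj_conj, mul_comm]
  rw [e]
  exact Complex.continuous_conj.comp (continuous_orbitKernel_left hψ s)

lemma continuous_orbitKernel_diag :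
    Continuous fun p : SL(2, F) × F => orbitKernel ψ δ p.1 p.2 p.2 := by
  refine continuous_iff_continuousAt.2 fun p => ?_
  have h1 : Filter.Tendsto (fun p' : SL(2, F) × F => (p'.1, p.2)) (nhds p) (nhds p) :=
    (Continuous.prodMk continuous_fst continuous_const).tendsto' p p rfl
  refine ((continuous_orbitKernel_right hψ p.2).tendsto p).congr' ?_
  filter_upwards [eventually_orbitKernel_eq hψ p,
    h1.eventually (eventually_orbitKernel_eq hψ p)] with p' h2 h3
  rw [h2, h3]

lemma continuous_integral_orbitKernel (E : Set F) :
    Continuous fun p : SL(2, F) × F => ∫ t in E, orbitKernel ψ δ p.1 p.2 t ∂haarF F :=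
  continuous_iff_continuousAt.2 fun p =>
    (continuousAt_const (y := ∫ t in E, orbitKernel ψ δ p.1 p.2 t ∂haarF F)).congr <| by
      filter_upwards [eventually_orbitKernel_eq hψ p] with p' hp'
      simp only [hp']

omit [CharZero F] hψ in
/-- The integral of a function that is constant on `s + 𝔬` and vanishes elsewhere. -/
lemma setIntegral_translate {m : ℤ} (hm : m ≤ 0) {s : F} (hs : s ∈ primePow F m) {f : F → ℂ}
    (hf : ∀ t ∈ primePow F m, t - s ∉ primePow F 0 → f t = 0)
    (hf' : ∀ t, t - s ∈ primePow F 0 → f t = f s) :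
    ∫ t in primePow F m, f t ∂haarF F = f s := by
  classical
  rw [← setIntegral_add_left hs, setIntegral_congr_fun
    (g := fun t => if t ∈ primePow F 0 then f s else 0) (measurableSet_primePow m),
    setIntegral_ite_primePow hm]
  · simp
  · intro t ht
    simp only
    split_ifs with h0
    · exact hf' _ (by simpa using h0)
    · exact hf _ (add_mem_primePow hs ht) (by simpa using h0)

variable [MeasurableSpace SL(2, F)] [BorelSpace SL(2, F)] (μ : Measure SL(2, F))

/-- The integral of `conj f_h(s) f_h(t)` over `h ∈ Λ`, where `f_h = ω_ψ([h⁻¹]) φ₀`. -/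
noncomputable def averagedKernel (ψ : AddChar F ℂ) (δ : F) (s t : F) : ℂ :=
  ∫ h in ((latticeGroup (ord δ) 0 : Subgroup SL(2, F)) : Set SL(2, F)), orbitKernel ψ δ h s t ∂μ

omit [BorelSpace SL(2, F)] in
lemma averagedKernel_add_right [OpensMeasurableSpace SL(2, F)] {s t y : F}
    (hy : y ∈ primePow F 0) :
    averagedKernel μ ψ δ s (t + y) = averagedKernel μ ψ δ s t := by
  refine setIntegral_congr_fun (isOpen_latticeGroup _ _).measurableSet fun h hh => ?_
  simp only [orbitKernel, (isBounded_orbitVec hψ hh).inv t y hy]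

omit [BorelSpace SL(2, F)] in
lemma averagedKernel_add_left [OpensMeasurableSpace SL(2, F)] {s t y : F}
    (hy : y ∈ primePow F 0) :
    averagedKernel μ ψ δ (s + y) t = averagedKernel μ ψ δ s t := by
  refine setIntegral_congr_fun (isOpen_latticeGroup _ _).measurableSet fun h hh => ?_
  simp only [orbitKernel, (isBounded_orbitVec hψ hh).inv s y hy]

variable [μ.IsHaarMeasure]

lemma averagedKernel_eq_integral_mul_right {n : SL(2, F)} (hn : n ∈ latticeGroup (ord δ) 0)
    (s t : F) : averagedKernel μ ψ δ s t =
      ∫ h in ((latticeGroup (ord δ) 0 : Subgroup SL(2, F)) : Set SL(2, F)),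
        orbitKernel ψ δ (h * n) s t ∂μ := by
  have h0 := ord_two_nonneg (F := F)
  refine (setIntegral_mul_right (isOpen_latticeGroup (ord δ) (2 * (ord (2 : F)).toNat))
    (latticeGroup_anti _ (Nat.zero_le _)) (isCompact_latticeGroup _ _) hn
    (f := fun h => orbitKernel ψ δ h s t) fun γ hγ x => ?_).symm
  exact orbitKernel_mul_left hψ (latticeGroup_le_eigenGroup hψ (by omega) hγ) x s t

/-- The averaged kernel vanishes off the diagonal, because the characters `b ↦ ψ(b s²)` of `𝔡⁻¹`
are distinct for the classes `s ∈ ½ 𝔬 / 𝔬`. -/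
lemma averagedKernel_eq_zero {s t : F} (ht : t ∈ primePow F (-ord (2 : F)))
    (hst : t - s ∉ primePow F 0) : averagedKernel μ ψ δ s t = 0 := by
  have hne : t - s ≠ 0 := by intro h; rw [h] at hst; simp at hst
  have hlt : ord (t - s) < 0 := by
    rw [mem_primePow_of_ne hne] at hst; omega
  have hsq : t ^ 2 - s ^ 2 ∉ primePow F 0 := by
    have e : t ^ 2 - s ^ 2 = -(t - s) ^ 2 + 2 * t * (t - s) := by ring
    have h2t : 2 * t ∈ primePow F 0 := mul_mem_of_eq (self_mem_primePow 2) ht (by omega)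
    obtain ⟨h1, h2⟩ := ord_add_eq_left (x := -(t - s) ^ 2) (y := 2 * t * (t - s))
      (neg_ne_zero.2 (pow_ne_zero 2 hne)) (by
        rw [ord_neg, ord_pow]
        exact mul_mem_of_eq h2t (self_mem_primePow (t - s)) (by push_cast; omega))
    rw [e, mem_primePow_of_ne h1, h2, ord_neg, ord_pow]
    push_cast
    omega
  have hex : ∃ b ∈ primePow F (-ord δ), ψ ((t ^ 2 - s ^ 2) * b) ≠ 1 := by
    by_contra! h
    exact hsq (by simpa using hψ.dual.1 h)
  obtain ⟨b, hb, hb1⟩ := hex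
  have key : averagedKernel μ ψ δ s t =
      ψ ((t ^ 2 - s ^ 2) * b) * averagedKernel μ ψ δ s t := by
    conv_lhs => rw [averagedKernel_eq_integral_mul_right hψ μ (upperUni_mem (neg_mem_primePow.2 hb))]
    rw [averagedKernel, ← integral_const_mul]
    congr 1; ext h
    have e : ((upperUni (-b))⁻¹).1 1 0 = 0 := by simp
    rw [orbitKernel_mul hψ, weil_bracket_of_eq e]
    simp only [sl_inv_00, sl_inv_01, upperUni_11, upperUni_01, neg_neg, one_mul, weilM_one hψ,
      weilU, orbitKernel, map_mul, hψ.conj_eq]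
    rw [show (t ^ 2 - s ^ 2) * b = -(b * s ^ 2) + b * t ^ 2 by ring, AddChar.map_add_eq_mul]
    ring
  have : (1 - ψ ((t ^ 2 - s ^ 2) * b)) * averagedKernel μ ψ δ s t = 0 := by
    linear_combination key
  exact (mul_eq_zero.1 this).resolve_left (sub_ne_zero.2 (Ne.symm hb1))

omit [MeasurableSpace SL(2, F)] [BorelSpace SL(2, F)] in
/-- The Weyl element of `Λ` turns the value of the kernel at zero into its integral. -/
lemma orbitKernel_mul_weylMat {h : SL(2, F)} (hh : h ∈ latticeGroup (ord δ) 0) :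
    orbitKernel ψ δ (h * weylMat δ hψ.ne_zero) 0 0 =
      nabs (2 : F) * ∫ s in primePow F (-ord (2 : F)), ∫ t in primePow F (-ord (2 : F)),
        orbitKernel ψ δ h s t ∂haarF F ∂haarF F := by
  have hδ := hψ.ne_zero
  have hb := isBounded_orbitVec hψ hh
  set I : ℂ := ∫ s in primePow F (-ord (2 : F)), orbitVec ψ δ h s ∂haarF F with hI
  have e : ((weylMat δ hδ)⁻¹).1 1 0 ≠ 0 := by simpa using hδ
  have hF : weil ψ δ (bracket (weylMat δ hδ)⁻¹) (orbitVec ψ δ h) 0 =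
      conj (weilConst ψ δ (-δ)) * Real.sqrt (nabs (2 * (-δ)⁻¹)) * (Real.sqrt (nabs δ) * I) := by
    rw [weil_bracket_of_ne e]
    simp only [sl_inv_00, sl_inv_11, sl_inv_10, weylMat_00, weylMat_11, weylMat_10, zero_div,
      weilU_zero, weilW, mul_zero, fourierT]
    congr 2
    simpa using hb.integral_eq (fun _ => (1 : ℂ))
  have h2 : 2 * (-δ)⁻¹ * δ = -2 := by field_simp
  have hsq : (Real.sqrt (nabs (2 * (-δ)⁻¹)) : ℂ) * Real.sqrt (nabs δ) =
      Real.sqrt (nabs (2 : F)) := by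
    rw [← Complex.ofReal_mul, ← Real.sqrt_mul (nabs_nonneg _), ← nabs_mul, h2, nabs_neg]
  have hI2 : ∫ s in primePow F (-ord (2 : F)), ∫ t in primePow F (-ord (2 : F)),
      orbitKernel ψ δ h s t ∂haarF F ∂haarF F = conj I * I := by
    simp only [orbitKernel, integral_const_mul, integral_mul_const, integral_conj]
    rfl
  rw [orbitKernel_mul hψ, hF, hI2, ← sqrt_nabs_mul_self (2 : F), ← hsq]
  have h1 := weilConst_mul_conj hψ (neg_ne_zero.2 hδ)
  simp only [map_mul, Complex.conj_conj, Complex.conj_ofReal]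
  linear_combination ((Real.sqrt (nabs (2 * (-δ)⁻¹)) : ℂ) ^ 2 * (Real.sqrt (nabs δ)) ^ 2 *
    (conj I * I)) * h1

omit [CharZero F] hψ in
/-- Interchange of the integrals over `Λ` and over `½ 𝔬`. -/
lemma integral_latticeGroup_swap (f : SL(2, F) → F → ℂ)
    (hf : Continuous fun p : SL(2, F) × F => f p.1 p.2) (D n : ℤ) :
    ∫ h in ((latticeGroup D 0 : Subgroup SL(2, F)) : Set SL(2, F)),
        ∫ s in primePow F n, f h s ∂haarF F ∂μ =
      ∫ s in primePow F n, ∫ h in ((latticeGroup D 0 : Subgroup SL(2, F)) : Set SL(2, F)),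
        f h s ∂μ ∂haarF F :=
  setIntegral_swap_of_isClopen (isClopen_latticeGroup _ _) (isCompact_latticeGroup _ _)
    (isClopen_primePow _) (isCompact_primePow _) hf

/-- The trace of the averaged kernel is one, because the vectors `f_h` have norm one. -/
lemma integral_averagedKernel_diag
    (hμ : μ ((latticeGroup (ord δ) 0 : Subgroup SL(2, F)) : Set SL(2, F)) = 1) :
    ∫ s in primePow F (-ord (2 : F)), averagedKernel μ ψ δ s s ∂haarF F = 1 := by
  have h1 := integral_latticeGroup_swap μ (fun h s => orbitKernel ψ δ h s s)
    (continuous_orbitKernel_diag hψ) (ord δ) (-ord (2 : F))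
  refine h1.symm.trans ?_
  have h2 : ∀ h ∈ ((latticeGroup (ord δ) 0 : Subgroup SL(2, F)) : Set SL(2, F)),
      ∫ s in primePow F (-ord (2 : F)), orbitKernel ψ δ h s s ∂haarF F = 1 := by
    intro h hh
    rw [← innerF_orbitVec_self hψ h, innerF, (isBounded_orbitVec hψ hh).integral_eq]
    simp only [orbitKernel, mul_comm]
  rw [setIntegral_congr_fun (isOpen_latticeGroup _ _).measurableSet h2, setIntegral_const,
    Measure.real, hμ]
  simp

/-- The diagonal value of the averaged kernel: by the action of a Weyl element it is the average of
the values at the classes `s ∈ ½ 𝔬 / 𝔬`, and these add up to one. -/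
lemma averagedKernel_zero_zero
    (hμ : μ ((latticeGroup (ord δ) 0 : Subgroup SL(2, F)) : Set SL(2, F)) = 1) :
    averagedKernel μ ψ δ 0 0 = nabs (2 : F) := by
  have h0 := ord_two_nonneg (F := F)
  have hδ := hψ.ne_zero
  have hw : weylMat δ hδ ∈ latticeGroup (ord δ) 0 := by
    simp [mem_latticeGroup, mem_primePow_of_ne (inv_ne_zero hδ), mem_primePow_of_ne hδ]
  rw [averagedKernel_eq_integral_mul_right hψ μ hw,
    setIntegral_congr_fun (isOpen_latticeGroup _ _).measurableSet
      fun h hh => orbitKernel_mul_weylMat hψ hh, integral_const_mul]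
  have h1 := integral_latticeGroup_swap μ
    (fun h s => ∫ t in primePow F (-ord (2 : F)), orbitKernel ψ δ h s t ∂haarF F)
    (continuous_integral_orbitKernel hψ _) (ord δ) (-ord (2 : F))
  rw [h1]
  have h2 : ∀ s, ∫ h in ((latticeGroup (ord δ) 0 : Subgroup SL(2, F)) : Set SL(2, F)),
      ∫ t in primePow F (-ord (2 : F)), orbitKernel ψ δ h s t ∂haarF F ∂μ =
      ∫ t in primePow F (-ord (2 : F)), averagedKernel μ ψ δ s t ∂haarF F := fun s =>
    integral_latticeGroup_swap μ (fun h t => orbitKernel ψ δ h s t) (continuous_orbitKernel_right hψ s)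
       (ord δ) (-ord (2 : F))
  have h3 : ∀ s ∈ primePow F (-ord (2 : F)),
      ∫ t in primePow F (-ord (2 : F)), averagedKernel μ ψ δ s t ∂haarF F =
        averagedKernel μ ψ δ s s := fun s hs => by
    refine setIntegral_translate (by omega) hs
      (fun t ht hts => averagedKernel_eq_zero hψ μ ht hts) fun t ht => ?_
    have := averagedKernel_add_right hψ μ (s := s) (t := s) ht
    rwa [add_sub_cancel] at this
  simp only [h2]
  rw [setIntegral_congr_fun (measurableSet_primePow _) h3, integral_averagedKernel_diag hψ μ hμ,
    mul_one]

/-- A case of Schur's orthogonality relations for the representation of `Λ` on the `𝔬`-periodic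
functions with support in `½ 𝔬`. -/
theorem integral_innerF_mul_innerF
    (hμ : μ ((latticeGroup (ord δ) 0 : Subgroup SL(2, F)) : Set SL(2, F)) = 1) {y : F → ℂ}
    (hy : IsBounded y (-ord (2 : F)) 0) :
    ∫ h in ((latticeGroup (ord δ) 0 : Subgroup SL(2, F)) : Set SL(2, F)),
      innerF y (orbitVec ψ δ h) * innerF (orbitVec ψ δ h) (phi0 F) ∂μ = nabs (2 : F) * y 0 := by
  have h0 := ord_two_nonneg (F := F)
  have h1 : ∀ h ∈ ((latticeGroup (ord δ) 0 : Subgroup SL(2, F)) : Set SL(2, F)),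
      innerF y (orbitVec ψ δ h) * innerF (orbitVec ψ δ h) (phi0 F) =
        ∫ s in primePow F (-ord (2 : F)), y s * orbitKernel ψ δ h s 0 ∂haarF F := by
    intro h hh
    rw [(isBounded_orbitVec hψ hh).innerF_phi0, innerF, hy.integral_eq, ← integral_mul_const]
    simp only [orbitKernel, mul_assoc]
  have hc : Continuous fun p : SL(2, F) × F => y p.2 * orbitKernel ψ δ p.1 p.2 0 :=
    (hy.continuous.comp continuous_snd).mul (continuous_orbitKernel_left hψ 0)
  rw [setIntegral_congr_fun (isOpen_latticeGroup _ _).measurableSet h1,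
    integral_latticeGroup_swap μ (fun h s => y s * orbitKernel ψ δ h s 0) hc]
  simp only [integral_const_mul]
  have h2 : ∫ s in primePow F (-ord (2 : F)), y s * averagedKernel μ ψ δ s 0 ∂haarF F =
      y 0 * averagedKernel μ ψ δ 0 0 := by
    refine setIntegral_translate (f := fun s => y s * averagedKernel μ ψ δ s 0) (by omega)
      (zero_mem_primePow _) (fun s hs hs0 => ?_) fun s hs => ?_
    · rw [averagedKernel_eq_zero hψ μ (zero_mem_primePow _), mul_zero]
      rwa [zero_sub, neg_mem_primePow, ← sub_zero s]
    · rw [sub_zero] at hs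
      have h1 := averagedKernel_add_left hψ μ (s := 0) (t := 0) hs
      have h2 := hy.inv 0 s hs
      rw [zero_add] at h1 h2
      simp only [h1, h2]
  rw [averagedKernel_zero_zero hψ μ hμ, mul_comm] at h2
  exact h2

end Orthogonality

/-! ### Conjugates of `Λ` and the two idempotents -/

section Idempotent

variable {F : Type*} [Field F] [ValuativeRel F] [TopologicalSpace F]
  [IsNonarchimedeanLocalField F]

/-- The conjugate `n Λ n⁻¹`, for `Λ` the group `latticeGroup D 0`. -/
noncomputable def conjGroup (D : ℤ) (n : SL(2, F)) : Subgroup SL(2, F) :=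
  (latticeGroup D 0).comap (MulAut.conj n⁻¹).toMonoidHom

@[simp]
lemma mem_conjGroup {D : ℤ} {n g : SL(2, F)} :
    g ∈ conjGroup D n ↔ n⁻¹ * g * n ∈ latticeGroup D 0 := by
  simp [conjGroup]

lemma isCompact_conjGroup (D : ℤ) (n : SL(2, F)) :
    IsCompact (conjGroup D n : Set SL(2, F)) := by
  have h : (conjGroup D n : Set SL(2, F)) = (fun h => n * h * n⁻¹) ''
      ((latticeGroup D 0 : Subgroup SL(2, F)) : Set SL(2, F)) := by
    ext g
    refine ⟨fun hg => ⟨_, mem_conjGroup.1 hg, by simp [mul_assoc]⟩, ?_⟩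
    rintro ⟨h, hh, rfl⟩
    simpa [mul_assoc] using hh
  rw [h]
  exact (isCompact_latticeGroup D 0).image
    ((continuous_const.mul continuous_id).mul continuous_const)

lemma latticeGroup_le_conjGroup_one (D : ℤ) (k : ℕ) : latticeGroup D k ≤ conjGroup D (1 : SL(2, F)) :=
  fun g hg => by simpa using latticeGroup_anti D (Nat.zero_le k) hg

lemma latticeGroup_le_conjGroup_weylMat [CharZero F] {δ : F} (hδ : 2 * δ ≠ 0) :
    latticeGroup (ord δ) (2 * (ord (2 : F)).toNat) ≤ conjGroup (ord δ) (weylMat (2 * δ) hδ) := by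
  have h0 := ord_two_nonneg (F := F)
  have hδ' : δ ≠ 0 := right_ne_zero_of_mul hδ
  rintro g ⟨h00, h11, h01, h10⟩
  have ha : (2 * δ) ^ 2 ∈ primePow F (2 * (ord (2 : F) + ord δ)) :=
    (mem_primePow_of_ne (pow_ne_zero 2 hδ)).2 (by
      rw [ord_pow, ord_mul two_ne_zero hδ']; push_cast; omega)
  have ha' : ((2 * δ) ^ 2)⁻¹ ∈ primePow F (-(2 * (ord (2 : F) + ord δ))) :=
    (mem_primePow_of_ne (inv_ne_zero (pow_ne_zero 2 hδ))).2 (by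
      rw [ord_inv, ord_pow, ord_mul two_ne_zero hδ']; push_cast; omega)
  have e00 : ((weylMat (2 * δ) hδ)⁻¹ * g * weylMat (2 * δ) hδ).1 0 0 = g.1 1 1 := by
    simp only [sl_mul_apply, sl_inv_00, sl_inv_01, weylMat_00, weylMat_10, weylMat_01, weylMat_11]
    field_simp
    ring
  have e11 : ((weylMat (2 * δ) hδ)⁻¹ * g * weylMat (2 * δ) hδ).1 1 1 = g.1 0 0 := by
    simp only [sl_mul_apply, sl_inv_10, sl_inv_11, weylMat_00, weylMat_10, weylMat_01, weylMat_11]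
    field_simp
    ring
  have e01 : ((weylMat (2 * δ) hδ)⁻¹ * g * weylMat (2 * δ) hδ).1 0 1 =
      -(g.1 1 0 * ((2 * δ) ^ 2)⁻¹) := by
    simp only [sl_mul_apply, sl_inv_00, sl_inv_01, weylMat_01, weylMat_11]
    field_simp
    ring
  have e10 : ((weylMat (2 * δ) hδ)⁻¹ * g * weylMat (2 * δ) hδ).1 1 0 =
      -(g.1 0 1 * (2 * δ) ^ 2) := by
    simp only [sl_mul_apply, sl_inv_10, sl_inv_11, weylMat_00, weylMat_10]
    ring
  rw [mem_conjGroup, mem_latticeGroup, e00, e11, e01, e10, neg_mem_primePow, neg_mem_primePow]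
  exact ⟨h11, h00, mul_mem_of_eq h10 ha' (by push_cast; omega),
    mul_mem_of_eq h01 ha (by push_cast; omega)⟩

variable [MeasurableSpace F] [BorelSpace F] [CharZero F] {ψ : AddChar F ℂ} {δ : F}
  (hψ : HasConductor ψ δ)
include hψ

omit [CharZero F] hψ in
lemma innerF_mul_innerF_smul {z : ℂ} (hz : z * conj z = 1) (y v φ : F → ℂ) :
    innerF y (z • v) * innerF (z • v) φ = innerF y v * innerF v φ := by
  rw [innerF_smul_left, innerF_smul_right]
  linear_combination (innerF y v * innerF v φ) * hz

lemma exists_orbitVec_conj {n : SL(2, F)} (hn : n ∈ eigenGroup hψ) (k : SL(2, F)) :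
    ∃ z : ℂ, z * conj z = 1 ∧
      orbitVec ψ δ (n * k * n⁻¹) = z • weil ψ δ (bracket n) (orbitVec ψ δ k) := by
  obtain ⟨z, hz, e⟩ := exists_orbitVec_mul_left hψ hn (k * n⁻¹)
  refine ⟨z * ((kubota n⁻¹⁻¹ k⁻¹ : ℤ) : ℂ), ?_, ?_⟩
  · rw [map_mul, map_intCast (starRingEnd ℂ)]
    linear_combination z * conj z * sign_sq (kubota n⁻¹⁻¹ k⁻¹) + hz
  · rw [mul_assoc, e, orbitVec_mul hψ, smul_smul, inv_inv]

omit [CharZero F] hψ in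
lemma weil_bracket_inv_phi0 (h : SL(2, F)) : ∃ z : ℂ, z * conj z = 1 ∧
    weil ψ δ (bracket h)⁻¹ (phi0 F) = z • orbitVec ψ δ h := by
  refine ⟨((bracket h)⁻¹.ζ : ℤ), ?_, ?_⟩
  · rw [map_intCast (starRingEnd ℂ), sign_sq]
  · rw [weil_eq_smul, orbitVec, Mp.inv_g, bracket_g]

/-- The integrand of the convolution square, in terms of the vectors `f_h = ω_ψ([h⁻¹]) φ₀`. -/
lemma coeffOn_mul_coeffOn {K : Subgroup SL(2, F)} {x : Mp F} (hx : x.g ∈ K) {h : SL(2, F)}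
    (hh : h ∈ K) : coeffOn ψ δ K (x * (bracket h)⁻¹) * coeffOn ψ δ K (bracket h) =
      ((resCard F : ℂ) ^ ord (2 : F)) ^ 2 * (innerF (weil ψ δ x⁻¹ (phi0 F)) (orbitVec ψ δ h) *
        innerF (orbitVec ψ δ h) (phi0 F)) := by
  have hφ := isSchwartz_phi0 (F := F)
  obtain ⟨z, hz, e⟩ := weil_bracket_inv_phi0 h
  rw [coeffOn_of_mem (by simpa using mul_mem hx (inv_mem hh)), coeffOn_of_mem (by simpa using hh),
    weil_mul hψ _ _ hφ, innerF_weil_right hψ _ hφ hφ, e,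
    innerF_weil_right hψ _ hφ ((isSchwartz_orbitVec hψ h).smul z),
    ← innerF_mul_innerF_smul hz]
  ring

variable [MeasurableSpace SL(2, F)] [BorelSpace SL(2, F)] {μ : Measure SL(2, F)}
  [μ.IsHaarMeasure]

omit [CharZero F] hψ [MeasurableSpace SL(2, F)] [BorelSpace SL(2, F)] in
lemma coeffOn_eq_zero_of_mul {K : Subgroup SL(2, F)} {x : Mp F} (hx : x.g ∉ K) (h : SL(2, F)) :
    coeffOn ψ δ K (x * (bracket h)⁻¹) * coeffOn ψ δ K (bracket h) = 0 := by
  by_cases hh : h ∈ K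
  · rw [coeffOn_of_notMem, zero_mul]
    simpa using mt (mul_mem_cancel_right (inv_mem hh)).1 hx
  · rw [coeffOn_of_notMem (x := bracket h) hh, mul_zero]

/-- The matrix coefficient `q^e (φ₀, ω_ψ(g) φ₀)` on `n Λ n⁻¹` is idempotent when `φ₀` is an
eigenvector of `ω_ψ([n])`: conjugation by `n` reduces this to the orthogonality relations on `Λ`. -/
theorem conv_coeffOn_conjGroup
    (hμ : μ ((latticeGroup (ord δ) 0 : Subgroup SL(2, F)) : Set SL(2, F)) = 1) {n : SL(2, F)}
    (hn : n ∈ eigenGroup hψ) (hn' : RightInvariantUnder μ n) :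
    conv μ (coeffOn ψ δ (conjGroup (ord δ) n)) (coeffOn ψ δ (conjGroup (ord δ) n)) =
      coeffOn ψ δ (conjGroup (ord δ) n) := by
  have hφ := isSchwartz_phi0 (F := F)
  funext x
  by_cases hx : x.g ∈ conjGroup (ord δ) n
  swap
  · simp only [conv, coeffOn_eq_zero_of_mul hx, integral_zero, coeffOn_of_notMem hx]
  set w : Mp F := bracket n with hw
  have hwe : w⁻¹.g ∈ eigenGroup hψ := by simpa [hw] using inv_mem hn
  set z : ℂ := (eps ψ δ w⁻¹)⁻¹ with hz
  have hzw : weil ψ δ w⁻¹ (phi0 F) = z • phi0 F := weil_phi0 hψ hwe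
  have hzz : z * conj z = 1 := by
    rw [hz, map_inv₀, ← mul_inv, eps_mul_conj hψ hwe, inv_one]
  set y : F → ℂ := weil ψ δ (w⁻¹ * x⁻¹ * w) (phi0 F) with hy
  -- `z • y` is the translate by `w⁻¹` of the vector `ω_ψ(x⁻¹) φ₀`
  have hyx : weil ψ δ w⁻¹ (weil ψ δ x⁻¹ (phi0 F)) = z • y := by
    have h1 : phi0 F = z • weil ψ δ w (phi0 F) := by
      rw [← weil_smul, ← hzw, weil_weil_inv hψ w hφ]
    rw [hy, weil_mul hψ _ _ hφ, weil_mul hψ _ _ (hφ.weil hψ w), ← weil_smul, ← weil_smul, ← h1]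
  have hys : IsSchwartz y := hφ.weil hψ _
  have hyb : IsBounded y (-ord (2 : F)) 0 := by
    refine isBounded_phi0_half.weil_of_mem hψ ?_
    have := inv_mem (mem_conjGroup.1 hx)
    simpa [hw, mul_assoc] using this
  have hx0 : coeffOn ψ δ (conjGroup (ord δ) n) x = (resCard F : ℂ) ^ ord (2 : F) * y 0 := by
    rw [coeffOn_of_mem hx, innerF_weil_right hψ _ hφ hφ,
      ← innerF_weil hψ w⁻¹ (hφ.weil hψ x⁻¹) hφ, hyx, hzw, innerF_smul_left, innerF_smul_right,
      hyb.innerF_phi0]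
    linear_combination ((resCard F : ℂ) ^ ord (2 : F) * y 0) * hzz
  set L : Subgroup SL(2, F) := latticeGroup (ord δ) 0 with hL
  set Q : ℂ := (resCard F : ℂ) ^ ord (2 : F) with hQ
  set Θ : SL(2, F) → ℂ := fun k => innerF y (orbitVec ψ δ k) * innerF (orbitVec ψ δ k) (phi0 F)
    with hΘ
  have hLo : IsOpen (L : Set SL(2, F)) := isOpen_latticeGroup _ _
  have hLc : IsCompact (L : Set SL(2, F)) := isCompact_latticeGroup _ _
  have hΘc : Continuous ((L : Set SL(2, F)).indicator Θ) := by
    refine Continuous.indicator (by simp [frontier_subgroup_eq_empty hLo]) ?_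
    refine continuous_of_left_invariant (isOpen_eigenGroup hψ) fun γ hγ k => ?_
    obtain ⟨u, hu, e⟩ := exists_orbitVec_mul_left hψ hγ k
    simp only [hΘ, e, innerF_mul_innerF_smul hu]
  have hΘs := hasCompactSupport_indicator hLo hLc Θ
  -- the integrand is the integrand of the orthogonality relations, transported by conjugation
  have key : ∀ h, coeffOn ψ δ (conjGroup (ord δ) n) (x * (bracket h)⁻¹) *
      coeffOn ψ δ (conjGroup (ord δ) n) (bracket h) =
        Q ^ 2 * (L : Set SL(2, F)).indicator Θ (n⁻¹ * (h * n)) := by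
    intro h
    by_cases hh : h ∈ conjGroup (ord δ) n
    · have hk : n⁻¹ * (h * n) ∈ L := by rw [← mul_assoc]; exact mem_conjGroup.1 hh
      obtain ⟨u, hu, e⟩ := exists_orbitVec_conj hψ hn (n⁻¹ * (h * n))
      have hs := isSchwartz_orbitVec hψ (n⁻¹ * (h * n))
      have e' : n * (n⁻¹ * (h * n)) * n⁻¹ = h := by group
      rw [e'] at e
      rw [coeffOn_mul_coeffOn hψ hx hh, Set.indicator_of_mem hk, e, innerF_mul_innerF_smul hu,
        innerF_weil_right hψ _ (hφ.weil hψ _) hs, innerF_weil_left hψ _ hs hφ, ← hw, hyx, hzw,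
        innerF_smul_left, innerF_smul_right]
      simp only [hΘ]
      linear_combination (Q ^ 2 * (innerF y (orbitVec ψ δ (n⁻¹ * (h * n))) *
        innerF (orbitVec ψ δ (n⁻¹ * (h * n))) (phi0 F))) * hzz
    · have hk : n⁻¹ * (h * n) ∉ L := by rw [← mul_assoc]; exact mt mem_conjGroup.2 hh
      rw [Set.indicator_of_notMem hk, coeffOn_of_notMem (x := bracket h) hh, mul_zero, mul_zero]
  have hint : ∫ h, (L : Set SL(2, F)).indicator Θ (n⁻¹ * (h * n)) ∂μ = nabs (2 : F) * y 0 := by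
    rw [hn' (fun h => (L : Set SL(2, F)).indicator Θ (n⁻¹ * h))
        (hΘc.comp (continuous_const_mul n⁻¹)) (hΘs.comp_homeomorph (Homeomorph.mulLeft n⁻¹)),
      integral_mul_left_eq_self, integral_indicator hLo.measurableSet]
    exact integral_innerF_mul_innerF hψ μ hμ hyb
  have hq : Q * (nabs (2 : F) : ℂ) = 1 := by
    have hq0 : (resCard F : ℂ) ≠ 0 := by
      exact_mod_cast (lt_trans one_pos (one_lt_resCard F)).ne'
    rw [hQ, nabs, if_neg two_ne_zero]
    push_cast
    rw [← zpow_add₀ hq0, add_neg_cancel, zpow_zero]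
  simp only [conv, key]
  rw [integral_const_mul, hint, hx0]
  linear_combination (Q * y 0) * hq

omit [CharZero F] hψ [MeasurableSpace SL(2, F)] [BorelSpace SL(2, F)] in
lemma eK_eq_coeffOn (p : ℕ) [Fact p.Prime] [Algebra ℚ_[p] F]
    (hc : different F p = primePow F (ord δ)) :
    eK p ψ δ = coeffOn ψ δ (conjGroup (ord δ) 1) := by
  funext x
  have h : x ∈ tilde (Lam F p) ↔ x.g ∈ conjGroup (ord δ) 1 := by
    rw [Lam_eq p hc, mem_tilde, mem_conjGroup]
    simp
  by_cases hx : x.g ∈ conjGroup (ord δ) 1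
  · rw [coeffOn_of_mem hx, eK, if_pos (h.2 hx)]
  · rw [coeffOn_of_notMem hx, eK, if_neg (mt h.1 hx)]

omit [MeasurableSpace SL(2, F)] [BorelSpace SL(2, F)] in
/-- Conjugation by `w_{2δ}` only moves the support of the matrix coefficient, because `φ₀` is an
eigenvector of `ω_ψ(w_{2δ})`. -/
lemma EK_eq_coeffOn (p : ℕ) [Fact p.Prime] [Algebra ℚ_[p] F]
    (hc : different F p = primePow F (ord δ)) :
    EK p ψ δ hψ.ne_zero = coeffOn ψ δ
      (conjGroup (ord δ) (weylMat (2 * δ) (mul_ne_zero two_ne_zero hψ.ne_zero))) := by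
  have hφ := isSchwartz_phi0 (F := F)
  funext x
  set n := weylMat (2 * δ) (mul_ne_zero two_ne_zero hψ.ne_zero) with hn
  have hw : weil ψ δ (bracket n) (phi0 F) = (eps ψ δ (bracket n))⁻¹ • phi0 F :=
    weil_phi0 hψ (weylMat_mem_eigenGroup hψ)
  have hz := eps_mul_conj hψ (x := bracket n) (weylMat_mem_eigenGroup hψ)
  have e : EK p ψ δ hψ.ne_zero x = eK p ψ δ ((bracket n)⁻¹ * x * bracket n) := rfl
  have hg : ((bracket n)⁻¹ * x * bracket n).g = n⁻¹ * x.g * n := by simp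
  rw [e, eK_eq_coeffOn p hc]
  by_cases hx : x.g ∈ conjGroup (ord δ) n
  · have hx' : ((bracket n)⁻¹ * x * bracket n).g ∈ conjGroup (ord δ) 1 := by
      rw [hg]
      simpa using hx
    rw [coeffOn_of_mem hx, coeffOn_of_mem hx', weil_mul hψ _ _ hφ,
      weil_mul hψ _ _ (hφ.weil hψ _), ← innerF_weil_left hψ _ hφ ((hφ.weil hψ _).weil hψ _), hw,
      weil_smul, innerF_smul_left, innerF_smul_right, map_inv₀]
    have : (eps ψ δ (bracket n))⁻¹ * (conj (eps ψ δ (bracket n)))⁻¹ = 1 := by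
      rw [← mul_inv, hz, inv_one]
    linear_combination ((resCard F : ℂ) ^ ord (2 : F) *
      innerF (phi0 F) (weil ψ δ x (phi0 F))) * this
  · have hx' : ((bracket n)⁻¹ * x * bracket n).g ∉ conjGroup (ord δ) 1 := by
      rw [hg]
      simpa using hx
    rw [coeffOn_of_notMem hx, coeffOn_of_notMem hx']

omit [MeasurableSpace F] [BorelSpace F] [CharZero F] hψ in
lemma rightInvariantUnder_weylMat (a : F) (ha : a ≠ 0) :
    RightInvariantUnder μ (weylMat a ha) := by
  refine rightInvariantUnder_of_sq_central (isOpen_latticeGroup 0 0) (isCompact_latticeGroup 0 0)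
    fun h => ?_
  -- the square of the matrix is `-1`
  apply sl_ext <;> simp [sl_mul_apply, ha]

end Idempotent

end Metaplectic

theorem proposition3p9 (p : ℕ) [Fact p.Prime]
    {F : Type*} [Field F] [ValuativeRel F] [TopologicalSpace F] [IsNonarchimedeanLocalField F]
    [Algebra ℚ_[p] F] [ValuativeExtension ℚ_[p] F] [FiniteDimensional ℚ_[p] F]
    [MeasurableSpace F] [BorelSpace F] [MeasurableSpace SL(2, F)] [BorelSpace SL(2, F)]
    -- the character `ψ`, whose order is the order `c` of the different, and `δ` of order `c`
    (ψ : AddChar F ℂ) (c : ℕ) (hc : different F p = primePow F c) (hψ : HasOrder F ψ c)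
    (δ : F) (hδ : ord δ = c) (hδ0 : δ ≠ 0)
    -- the Haar measure for which `Λ` has volume one
    (μ : Measure SL(2, F)) [μ.IsHaarMeasure] (hμ : μ (Lam F p) = 1) :
    (eK p ψ δ ∈ heckeAlg p ψ δ ∧ conv μ (eK p ψ δ) (eK p ψ δ) = eK p ψ δ) ∧
    (EK p ψ δ hδ0 ∈ heckeAlg p ψ δ ∧ conv μ (EK p ψ δ hδ0) (EK p ψ δ hδ0) = EK p ψ δ hδ0) := by
  have : CharZero F := charZero_of_injective_algebraMap (algebraMap ℚ_[p] F).injective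
  have hcond : HasConductor ψ δ := hψ.hasConductor hδ0 hδ
  have hc' : different F p = primePow F (ord δ) := hc.trans (by rw [hδ])
  have hμ' : μ ((latticeGroup (ord δ) 0 : Subgroup SL(2, F)) : Set SL(2, F)) = 1 := by
    rw [← Lam_eq p hc', hμ]
  have h1 : RightInvariantUnder μ (1 : SL(2, F)) := fun f _ _ => by simp only [mul_one]
  rw [eK_eq_coeffOn p hc', EK_eq_coeffOn hcond p hc']
  exact ⟨⟨coeffOn_mem_heckeAlg hcond p hc' (latticeGroup_le_conjGroup_one _ _)
      (isCompact_conjGroup _ _), conv_coeffOn_conjGroup hcond hμ' (one_mem _) h1⟩,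
    coeffOn_mem_heckeAlg hcond p hc' (latticeGroup_le_conjGroup_weylMat _)
      (isCompact_conjGroup _ _), conv_coeffOn_conjGroup hcond hμ' (weylMat_mem_eigenGroup hcond)
      (rightInvariantUnder_weylMat _ _)⟩
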